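/- **Conventions.** $C^*$-algebras and their $*$-morphisms are unital; $\otimes$ denotes the spatial (minimal) tensor product of $C^*$-algebras and the exterior tensor product $E\otimes Q$ (a Hilbert $A\otimes Q$-module) of a Hilbert $A$-module $E$ with a $C^*$-algebra $Q$; $\odot$ denotes algebraic tensor products. A *Woronowicz $C^*$-algebra* is a $C^*$-algebra $Q$ with a $*$-morphism $\Delta:Q\to Q\otimes Q$ such that $(\Delta\otimes \mathrm{id})\Delta=(\mathrm{id}\otimes\Delta)\Delta$ and both $\mathrm{span}\{\Delta(Q)(Q\otimes 1)\}$ and $\mathrm{span}\{\Delta(Q)(1\otimes Q)\}$ are dense in $Q\otimes Q$. A morphism $\mu:Q_0\to Q_1$ of Woronowicz $C^*$-algebras is a $*$-morphism with $(\mu\otimes\mu)\Delta_0=\Delta_1\mu$; the category of compact quantum groups is the opposite category. A matrix $(v_{ij})\in M_n(Q)$ is *multiplicative* if $\Delta(v_{ij})=\sum_k v_{ik}\otimes v_{kj}$ for all $i,j$. A *coaction* of $Q$ on a $C^*$-algebra $A$ is a $*$-morphism $\alpha:A\to A\otimes Q$ with $(\alpha\otimes\mathrm{id})\alpha=(\mathrm{id}\otimes\Delta)\alpha$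 and $\mathrm{span}\{\alpha(A)(1\otimes Q)\}$ dense in $A\otimes Q$. A *coaction* of $Q$ on a (right) Hilbert $A$-module $E$ is a pair $(\alpha,\beta)$ of a coaction $\alpha$ of $Q$ on $A$ and a linear map $\beta:E\to E\otimes Q$ such that $\mathrm{span}\{\beta(E)(1\otimes Q)\}$ is dense in $E\otimes Q$, $(\beta\otimes\mathrm{id})\beta=(\mathrm{id}\otimes\Delta)\beta$, $\langle\beta(\xi)|\beta(\eta)\rangle=\alpha(\langle\xi|\eta\rangle)$ and $\beta(\xi a)=\beta(\xi)\alpha(a)$ for all $\xi,\eta\in E$, $a\in A$. An *orthogonal filtration* $(\tau,(V_i)_{i\in I},J,\xi_0)$ of $E$ consists of a faithful state $\tau$ on $A$, finite-dimensional subspaces $V_i\subset E$ with $\tau(\langle\xi|\eta\rangle)=0$ for $\xi\in V_i,\eta\in V_j$, $i\ne j$, and with $\mathcal E_0=\sum_i V_i$ dense in $E$, an injective antilinear operator $J:\mathcal E_0\to\mathcal E_0$, and an element $\xi_0\in E$. A coaction $(\alpha,\beta)$ of $Q$ on $E$ is *filtration preserving* if $(\tau\otimes\mathrm{id})\alpha=\tau(\cdot)1_Q$,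 $\beta(V_i)\subset V_i\odot Q$ for all $i$, $(J\otimes *)\beta=\beta J$ on $\mathcal E_0$, and $\beta(\xi_0)=\xi_0\otimes 1_Q$. These coactions are the objects of a category $\mathcal C(E,\tau,(V_i),J,\xi_0)$, in which a morphism from $(Q_0,\alpha_0,\beta_0)$ to $(Q_1,\alpha_1,\beta_1)$ is a morphism $\mu:Q_0\to Q_1$ of Woronowicz $C^*$-algebras with $\alpha_1=(\mathrm{id}\otimes\mu)\alpha_0$ and $\beta_1=(\mathrm{id}\otimes\mu)\beta_0$. The *quantum symmetry group* of $E$ is the compact quantum group given by an initial object of this category. **Theorem.** Let $n\in\mathbb N$, let $A=\mathbb C$, let $E=\mathbb C^n$ with its canonical Hilbert space structure and canonical basis $(e_i)$, let $\tau=\mathrm{id}_{\mathbb C}$, $V_0=\mathbb C^n$ (the only subspace of the filtration), $\xi_0=0$, and let $J:\mathbb C^n\to\mathbb C^n$ be any invertible antilinear map, with matrix $P$ in the canonical basis, $J(e_j)=\sum_i P_{ij}e_i$. Then $(\mathrm{id}_{\mathbb C},(V_0),J,\xi_0)$ is an orthogonal filtration of $E$, and the following hold. 1. The free orthogonal quantum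 group of $P$ exists: there is a universal Woronowicz $C^*$-algebra $\mathcal A_o(P)$ generated by the entries of a multiplicative and unitary matrix $u=(u_{ij})\in M_n(\mathcal A_o(P))$ with $u=P\overline uP^{-1}$, where $\overline u=(u_{ij}^*)$. That is, for each Woronowicz $C^*$-algebra $R$ and each multiplicative and unitary $v\in M_n(R)$ with $v=P\overline vP^{-1}$ there is a unique morphism of Woronowicz $C^*$-algebras $\mu:\mathcal A_o(P)\to R$ with $\mu(u_{ij})=v_{ij}$ for all $i,j$. 2. For every such $(\mathcal A_o(P),u)$, the trivial coaction $\alpha_P:z\mapsto z\otimes 1$ of $\mathcal A_o(P)$ on $\mathbb C$ and the linear map $\beta_P:\mathbb C^n\to\mathbb C^n\otimes\mathcal A_o(P)$, $\beta_P(e_i)=\sum_k e_k\otimes u_{ki}$, form a filtration preserving coaction of $\mathcal A_o(P)$ on $E$, and $(\mathcal A_o(P),\alpha_P,\beta_P)$ is an initial object of $\mathcal C(E,\mathrm{id}_{\mathbb C},(V_0),J,\xi_0)$. 3. Conversely, if $(Q,\alpha,\beta)$ is an initial object of this category, there is a matrix $u\in M_n(Q)$ with $\beta(e_i)=\sum_k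 e_k\otimes u_{ki}$ for all $i$, and $Q$ with $u$ is the universal Woronowicz $C^*$-algebra described in 1. In other words, the quantum symmetry group of $E$ is the free orthogonal quantum group associated with $P$. -/

import Mathlib

open scoped TensorProduct
open UniformSpace

universe u v w

namespace CQG

/-! ### The spatial tensor product of two unital C⋆-algebras -/

noncomputable section Spatial

section Rep

variable {A : Type u} {B : Type v} [CStarAlgebra A] [CStarAlgebra B]
variable {H : Type u} [NormedAddCommGroup H] [InnerProductSpace ℂ H] [CompleteSpace H]
variable {K : Type v} [NormedAddCommGroup K] [InnerProductSpace ℂ K] [CompleteSpace K]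

/-- For representations `π` of `A` on `H` and `ρ` of `B` on `K`, the representation `π ⊗ ρ` of the
algebraic tensor product `A ⊙ B` by bounded operators on the (algebraic) tensor product of the
Hilbert spaces `H` and `K`, `(π ⊗ ρ)(a ⊗ b) = π(a) ⊗ ρ(b)`.  Operator norms do not change when
one passes to the completed Hilbert space tensor product. -/
def tensorRep (π : A →⋆ₐ[ℂ] (H →L[ℂ] H)) (ρ : B →⋆ₐ[ℂ] (K →L[ℂ] K)) :
    A ⊗[ℂ] B →ₐ[ℂ] (H ⊗[ℂ] K →L[ℂ] H ⊗[ℂ] K) :=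
  Algebra.TensorProduct.algHomOfLinearMapTensorProduct
    (TensorProduct.lift (LinearMap.mk₂ ℂ (fun a b => TensorProduct.mapL (π a) (ρ b))
      (fun _ _ _ => by rw [map_add, TensorProduct.mapL_add_left])
      (fun _ _ _ => by rw [map_smul, TensorProduct.mapL_smul_left])
      (fun _ _ _ => by rw [map_add, TensorProduct.mapL_add_right])
      (fun _ _ _ => by rw [map_smul, TensorProduct.mapL_smul_right])))
    (fun a₁ a₂ b₁ b₂ => by simp [TensorProduct.mapL_mul])
    (by
      simp only [TensorProduct.lift.tmul, LinearMap.mk₂_apply, map_one]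
      exact TensorProduct.mapL_id_id)

@[simp]
theorem tensorRep_tmul (π : A →⋆ₐ[ℂ] (H →L[ℂ] H)) (ρ : B →⋆ₐ[ℂ] (K →L[ℂ] K)) (a : A) (b : B) :
    tensorRep π ρ (a ⊗ₜ b) = TensorProduct.mapL (π a) (ρ b) := by
  rfl

theorem tensorRep_star (π : A →⋆ₐ[ℂ] (H →L[ℂ] H)) (ρ : B →⋆ₐ[ℂ] (K →L[ℂ] K)) (x : A ⊗[ℂ] B)
    (v w : H ⊗[ℂ] K) :
    inner ℂ (tensorRep π ρ (star x) v) w = inner ℂ v (tensorRep π ρ x w) := by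
  induction x with
  | zero => simp
  | add x y hx hy => simp only [star_add, map_add, add_apply, inner_add_left,
      inner_add_right, hx, hy]
  | tmul a b =>
    induction v with
    | zero => simp
    | add x y hx hy => simp only [map_add, inner_add_left, hx, hy]
    | tmul h k =>
      induction w with
      | zero => simp
      | add x y hx hy => simp only [map_add, inner_add_right, hx, hy]
      | tmul h' k' =>
        simp only [TensorProduct.star_tmul, tensorRep_tmul, TensorProduct.mapL_tmul,
          TensorProduct.inner_tmul, map_star, ContinuousLinearMap.star_eq_adjoint,
          ContinuousLinearMap.adjoint_inner_left]

theorem tensorRep_sq_le (π : A →⋆ₐ[ℂ] (H →L[ℂ] H)) (ρ : B →⋆ₐ[ℂ] (K →L[ℂ] K)) (x : A ⊗[ℂ] B) :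
    ‖tensorRep π ρ x‖ ^ 2 ≤ ‖tensorRep π ρ (star x * x)‖ := by
  have h : ‖tensorRep π ρ x‖ ≤ √‖tensorRep π ρ (star x * x)‖ := by
    refine ContinuousLinearMap.opNorm_le_bound _ (Real.sqrt_nonneg _) fun v => ?_
    refine le_of_sq_le_sq ?_ (by positivity)
    rw [mul_pow, Real.sq_sqrt (ContinuousLinearMap.opNorm_nonneg _)]
    have h1 : ‖tensorRep π ρ x v‖ ^ 2 = RCLike.re (inner ℂ (tensorRep π ρ (star x * x) v) v) := by
      have h2 : tensorRep π ρ (star x * x) v = tensorRep π ρ (star x) (tensorRep π ρ x v) := by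
        rw [map_mul]; rfl
      rw [h2, tensorRep_star]
      exact (inner_self_eq_norm_sq (𝕜 := ℂ) (tensorRep π ρ x v)).symm
    rw [h1]
    calc RCLike.re (inner ℂ (tensorRep π ρ (star x * x) v) v)
        ≤ ‖tensorRep π ρ (star x * x) v‖ * ‖v‖ :=
          re_inner_le_norm (𝕜 := ℂ) (tensorRep π ρ (star x * x) v) v
      _ ≤ (‖tensorRep π ρ (star x * x)‖ * ‖v‖) * ‖v‖ := by
          gcongr; exact ContinuousLinearMap.le_opNorm _ _
      _ = _ := by ring
  calc ‖tensorRep π ρ x‖ ^ 2 ≤ (√‖tensorRep π ρ (star x * x)‖) ^ 2 := by gcongr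
    _ = _ := Real.sq_sqrt (ContinuousLinearMap.opNorm_nonneg _)

end Rep

section Norm

variable {A : Type u} {B : Type v} [CStarAlgebra A] [CStarAlgebra B]

/-- The set of all the norms `‖(π ⊗ ρ)(x)‖`, where `π` and `ρ` are representations of `A` and `B`
on Hilbert spaces. -/
def tensorRepNorms (x : A ⊗[ℂ] B) : Set ℝ :=
  {r | ∃ (H : Type u) (_ : NormedAddCommGroup H) (_ : InnerProductSpace ℂ H) (_ : CompleteSpace H)
    (K : Type v) (_ : NormedAddCommGroup K) (_ : InnerProductSpace ℂ K) (_ : CompleteSpace K)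
    (π : A →⋆ₐ[ℂ] (H →L[ℂ] H)) (ρ : B →⋆ₐ[ℂ] (K →L[ℂ] K)), r = ‖tensorRep π ρ x‖}

/-- The spatial (minimal) C⋆-norm on `A ⊙ B`: the supremum of `‖(π ⊗ ρ)(x)‖` over all
representations `π` of `A` and `ρ` of `B`. -/
def spatialNorm (x : A ⊗[ℂ] B) : ℝ := sSup (tensorRepNorms x)

theorem bddAbove_tensorRepNorms (x : A ⊗[ℂ] B) : BddAbove (tensorRepNorms x) := by
  induction x with
  | zero =>
    refine ⟨0, ?_⟩
    rintro _ ⟨H, _, _, _, K, _, _, _, π, ρ, rfl⟩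
    rw [map_zero]
    exact ContinuousLinearMap.opNorm_zero.le
  | add x y hx hy =>
    obtain ⟨C, hC⟩ := hx
    obtain ⟨D, hD⟩ := hy
    refine ⟨C + D, ?_⟩
    rintro _ ⟨H, _, _, _, K, _, _, _, π, ρ, rfl⟩
    rw [map_add]
    exact (ContinuousLinearMap.opNorm_add_le _ _).trans (add_le_add (hC ⟨H, _, _, _, K, _, _, _, π, ρ, rfl⟩)
      (hD ⟨H, _, _, _, K, _, _, _, π, ρ, rfl⟩))
  | tmul a b =>
    refine ⟨‖a‖ * ‖b‖, ?_⟩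
    rintro _ ⟨H, _, _, _, K, _, _, _, π, ρ, rfl⟩
    rw [tensorRep_tmul]
    refine (TensorProduct.norm_mapL_le _ _).trans ?_
    gcongr
    · exact NonUnitalStarAlgHom.norm_apply_le π a
    · exact NonUnitalStarAlgHom.norm_apply_le ρ b

theorem spatialNorm_nonneg (x : A ⊗[ℂ] B) : 0 ≤ spatialNorm x :=
  Real.sSup_nonneg (by rintro _ ⟨H, _, _, _, K, _, _, _, π, ρ, rfl⟩; exact ContinuousLinearMap.opNorm_nonneg _)

theorem norm_tensorRep_le {H : Type u} [NormedAddCommGroup H] [InnerProductSpace ℂ H]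
    [CompleteSpace H] {K : Type v} [NormedAddCommGroup K] [InnerProductSpace ℂ K] [CompleteSpace K]
    (π : A →⋆ₐ[ℂ] (H →L[ℂ] H)) (ρ : B →⋆ₐ[ℂ] (K →L[ℂ] K)) (x : A ⊗[ℂ] B) :
    ‖tensorRep π ρ x‖ ≤ spatialNorm x :=
  le_csSup (bddAbove_tensorRepNorms x) ⟨H, _, _, _, K, _, _, _, π, ρ, rfl⟩

theorem spatialNorm_le {x : A ⊗[ℂ] B} {C : ℝ} (hC : 0 ≤ C)
    (h : ∀ r ∈ tensorRepNorms x, r ≤ C) : spatialNorm x ≤ C :=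
  Real.sSup_le h hC

theorem spatialNorm_tmul_le (a : A) (b : B) : spatialNorm (a ⊗ₜ[ℂ] b) ≤ ‖a‖ * ‖b‖ := by
  refine spatialNorm_le (by positivity) ?_
  rintro _ ⟨H, _, _, _, K, _, _, _, π, ρ, rfl⟩
  rw [tensorRep_tmul]
  refine (TensorProduct.norm_mapL_le _ _).trans ?_
  gcongr
  · exact NonUnitalStarAlgHom.norm_apply_le π a
  · exact NonUnitalStarAlgHom.norm_apply_le ρ b

theorem spatialNorm_zero : spatialNorm (0 : A ⊗[ℂ] B) = 0 := by
  refine le_antisymm (spatialNorm_le le_rfl ?_) (spatialNorm_nonneg _)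
  rintro _ ⟨H, _, _, _, K, _, _, _, π, ρ, rfl⟩
  rw [map_zero]
  exact ContinuousLinearMap.opNorm_zero.le

theorem spatialNorm_add_le (x y : A ⊗[ℂ] B) :
    spatialNorm (x + y) ≤ spatialNorm x + spatialNorm y := by
  refine spatialNorm_le (add_nonneg (spatialNorm_nonneg _) (spatialNorm_nonneg _)) ?_
  rintro _ ⟨H, _, _, _, K, _, _, _, π, ρ, rfl⟩
  rw [map_add]
  exact (ContinuousLinearMap.opNorm_add_le _ _).trans (add_le_add (norm_tensorRep_le π ρ x) (norm_tensorRep_le π ρ y))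

theorem spatialNorm_mul_le (x y : A ⊗[ℂ] B) :
    spatialNorm (x * y) ≤ spatialNorm x * spatialNorm y := by
  refine spatialNorm_le (mul_nonneg (spatialNorm_nonneg _) (spatialNorm_nonneg _)) ?_
  rintro _ ⟨H, _, _, _, K, _, _, _, π, ρ, rfl⟩
  rw [map_mul]
  exact (ContinuousLinearMap.opNorm_comp_le _ _).trans (mul_le_mul (norm_tensorRep_le π ρ x) (norm_tensorRep_le π ρ y)
    (ContinuousLinearMap.opNorm_nonneg _) (spatialNorm_nonneg _))

theorem spatialNorm_smul_le (c : ℂ) (x : A ⊗[ℂ] B) :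
    spatialNorm (c • x) ≤ ‖c‖ * spatialNorm x := by
  refine spatialNorm_le (mul_nonneg (norm_nonneg _) (spatialNorm_nonneg _)) ?_
  rintro _ ⟨H, _, _, _, K, _, _, _, π, ρ, rfl⟩
  rw [map_smul]
  refine (ContinuousLinearMap.opNorm_smul_le _ _).trans ?_
  exact mul_le_mul_of_nonneg_left (norm_tensorRep_le π ρ x) (norm_nonneg _)

theorem spatialNorm_neg (x : A ⊗[ℂ] B) : spatialNorm (-x) = spatialNorm x := by
  have h : ∀ y : A ⊗[ℂ] B, spatialNorm (-y) ≤ spatialNorm y := fun y => by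
    have := spatialNorm_smul_le (-1 : ℂ) y
    simpa using this
  refine le_antisymm (h x) ?_
  simpa using h (-x)

theorem spatialNorm_sq_le (x : A ⊗[ℂ] B) :
    spatialNorm x * spatialNorm x ≤ spatialNorm (star x * x) := by
  have h : spatialNorm x ≤ √(spatialNorm (star x * x)) := by
    refine spatialNorm_le (Real.sqrt_nonneg _) ?_
    rintro _ ⟨H, _, _, _, K, _, _, _, π, ρ, rfl⟩
    exact Real.le_sqrt_of_sq_le ((tensorRep_sq_le π ρ x).trans (norm_tensorRep_le π ρ _))
  calc spatialNorm x * spatialNorm x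
      ≤ √(spatialNorm (star x * x)) * √(spatialNorm (star x * x)) :=
        mul_le_mul h h (spatialNorm_nonneg _) (Real.sqrt_nonneg _)
    _ = _ := Real.mul_self_sqrt (spatialNorm_nonneg _)

theorem spatialNorm_star (x : A ⊗[ℂ] B) : spatialNorm (star x) = spatialNorm x := by
  have h : ∀ y : A ⊗[ℂ] B, spatialNorm y ≤ spatialNorm (star y) := fun y => by
    have h1 := (spatialNorm_sq_le y).trans (spatialNorm_mul_le _ _)
    rcases (spatialNorm_nonneg y).eq_or_lt with h0 | h0
    · rw [← h0]; exact spatialNorm_nonneg _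
    · exact le_of_mul_le_mul_right h1 h0
  refine le_antisymm ?_ (h x)
  simpa using h (star x)

end Norm

/-- The algebraic tensor product `A ⊙ B` of two C⋆-algebras, to be endowed with the spatial
C⋆-norm. -/
def AlgTensor (A : Type u) (B : Type v) [CStarAlgebra A] [CStarAlgebra B] : Type (max u v) :=
  A ⊗[ℂ] B

section AlgTensor

variable (A : Type u) (B : Type v) [CStarAlgebra A] [CStarAlgebra B]

instance : Ring (AlgTensor A B) := inferInstanceAs (Ring (A ⊗[ℂ] B))
instance : Algebra ℂ (AlgTensor A B) := inferInstanceAs (Algebra ℂ (A ⊗[ℂ] B))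
instance : StarRing (AlgTensor A B) := inferInstanceAs (StarRing (A ⊗[ℂ] B))
instance : StarModule ℂ (AlgTensor A B) := inferInstanceAs (StarModule ℂ (A ⊗[ℂ] B))

/-- The spatial norm as a ring seminorm. -/
def spatialRingSeminorm : RingSeminorm (AlgTensor A B) where
  toFun x := spatialNorm (A := A) (B := B) x
  map_zero' := spatialNorm_zero
  add_le' := spatialNorm_add_le
  neg' := spatialNorm_neg
  mul_le' := spatialNorm_mul_le

instance : SeminormedRing (AlgTensor A B) := (spatialRingSeminorm A B).toSeminormedRing

instance : NormedAlgebra ℂ (AlgTensor A B) where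
  norm_smul_le := spatialNorm_smul_le

variable {A B}

/-- The elementary tensor `a ⊗ b` of `A ⊙ B`. -/
def AlgTensor.tmul (a : A) (b : B) : AlgTensor A B := a ⊗ₜ[ℂ] b

theorem AlgTensor.norm_def (x : AlgTensor A B) : ‖x‖ = spatialNorm (A := A) (B := B) x := rfl

theorem AlgTensor.norm_star (x : AlgTensor A B) : ‖star x‖ = ‖x‖ := spatialNorm_star _

theorem AlgTensor.norm_sq_le (x : AlgTensor A B) : ‖x‖ * ‖x‖ ≤ ‖star x * x‖ := spatialNorm_sq_le _

instance : NormedStarGroup (AlgTensor A B) := ⟨fun x => (AlgTensor.norm_star x).le⟩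

end AlgTensor

/-- The spatial tensor product `A ⊗ B` of two C⋆-algebras: the completion of `A ⊙ B` for the
spatial C⋆-norm. -/
abbrev SpatialTensor (A : Type u) (B : Type v) [CStarAlgebra A] [CStarAlgebra B] :
    Type (max u v) :=
  Completion (AlgTensor A B)

namespace SpatialTensor

variable {A : Type u} {B : Type v} [CStarAlgebra A] [CStarAlgebra B]

instance : Star (SpatialTensor A B) := ⟨Completion.map star⟩

theorem uniformContinuous_star' : UniformContinuous (star : AlgTensor A B → AlgTensor A B) :=
  (starNormedAddGroupHom (E := AlgTensor A B)).uniformContinuous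

theorem coe_star (x : AlgTensor A B) : ((star x : AlgTensor A B) : SpatialTensor A B) = star (x : SpatialTensor A B) :=
  (Completion.map_coe uniformContinuous_star' x).symm

theorem continuous_star' : Continuous (star : SpatialTensor A B → SpatialTensor A B) :=
  Completion.continuous_map

instance : StarRing (SpatialTensor A B) where
  star_involutive x := by
    induction x using Completion.induction_on with
    | hp => exact isClosed_eq (continuous_star'.comp continuous_star') continuous_id
    | ih x => rw [← coe_star, ← coe_star, star_star]
  star_mul x y := by
    induction x, y using Completion.induction_on₂ with
    | hp =>
      exact isClosed_eq (continuous_star'.comp continuous_mul)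
        ((continuous_star'.comp continuous_snd).mul (continuous_star'.comp continuous_fst))
    | ih x y => rw [← coe_star, ← coe_star, ← Completion.coe_mul, ← coe_star, star_mul,
        Completion.coe_mul]
  star_add x y := by
    induction x, y using Completion.induction_on₂ with
    | hp =>
      exact isClosed_eq (continuous_star'.comp continuous_add)
        ((continuous_star'.comp continuous_fst).add (continuous_star'.comp continuous_snd))
    | ih x y => rw [← coe_star, ← coe_star, ← Completion.coe_add, ← coe_star, star_add,
        Completion.coe_add]

instance : NormedAlgebra ℂ (SpatialTensor A B) where
  norm_smul_le := norm_smul_le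

instance : CStarAlgebra (SpatialTensor A B) where
  star_smul c x := by
    induction x using Completion.induction_on with
    | hp =>
      exact isClosed_eq (continuous_star'.comp (continuous_const_smul c))
        ((continuous_const_smul _).comp continuous_star')
    | ih x => rw [← coe_star, ← Completion.coe_smul, ← coe_star, star_smul, Completion.coe_smul]
  norm_mul_self_le x := by
    induction x using Completion.induction_on with
    | hp =>
      exact isClosed_le (continuous_norm.mul continuous_norm)
        (continuous_norm.comp (continuous_star'.mul continuous_id))
    | ih x =>
      rw [← coe_star, ← Completion.coe_mul, Completion.norm_coe, Completion.norm_coe]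
      exact AlgTensor.norm_sq_le x

/-- The elementary tensor `a ⊗ b`, as an element of the completed tensor product. -/
def tmul (a : A) (b : B) : SpatialTensor A B := (AlgTensor.tmul a b : AlgTensor A B)

end SpatialTensor

namespace AlgTensor

variable {A : Type u} {B : Type v} [CStarAlgebra A] [CStarAlgebra B]

theorem induction {p : AlgTensor A B → Prop} (h0 : p 0) (ht : ∀ (a : A) (x : B), p (tmul a x))
    (ha : ∀ z w, p z → p w → p (z + w)) (z : AlgTensor A B) : p z :=
  TensorProduct.induction_on (motive := p) z h0 ht ha

theorem tmul_mul_tmul (a a' : A) (x x' : B) :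
    tmul a x * tmul a' x' = tmul (a * a') (x * x') :=
  Algebra.TensorProduct.tmul_mul_tmul _ _ _ _

theorem star_tmul (a : A) (x : B) : star (tmul a x) = tmul (star a) (star x) :=
  TensorProduct.star_tmul _ _

theorem sum_tmul {S : Type*} [Fintype S] (f : S → A) (x : B) :
    tmul (∑ k, f k) x = ∑ k, tmul (f k) x :=
  TensorProduct.sum_tmul _ _ _

variable {A' : Type u} {B' : Type v} [CStarAlgebra A'] [CStarAlgebra B']

/-- The algebraic tensor product `f ⊙ g : A ⊙ B → A' ⊙ B'` of two ⋆-morphisms. -/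
def map (f : A →⋆ₐ[ℂ] A') (g : B →⋆ₐ[ℂ] B') : AlgTensor A B →ₐ[ℂ] AlgTensor A' B' :=
  Algebra.TensorProduct.map f.toAlgHom g.toAlgHom

theorem map_tmul (f : A →⋆ₐ[ℂ] A') (g : B →⋆ₐ[ℂ] B') (a : A) (b : B) :
    map f g (tmul a b) = tmul (f a) (g b) := rfl

theorem map_star' (f : A →⋆ₐ[ℂ] A') (g : B →⋆ₐ[ℂ] B') (x : AlgTensor A B) :
    map f g (star x) = star (map f g x) := by
  have key : ∀ x : A ⊗[ℂ] B, Algebra.TensorProduct.map f.toAlgHom g.toAlgHom (star x) =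
      star (Algebra.TensorProduct.map f.toAlgHom g.toAlgHom x) := by
    intro x
    induction x with
    | zero => simp
    | add x y hx hy => simp only [star_add, _root_.map_add, hx, hy]
    | tmul a b => simp [TensorProduct.star_tmul, map_star]
  exact key x

theorem norm_map_le (f : A →⋆ₐ[ℂ] A') (g : B →⋆ₐ[ℂ] B') (x : AlgTensor A B) :
    ‖map f g x‖ ≤ ‖x‖ := by
  refine spatialNorm_le (norm_nonneg _) ?_
  rintro _ ⟨H, _, _, _, K, _, _, _, π, ρ, rfl⟩
  have key : ∀ x : A ⊗[ℂ] B, tensorRep π ρ (Algebra.TensorProduct.map f.toAlgHom g.toAlgHom x) =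
      tensorRep (π.comp f) (ρ.comp g) x := by
    intro x
    induction x with
    | zero => simp
    | add x y hx hy => simp only [_root_.map_add, hx, hy]
    | tmul a b => simp
  calc _ = ‖tensorRep (π.comp f) (ρ.comp g) x‖ := congrArg norm (key x)
    _ ≤ _ := norm_tensorRep_le _ _ _

end AlgTensor

namespace SpatialTensor

variable {A : Type u} {B : Type v} [CStarAlgebra A] [CStarAlgebra B]
variable {A' : Type u} {B' : Type v} [CStarAlgebra A'] [CStarAlgebra B']

theorem uniformContinuous_map (f : A →⋆ₐ[ℂ] A') (g : B →⋆ₐ[ℂ] B') :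
    UniformContinuous (AlgTensor.map f g) :=
  ((AlgTensor.map f g).toLinearMap.mkContinuous 1
    (fun x => by simpa using AlgTensor.norm_map_le f g x)).uniformContinuous

/-- The tensor product `f ⊗ g : A ⊗ B → A' ⊗ B'` of two ⋆-morphisms. -/
def map (f : A →⋆ₐ[ℂ] A') (g : B →⋆ₐ[ℂ] B') : SpatialTensor A B →⋆ₐ[ℂ] SpatialTensor A' B' where
  toFun := Completion.map (AlgTensor.map f g)
  map_one' := by
    rw [← Completion.coe_one, Completion.map_coe (uniformContinuous_map f g), map_one,
      Completion.coe_one]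
  map_mul' x y := by
    induction x, y using Completion.induction_on₂ with
    | hp =>
      exact isClosed_eq (Completion.continuous_map.comp continuous_mul)
        (continuous_mul.comp ((Completion.continuous_map.comp continuous_fst).prodMk
          (Completion.continuous_map.comp continuous_snd)))
    | ih x y => simp only [← Completion.coe_mul, Completion.map_coe (uniformContinuous_map f g),
        map_mul]
  map_zero' := by
    rw [← Completion.coe_zero, Completion.map_coe (uniformContinuous_map f g), map_zero,
      Completion.coe_zero]
  map_add' x y := by
    induction x, y using Completion.induction_on₂ with
    | hp =>
      exact isClosed_eq (Completion.continuous_map.comp continuous_add)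
        (continuous_add.comp ((Completion.continuous_map.comp continuous_fst).prodMk
          (Completion.continuous_map.comp continuous_snd)))
    | ih x y => simp only [← Completion.coe_add, Completion.map_coe (uniformContinuous_map f g),
        map_add]
  commutes' c := by
    have h : ∀ (A : Type u) (B : Type v) [CStarAlgebra A] [CStarAlgebra B],
        algebraMap ℂ (SpatialTensor A B) c = ((algebraMap ℂ (AlgTensor A B) c : AlgTensor A B) :
          SpatialTensor A B) := fun A B _ _ => by
      rw [Algebra.algebraMap_eq_smul_one, Algebra.algebraMap_eq_smul_one, Completion.coe_smul,
        Completion.coe_one]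
    rw [h, h, Completion.map_coe (uniformContinuous_map f g), AlgHom.commutes]
  map_star' x := by
    induction x using Completion.induction_on with
    | hp =>
      exact isClosed_eq (Completion.continuous_map.comp continuous_star')
        (continuous_star'.comp Completion.continuous_map)
    | ih x => simp only [← coe_star, Completion.map_coe (uniformContinuous_map f g),
        AlgTensor.map_star']

theorem map_coe (f : A →⋆ₐ[ℂ] A') (g : B →⋆ₐ[ℂ] B') (x : AlgTensor A B) :
    map f g (x : SpatialTensor A B) = (AlgTensor.map f g x : AlgTensor A' B') :=
  Completion.map_coe (uniformContinuous_map f g) x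

end SpatialTensor

end Spatial


/-! ### Right Hilbert modules -/

/-- A right Hilbert `A`-module over a unital C⋆-algebra `A` (a right `A`-module being a module over
the opposite algebra): an `A`-valued inner product, linear in the second variable, such that
`‖x‖ = ‖⟨x | x⟩‖ ^ (1/2)` is a complete norm.  As that is assumed to be the norm of `E`,
`⟨x | x⟩ = 0` implies `x = 0`. Mathlib's `CStarModule` has the algebra act on the left instead. -/
class HilbertModule (A : Type u) (E : Type w) [CStarAlgebra A] [NormedAddCommGroup E]
    [NormedSpace ℂ E] [Module Aᵐᵒᵖ E] extends CompleteSpace E where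
  /-- The `A`-valued inner product `⟨x | y⟩`. -/
  ip : E → E → A
  ip_add_right : ∀ x y z, ip x (y + z) = ip x y + ip x z
  ip_smul_right : ∀ (c : ℂ) x y, ip x (c • y) = c • ip x y
  ip_op_smul_right : ∀ (a : A) x y, ip x (MulOpposite.op a • y) = ip x y * a
  star_ip : ∀ x y, star (ip x y) = ip y x
  ip_self_nonneg : ∀ x, ∃ b, ip x x = star b * b
  norm_eq : ∀ x, ‖x‖ = √‖ip x x‖

namespace HilbertModule

section Basic

variable {A : Type u} {E : Type w} [CStarAlgebra A] [NormedAddCommGroup E]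
  [NormedSpace ℂ E] [Module Aᵐᵒᵖ E] [HilbertModule A E]

theorem ip_add_left (x y z : E) : ip (A := A) (x + y) z = ip x z + ip y z := by
  rw [← star_ip, ip_add_right, star_add, star_ip, star_ip]

theorem ip_smul_left (c : ℂ) (x y : E) : ip (A := A) (c • x) y = star c • ip x y := by
  rw [← star_ip, ip_smul_right, star_smul, star_ip]

theorem ip_op_smul_left (a : A) (x y : E) :
    ip (A := A) (MulOpposite.op a • x) y = star a * ip x y := by
  rw [← star_ip, ip_op_smul_right, star_mul, star_ip]

variable (A E) in
/-- The inner product as a sesquilinear map. -/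
noncomputable def ipₛₗ : E →ₗ⋆[ℂ] E →ₗ[ℂ] A :=
  LinearMap.mk₂'ₛₗ _ _ (fun x y => ip x y) ip_add_left (fun c x y => ip_smul_left c x y)
    ip_add_right (fun c x y => ip_smul_right c x y)

theorem ipₛₗ_apply (x y : E) : ipₛₗ A E x y = ip x y := rfl

variable (A) in
theorem ext_ip {x y : E} (h : ∀ z, ip (A := A) z x = ip z y) : x = y := by
  have h1 : ip (A := A) (x - y) (x - y) = 0 := by
    rw [← ipₛₗ_apply, map_sub, ipₛₗ_apply, ipₛₗ_apply, h, sub_self]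
  have h2 : ‖x - y‖ = 0 := by rw [norm_eq (A := A), h1, norm_zero, Real.sqrt_zero]
  exact sub_eq_zero.1 (norm_eq_zero.1 h2)

theorem op_smul_complex_smul (a : A) (c : ℂ) (x : E) :
    MulOpposite.op a • (c • x) = c • (MulOpposite.op a • x) :=
  ext_ip A fun z => by
    rw [ip_op_smul_right, ip_smul_right, ip_smul_right, ip_op_smul_right, smul_mul_assoc]

theorem op_complex_smul_smul (a : A) (c : ℂ) (x : E) :
    MulOpposite.op (c • a) • x = c • (MulOpposite.op a • x) :=
  ext_ip A fun z => by
    rw [ip_op_smul_right, ip_smul_right, ip_op_smul_right, mul_smul_comm]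

variable (A E) in
/-- The right action `(x, a) ↦ x a` as a bilinear map. -/
noncomputable def actₗ : E →ₗ[ℂ] A →ₗ[ℂ] E :=
  LinearMap.mk₂ ℂ (fun x a => MulOpposite.op a • x) (fun _ _ _ => smul_add _ _ _)
    (fun c x a => op_smul_complex_smul a c x)
    (fun x a b => by rw [MulOpposite.op_add, add_smul]) (fun c x a => op_complex_smul_smul a c x)

theorem actₗ_apply (x : E) (a : A) : actₗ A E x a = MulOpposite.op a • x := rfl

theorem sum_star_mul_self_eq_zero {ι : Type*} [Fintype ι] {f : ι → A}
    (b : A) (h : star b * b + ∑ i, star (f i) * f i = 0) (i : ι) : f i = 0 := by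
  let _ := CStarAlgebra.spectralOrder A
  have _ := CStarAlgebra.spectralOrderedRing A
  have h0 : ∀ i, 0 ≤ star (f i) * f i := fun i => star_mul_self_nonneg _
  have h1 : ∑ i, star (f i) * f i ≤ 0 := by
    rw [← h]; exact le_add_of_nonneg_left (star_mul_self_nonneg b)
  have h2 : star (f i) * f i = 0 :=
    le_antisymm ((Finset.single_le_sum (fun i _ => h0 i) (Finset.mem_univ i)).trans h1) (h0 i)
  exact CStarRing.star_mul_self_eq_zero_iff _ |>.1 h2

theorem exists_neg_part {M : Type*} [CStarAlgebra M] (X : M) (hX : IsSelfAdjoint X) :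
    ∃ N S : M, star N = N ∧ N = star S * S ∧ N * X * N = -(N * N * N) ∧
      (N = 0 → ∃ Y : M, X = star Y * Y) := by
  let _ := CStarAlgebra.spectralOrder M
  have _ := CStarAlgebra.spectralOrderedRing M
  have hN0 : 0 ≤ X⁻ := CFC.negPart_nonneg X
  have h1 : X = X⁺ - X⁻ := (CFC.posPart_sub_negPart X hX).symm
  obtain ⟨S, hS⟩ := CStarAlgebra.nonneg_iff_eq_star_mul_self.1 hN0
  refine ⟨X⁻, S, (IsSelfAdjoint.of_nonneg hN0).star_eq, hS, ?_, fun h0 => ?_⟩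
  · have h2 : X⁻ * X⁺ = 0 := CFC.negPart_mul_posPart X
    calc X⁻ * X * X⁻ = X⁻ * (X⁺ - X⁻) * X⁻ := by rw [← h1]
      _ = _ := by rw [mul_sub, h2, zero_sub, neg_mul]
  · have hX0 : 0 ≤ X := by
      rw [h1, h0, sub_zero]
      exact CFC.posPart_nonneg X
    exact CStarAlgebra.nonneg_iff_eq_star_mul_self.1 hX0

/-- Gram matrices in Hilbert modules are positive. -/
theorem exists_gram_eq {ι : Type*} [Fintype ι] (ξ : ι → E) :
    ∃ Y : ι → ι → A, ∀ i j, ip (ξ i) (ξ j) = ∑ k, star (Y k i) * Y k j := by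
  classical
  let _ := CStarAlgebra.spectralOrder A
  have _ := CStarAlgebra.spectralOrderedRing A
  let X : CStarMatrix ι ι A := CStarMatrix.ofMatrix fun i j => ip (ξ i) (ξ j)
  have hX : IsSelfAdjoint X := by
    ext i j
    rw [CStarMatrix.star_apply]
    exact star_ip _ _
  obtain ⟨N, S, hNs, hS, hNX, hYX⟩ := exists_neg_part X hX
  have hM : star (S * N) * (S * N) = N * N * N := by
    rw [star_mul, hNs, mul_assoc, ← mul_assoc (star S), ← hS, mul_assoc]
  have hMz : S * N = 0 := by
    ext k j
    let η : E := ∑ i, MulOpposite.op (N i j) • ξ i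
    obtain ⟨b, hb⟩ := ip_self_nonneg (A := A) η
    have h1 : ip (A := A) η η = (N * X * N) j j := by
      have hη : η = ∑ i, actₗ A E (ξ i) (N i j) := rfl
      have h3 : ip (A := A) η η = ∑ x, ∑ i, star (N i j) * (ip (ξ i) (ξ x) * N x j) := by
        rw [← ipₛₗ_apply, hη, map_sum]
        refine Finset.sum_congr rfl fun x _ => ?_
        rw [map_sum, LinearMap.sum_apply]
        refine Finset.sum_congr rfl fun i _ => ?_
        rw [actₗ_apply, actₗ_apply, ipₛₗ_apply, ip_op_smul_left, ip_op_smul_right]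
      rw [h3, CStarMatrix.mul_apply]
      refine Finset.sum_congr rfl fun x _ => ?_
      rw [CStarMatrix.mul_apply, Finset.sum_mul]
      refine Finset.sum_congr rfl fun i _ => ?_
      have h4 : N j i = star (N i j) := by
        conv_lhs => rw [← hNs]
        rw [CStarMatrix.star_apply]
      rw [h4, mul_assoc]
      rfl
    have h2 : (N * N * N) j j = ∑ k, star ((S * N) k j) * (S * N) k j := by
      rw [← hM, CStarMatrix.mul_apply]
      refine Finset.sum_congr rfl fun i _ => ?_
      rw [CStarMatrix.star_apply]
    refine sum_star_mul_self_eq_zero (f := fun k => (S * N) k j) b ?_ k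
    rw [← h2, ← hb, h1, hNX]
    exact neg_add_cancel _
  have hN1 : N * N * N = 0 := by rw [← hM, hMz, mul_zero]
  have hN2 : N = 0 := by
    have h3 : star (N * N) * (N * N) = 0 := by
      rw [star_mul, hNs, ← mul_assoc, hN1, zero_mul]
    have h4 : star N * N = 0 := by
      rw [hNs]; exact (CStarRing.star_mul_self_eq_zero_iff _).1 h3
    exact (CStarRing.star_mul_self_eq_zero_iff _).1 h4
  obtain ⟨Y, hY⟩ := hYX hN2
  refine ⟨fun k i => Y k i, fun i j => ?_⟩
  have h1 : ip (ξ i) (ξ j) = X i j := rfl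
  rw [h1, hY, CStarMatrix.mul_apply]
  refine Finset.sum_congr rfl fun k _ => ?_
  rw [CStarMatrix.star_apply]

end Basic

end HilbertModule

/-! ### The exterior tensor product of a Hilbert `A`-module and a C⋆-algebra -/

noncomputable section ModTensor

/-- The algebraic tensor product `E ⊙ Q` of a Hilbert `A`-module and a C⋆-algebra. -/
def AlgModTensor (A : Type u) (E : Type w) (Q : Type v) [CStarAlgebra A] [NormedAddCommGroup E]
    [NormedSpace ℂ E] [Module Aᵐᵒᵖ E] [HilbertModule A E] [CStarAlgebra Q] : Type (max w v) :=
  E ⊗[ℂ] Q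

namespace AlgModTensor

variable {A : Type u} {E : Type w} {Q : Type v} [CStarAlgebra A] [NormedAddCommGroup E]
  [NormedSpace ℂ E] [Module Aᵐᵒᵖ E] [HilbertModule A E] [CStarAlgebra Q]

instance : AddCommGroup (AlgModTensor A E Q) := inferInstanceAs (AddCommGroup (E ⊗[ℂ] Q))
instance : Module ℂ (AlgModTensor A E Q) := inferInstanceAs (Module ℂ (E ⊗[ℂ] Q))

variable (Q) in
/-- The sesquilinear map `(x, y) ↦ x⋆ y`. -/
def starMulₛₗ : Q →ₗ⋆[ℂ] Q →ₗ[ℂ] Q :=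
  LinearMap.mk₂'ₛₗ _ _ (fun x y => star x * y) (fun x y z => by rw [star_add, add_mul])
    (fun c x y => by rw [star_smul, smul_mul_assoc]; rfl) (fun x y z => mul_add _ _ _)
    (fun c x y => mul_smul_comm _ _ _)

/-- The `A ⊙ Q`-valued form `⟨ξ ⊗ x | η ⊗ y⟩ = ⟨ξ | η⟩ ⊗ x⋆ y` on `E ⊙ Q`. -/
def form : AlgModTensor A E Q →ₗ⋆[ℂ] AlgModTensor A E Q →ₗ[ℂ] AlgTensor A Q :=
  TensorProduct.map₂ (HilbertModule.ipₛₗ A E) (starMulₛₗ Q)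

/-- The right action `(ξ ⊗ x) (a ⊗ y) = ξ a ⊗ x y` of `A ⊙ Q` on `E ⊙ Q`. -/
def act : AlgModTensor A E Q →ₗ[ℂ] AlgTensor A Q →ₗ[ℂ] AlgModTensor A E Q :=
  TensorProduct.map₂ (HilbertModule.actₗ A E) (LinearMap.mul ℂ Q)

/-- The elementary tensor `ξ ⊗ x` of `E ⊙ Q`. -/
def tmul (ξ : E) (x : Q) : AlgModTensor A E Q := ξ ⊗ₜ[ℂ] x

theorem induction {p : AlgModTensor A E Q → Prop} (h0 : p 0) (ht : ∀ ξ x, p (tmul ξ x))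
    (ha : ∀ z w, p z → p w → p (z + w)) (z : AlgModTensor A E Q) : p z :=
  TensorProduct.induction_on (motive := p) z h0 ht ha

theorem form_tmul (ξ η : E) (x y : Q) : form (A := A) (tmul ξ x) (tmul η y) =
    AlgTensor.tmul (HilbertModule.ip ξ η : A) (star x * y) := rfl

theorem act_tmul (ξ : E) (x : Q) (a : A) (y : Q) :
    act (tmul ξ x) (AlgTensor.tmul a y) =
      tmul (A := A) (MulOpposite.op a • ξ) (x * y) := rfl

theorem star_form (z w : AlgModTensor A E Q) : star (form z w) = form w z := by
  induction z using induction with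
  | h0 => simp
  | ha z z' h h' => simp only [map_add, LinearMap.add_apply, star_add, h, h']
  | ht ξ x =>
    induction w using induction with
    | h0 => simp
    | ha z z' h h' => simp only [map_add, LinearMap.add_apply, star_add, h, h']
    | ht η y =>
      rw [form_tmul, form_tmul]
      rw [AlgTensor.star_tmul, HilbertModule.star_ip, star_mul, star_star]

theorem form_act (z w : AlgModTensor A E Q) (t : AlgTensor A Q) :
    form z (act w t) = form z w * t := by
  induction t using AlgTensor.induction with
  | h0 => simp
  | ha t t' h h' => simp only [map_add, mul_add, h, h']
  | ht a b =>
    induction z using induction with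
    | h0 => simp
    | ha z z' h h' => simp only [map_add, LinearMap.add_apply, add_mul, h, h']
    | ht ξ x =>
      induction w using induction with
      | h0 => simp
      | ha z z' h h' => simp only [map_add, LinearMap.add_apply, add_mul, h, h']
      | ht η y =>
        rw [act_tmul, form_tmul, form_tmul, HilbertModule.ip_op_smul_right, ← mul_assoc,
          AlgTensor.tmul_mul_tmul]

theorem form_act_left (z w : AlgModTensor A E Q) (t : AlgTensor A Q) :
    form (act z t) w = star t * form z w := by
  rw [← star_form, form_act, star_mul, star_form]

theorem exists_form_self (z : AlgModTensor A E Q) :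
    ∃ (S : Type (max w v)) (_ : Fintype S) (t : S → AlgTensor A Q),
      form z z = ∑ k, star (t k) * t k := by
  classical
  obtain ⟨S, hS⟩ := TensorProduct.exists_finset (R := ℂ) (M := E) (N := Q) z
  have hz : z = ∑ i : S, tmul (A := A) i.1.1 i.1.2 := by
    refine hS.trans ?_
    exact (Finset.sum_coe_sort S (fun i : E × Q => tmul (A := A) i.1 i.2)).symm
  obtain ⟨Y, hY⟩ := HilbertModule.exists_gram_eq (A := A) (fun i : S => i.1.1)
  refine ⟨S, inferInstance, fun k => ∑ i : S, AlgTensor.tmul (Y k i) i.1.2, ?_⟩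
  have h1 : form z z = ∑ i : S, ∑ j : S, ∑ k : S,
      AlgTensor.tmul (star (Y k i) * Y k j) (star i.1.2 * j.1.2) := by
    rw [hz]
    simp only [map_sum, LinearMap.sum_apply, form_tmul, hY, AlgTensor.sum_tmul]
    exact Finset.sum_comm
  have h2 : ∀ k : S, star (∑ i : S, AlgTensor.tmul (Y k i) i.1.2) *
      (∑ i : S, AlgTensor.tmul (Y k i) i.1.2) =
      ∑ i : S, ∑ j : S, AlgTensor.tmul (star (Y k i) * Y k j) (star i.1.2 * j.1.2) := fun k => by
    simp only [star_sum, Finset.sum_mul, Finset.mul_sum, AlgTensor.star_tmul,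
      AlgTensor.tmul_mul_tmul]
    exact Finset.sum_comm
  simp only [h1, h2]
  conv_rhs => rw [Finset.sum_comm]
  refine Finset.sum_congr rfl fun i _ => ?_
  rw [Finset.sum_comm]

theorem form_self_nonneg (y : AlgModTensor A E Q) :
    let _ := CStarAlgebra.spectralOrder (SpatialTensor A Q)
    0 ≤ ((form y y : AlgTensor A Q) : SpatialTensor A Q) := by
  intro _
  have _ := CStarAlgebra.spectralOrderedRing (SpatialTensor A Q)
  obtain ⟨S, _, t, ht⟩ := exists_form_self y
  have h : ((form y y : AlgTensor A Q) : SpatialTensor A Q) =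
      ∑ k, star (t k : SpatialTensor A Q) * (t k : SpatialTensor A Q) := by
    rw [ht]
    refine (map_sum (Completion.toCompl (α := AlgTensor A Q)) _ _).trans ?_
    refine Finset.sum_congr rfl fun k _ => ?_
    rw [← SpatialTensor.coe_star, ← Completion.coe_mul]
    rfl
  rw [h]
  exact Finset.sum_nonneg fun k _ => star_mul_self_nonneg _

/-- The Cauchy-Schwarz inequality. -/
theorem norm_form_sq_le (z w : AlgModTensor A E Q) :
    ‖form z w‖ ^ 2 ≤ ‖form z z‖ * ‖form w w‖ := by
  let _ := CStarAlgebra.spectralOrder (SpatialTensor A Q)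
  have _ := CStarAlgebra.spectralOrderedRing (SpatialTensor A Q)
  have pos := form_self_nonneg (A := A) (E := E) (Q := Q)
  set c := ((form z w : AlgTensor A Q) : SpatialTensor A Q) with hc
  set p := ((form z z : AlgTensor A Q) : SpatialTensor A Q) with hp
  set q := ((form w w : AlgTensor A Q) : SpatialTensor A Q) with hq
  have hps : IsSelfAdjoint p := IsSelfAdjoint.of_nonneg (pos z)
  have key : ∀ M : ℝ, ‖p‖ < M → ‖c‖ ^ 2 ≤ M * ‖q‖ := by
    intro M hM
    have hM0 : 0 < M := (norm_nonneg _).trans_lt hM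
    have h1 := pos ((M : ℂ) • w - act z (form z w))
    have h2 : ((form ((M : ℂ) • w - act z (form z w)) ((M : ℂ) • w - act z (form z w)) :
        AlgTensor A Q) : SpatialTensor A Q) =
        M • (M • q) - M • (star c * c) - M • (star c * c) + star c * p * c := by
      have h3 : form ((M : ℂ) • w - act z (form z w)) ((M : ℂ) • w - act z (form z w)) =
          (M : ℂ) • ((M : ℂ) • form w w) - (M : ℂ) • (star (form z w) * form z w) -
          (M : ℂ) • (star (form z w) * form z w) + star (form z w) * form z z * form z w := by
        simp only [map_sub, LinearMap.sub_apply, LinearMap.map_smulₛₗ, LinearMap.smul_apply,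
          form_act, form_act_left, Complex.conj_ofReal, RingHom.id_apply, star_form]
        simp only [mul_assoc, smul_sub]
        abel
      rw [h3]
      simp only [Completion.coe_add, Completion.coe_sub, Completion.coe_smul, Completion.coe_mul,
        SpatialTensor.coe_star, ← hc, ← hp, ← hq, Complex.coe_smul]
    rw [h2] at h1
    have h4 : star c * p * c ≤ M • (star c * c) :=
      (CStarAlgebra.star_left_conjugate_le_norm_smul (hb := hps)).trans
        (smul_le_smul_of_nonneg_right hM.le (star_mul_self_nonneg c))
    have h5 : M • (star c * c) ≤ M • (M • q) := by
      have h6 : 0 ≤ M • (M • q) - M • (star c * c) :=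
        calc (0 : SpatialTensor A Q)
            ≤ M • (M • q) - M • (star c * c) - M • (star c * c) + star c * p * c := h1
          _ ≤ M • (M • q) - M • (star c * c) - M • (star c * c) + M • (star c * c) := by gcongr
          _ = _ := by abel
      exact sub_nonneg.1 h6
    have h7 : star c * c ≤ M • q := le_of_smul_le_smul_left h5 hM0
    calc ‖c‖ ^ 2 = ‖star c * c‖ := by rw [CStarRing.norm_star_mul_self, pow_two]
      _ ≤ ‖M • q‖ := CStarAlgebra.norm_le_norm_of_nonneg_of_le (star_mul_self_nonneg c) h7
      _ = M * ‖q‖ := by rw [norm_smul, Real.norm_of_nonneg hM0.le]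
  have h8 : ‖c‖ ^ 2 ≤ ‖p‖ * ‖q‖ := by
    refine le_of_forall_pos_le_add fun ε hε => ?_
    have hq0 : 0 < ‖q‖ + 1 := by positivity
    have h9 := key (‖p‖ + ε / (‖q‖ + 1)) (by linarith [div_pos hε hq0])
    have h10 : ε / (‖q‖ + 1) * ‖q‖ ≤ ε := by
      rw [div_mul_eq_mul_div, div_le_iff₀ hq0]
      nlinarith [norm_nonneg q]
    linarith
  simpa only [hc, hp, hq, Completion.norm_coe] using h8

/-- The norm `‖z‖ = ‖⟨z | z⟩‖ ^ (1/2)` on `E ⊙ Q`. -/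
def modSeminorm : AddGroupSeminorm (AlgModTensor A E Q) where
  toFun z := √‖form z z‖
  map_zero' := by simp
  neg' z := by simp
  add_le' z w := by
    have h : ∀ z w : AlgModTensor A E Q, ‖form z w‖ ≤ √‖form z z‖ * √‖form w w‖ := fun z w => by
      rw [← Real.sqrt_mul (norm_nonneg _)]
      exact Real.le_sqrt_of_sq_le (norm_form_sq_le z w)
    refine Real.sqrt_le_iff.2 ⟨by positivity, ?_⟩
    have h1 : form (z + w) (z + w) = form z z + form w z + form z w + form w w := by
      simp only [map_add, LinearMap.add_apply]; abel
    have hz := Real.sq_sqrt (norm_nonneg (form z z))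
    have hw := Real.sq_sqrt (norm_nonneg (form w w))
    calc ‖form (z + w) (z + w)‖ ≤ ‖form z z‖ + ‖form w z‖ + ‖form z w‖ + ‖form w w‖ := by
          rw [h1]; exact norm_add₄_le
      _ ≤ _ := by nlinarith [h z w, h w z]

instance : SeminormedAddCommGroup (AlgModTensor A E Q) := modSeminorm.toSeminormedAddCommGroup

theorem norm_def (z : AlgModTensor A E Q) : ‖z‖ = √‖form z z‖ := rfl

theorem norm_sq (z : AlgModTensor A E Q) : ‖z‖ ^ 2 = ‖form z z‖ :=
  Real.sq_sqrt (norm_nonneg _)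

instance : NormedSpace ℂ (AlgModTensor A E Q) where
  norm_smul_le c z := by
    refine le_of_sq_le_sq ?_ (by positivity)
    rw [mul_pow, norm_sq, norm_sq, map_smul, LinearMap.map_smulₛₗ, LinearMap.smul_apply, norm_smul,
      norm_smul]
    simp [pow_two, mul_assoc]

theorem norm_form_le (z w : AlgModTensor A E Q) : ‖form z w‖ ≤ ‖z‖ * ‖w‖ := by
  refine le_of_sq_le_sq ?_ (by positivity)
  rw [mul_pow, norm_sq, norm_sq]
  exact norm_form_sq_le z w

theorem norm_act_le (z : AlgModTensor A E Q) (t : AlgTensor A Q) : ‖act z t‖ ≤ ‖z‖ * ‖t‖ := by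
  refine le_of_sq_le_sq ?_ (by positivity)
  rw [mul_pow, norm_sq, norm_sq, form_act, form_act_left]
  calc ‖star t * form z z * t‖ ≤ ‖star t * form z z‖ * ‖t‖ := norm_mul_le _ _
    _ ≤ ‖star t‖ * ‖form z z‖ * ‖t‖ := by gcongr; exact norm_mul_le _ _
    _ = _ := by rw [AlgTensor.norm_star]; ring

theorem act_one (z : AlgModTensor A E Q) : act z 1 = z := by
  induction z using induction with
  | h0 => simp
  | ha z z' h h' => simp only [map_add, LinearMap.add_apply, h, h']
  | ht ξ x =>
    refine (act_tmul ξ x 1 1).trans ?_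
    rw [MulOpposite.op_one, one_smul, mul_one]

theorem act_mul (z : AlgModTensor A E Q) (s t : AlgTensor A Q) :
    act z (s * t) = act (act z s) t := by
  induction z using induction with
  | h0 => simp
  | ha z z' h h' => simp only [map_add, LinearMap.add_apply, h, h']
  | ht ξ x =>
    induction s using AlgTensor.induction with
    | h0 => simp
    | ha t t' h h' => simp only [map_add, LinearMap.add_apply, add_mul, h, h']
    | ht a b =>
      induction t using AlgTensor.induction with
      | h0 => simp
      | ha t t' h h' => simp only [map_add, mul_add, h, h']
      | ht a' b' =>
        rw [AlgTensor.tmul_mul_tmul, act_tmul, act_tmul, act_tmul, MulOpposite.op_mul, mul_smul, mul_assoc]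

end AlgModTensor

/-- The exterior tensor product `E ⊗ Q` of a Hilbert `A`-module `E` and a C⋆-algebra `Q`: the
completion of `E ⊙ Q`, a Hilbert module over `A ⊗ Q`. -/
abbrev ModTensor (A : Type u) (E : Type w) (Q : Type v) [CStarAlgebra A] [NormedAddCommGroup E]
    [NormedSpace ℂ E] [Module Aᵐᵒᵖ E] [HilbertModule A E] [CStarAlgebra Q] : Type (max w v) :=
  Completion (AlgModTensor A E Q)

namespace ModTensor

open AlgModTensor

variable {A : Type u} {E : Type w} {Q : Type v} [CStarAlgebra A] [NormedAddCommGroup E]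
  [NormedSpace ℂ E] [Module Aᵐᵒᵖ E] [HilbertModule A E] [CStarAlgebra Q]

/-- The elementary tensor `ξ ⊗ x` of `E ⊗ Q`. -/
def tmul (ξ : E) (x : Q) : ModTensor A E Q := ((AlgModTensor.tmul ξ x : AlgModTensor A E Q) :)

/-- The inner product of `E ⊗ Q`, the continuous extension of that of `E ⊙ Q`. -/
def ip (z w : ModTensor A E Q) : SpatialTensor A Q :=
  (Completion.isDenseInducing_coe.prodMap Completion.isDenseInducing_coe).extend
    (fun p : AlgModTensor A E Q × AlgModTensor A E Q =>
      ((form p.1 p.2 : AlgTensor A Q) : SpatialTensor A Q)) (z, w)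

/-- The right action of `A ⊗ Q` on `E ⊗ Q`, the continuous extension of that on `E ⊙ Q`. -/
def act (z : ModTensor A E Q) (t : SpatialTensor A Q) : ModTensor A E Q :=
  (Completion.isDenseInducing_coe.prodMap Completion.isDenseInducing_coe).extend
    (fun p : AlgModTensor A E Q × AlgTensor A Q =>
      ((AlgModTensor.act p.1 p.2 : AlgModTensor A E Q) : ModTensor A E Q)) (z, t)

theorem continuous_form : Continuous (fun p : AlgModTensor A E Q × AlgModTensor A E Q =>
    ((form p.1 p.2 : AlgTensor A Q) : SpatialTensor A Q)) :=
  let f : AlgModTensor A E Q →L⋆[ℂ] AlgModTensor A E Q →L[ℂ] AlgTensor A Q :=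
    LinearMap.mkContinuous₂ form 1 (fun z w => by simpa using norm_form_le z w)
  have h : Continuous (fun p : AlgModTensor A E Q × AlgModTensor A E Q => f p.1 p.2) :=
    (f.continuous.comp continuous_fst).clm_apply continuous_snd
  (Completion.continuous_coe _).comp h

theorem continuous_act' : Continuous (fun p : AlgModTensor A E Q × AlgTensor A Q =>
    ((AlgModTensor.act p.1 p.2 : AlgModTensor A E Q) : ModTensor A E Q)) :=
  (Completion.continuous_coe _).comp
    (AlgModTensor.act.mkContinuous₂ 1 (fun z w => by simpa using norm_act_le z w)).continuous₂

theorem continuous_ip : Continuous (fun p : ModTensor A E Q × ModTensor A E Q => ip p.1 p.2) := by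
  have di : IsDenseInducing (Completion.toCompl : AlgModTensor A E Q → ModTensor A E Q) :=
    Completion.isDenseInducing_coe
  let m : AlgModTensor A E Q →+ AlgModTensor A E Q →+ SpatialTensor A Q :=
    AddMonoidHom.mk' (fun z => AddMonoidHom.mk'
      (fun w => ((form z w : AlgTensor A Q) : SpatialTensor A Q))
      (fun w w' => by rw [map_add, Completion.coe_add]))
      (fun z z' => by ext w; simp [Completion.coe_add])
  have h : Continuous fun p : AlgModTensor A E Q × AlgModTensor A E Q => m p.1 p.2 :=
    continuous_form
  exact (di.extend_Z_bilin di h :)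

theorem continuous_act : Continuous (fun p : ModTensor A E Q × SpatialTensor A Q =>
    act p.1 p.2) := by
  have di : IsDenseInducing (Completion.toCompl : AlgModTensor A E Q → ModTensor A E Q) :=
    Completion.isDenseInducing_coe
  have di' : IsDenseInducing (Completion.toCompl : AlgTensor A Q → SpatialTensor A Q) :=
    Completion.isDenseInducing_coe
  let m : AlgModTensor A E Q →+ AlgTensor A Q →+ ModTensor A E Q :=
    AddMonoidHom.mk' (fun z => AddMonoidHom.mk'
      (fun w => ((AlgModTensor.act z w : AlgModTensor A E Q) : ModTensor A E Q))
      (fun w w' => by rw [map_add, Completion.coe_add]))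
      (fun z z' => by ext w; simp [Completion.coe_add])
  have h : Continuous fun p : AlgModTensor A E Q × AlgTensor A Q => m p.1 p.2 :=
    continuous_act'
  exact (di.extend_Z_bilin di' h :)

theorem ip_coe (z w : AlgModTensor A E Q) :
    ip (z : ModTensor A E Q) (w : ModTensor A E Q) = (form z w : AlgTensor A Q) :=
  (Completion.isDenseInducing_coe.prodMap Completion.isDenseInducing_coe).extend_eq
    continuous_form (z, w)

theorem act_coe (z : AlgModTensor A E Q) (t : AlgTensor A Q) :
    act (z : ModTensor A E Q) (t : SpatialTensor A Q) =
      (AlgModTensor.act z t : AlgModTensor A E Q) :=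
  (Completion.isDenseInducing_coe.prodMap Completion.isDenseInducing_coe).extend_eq
    continuous_act' (z, t)

@[fun_prop]
theorem _root_.Continuous.modTensor_ip {X : Type*} [TopologicalSpace X] {f g : X → ModTensor A E Q}
    (hf : Continuous f) (hg : Continuous g) : Continuous fun x => ip (f x) (g x) :=
  continuous_ip.comp (hf.prodMk hg)

@[fun_prop]
theorem _root_.Continuous.modTensor_act {X : Type*} [TopologicalSpace X] {f : X → ModTensor A E Q}
    {g : X → SpatialTensor A Q} (hf : Continuous f) (hg : Continuous g) :
    Continuous fun x => act (f x) (g x) :=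
  continuous_act.comp (hf.prodMk hg)

theorem act_add (z : ModTensor A E Q) (s t : SpatialTensor A Q) :
    act z (s + t) = act z s + act z t := by
  induction z, s, t using Completion.induction_on₃ with
  | hp => exact isClosed_eq (by fun_prop) (by fun_prop)
  | ih z s t => simp only [← Completion.coe_add, act_coe, map_add]

theorem add_act (z w : ModTensor A E Q) (s : SpatialTensor A Q) :
    act (z + w) s = act z s + act w s := by
  induction z, w, s using Completion.induction_on₃ with
  | hp => exact isClosed_eq (by fun_prop) (by fun_prop)
  | ih z s t => simp only [← Completion.coe_add, act_coe, map_add, LinearMap.add_apply]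

theorem zero_act (s : SpatialTensor A Q) : act (0 : ModTensor A E Q) s = 0 := by
  have h := add_act (0 : ModTensor A E Q) 0 s
  rw [add_zero] at h
  exact left_eq_add.1 h

theorem act_zero (z : ModTensor A E Q) : act z 0 = 0 := by
  have h := act_add z 0 0
  rw [add_zero] at h
  exact left_eq_add.1 h

theorem act_one (z : ModTensor A E Q) : act z 1 = z := by
  induction z using Completion.induction_on with
  | hp => exact isClosed_eq (by fun_prop) (by fun_prop)
  | ih z => rw [← Completion.coe_one, act_coe, AlgModTensor.act_one]

theorem act_mul (z : ModTensor A E Q) (s t : SpatialTensor A Q) :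
    act z (s * t) = act (act z s) t := by
  induction z, s, t using Completion.induction_on₃ with
  | hp => exact isClosed_eq (by fun_prop) (by fun_prop)
  | ih z s t => simp only [← Completion.coe_mul, act_coe, AlgModTensor.act_mul]

instance : Module (SpatialTensor A Q)ᵐᵒᵖ (ModTensor A E Q) where
  smul t z := act z t.unop
  one_smul := act_one
  mul_smul s t z := act_mul z t.unop s.unop
  smul_zero _ := zero_act _
  smul_add _ z w := add_act z w _
  add_smul _ _ z := act_add z _ _
  zero_smul z := act_zero z

theorem op_smul_def (t : SpatialTensor A Q) (z : ModTensor A E Q) :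
    MulOpposite.op t • z = act z t := rfl

theorem ip_add (x y z : ModTensor A E Q) : ip x (y + z) = ip x y + ip x z := by
  induction x, y, z using Completion.induction_on₃ with
  | hp => exact isClosed_eq (by fun_prop) (by fun_prop)
  | ih x y z => simp only [← Completion.coe_add, ip_coe, map_add]

theorem ip_smul (c : ℂ) (x y : ModTensor A E Q) : ip x (c • y) = c • ip x y := by
  induction x, y using Completion.induction_on₂ with
  | hp =>
    exact isClosed_eq
      (continuous_ip.comp (continuous_fst.prodMk ((continuous_const_smul c).comp continuous_snd)))
      ((continuous_const_smul c).comp continuous_ip)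
  | ih x y => simp only [← Completion.coe_smul, ip_coe, map_smul]

theorem ip_act (x y : ModTensor A E Q) (t : SpatialTensor A Q) :
    ip x (act y t) = ip x y * t := by
  induction x, y, t using Completion.induction_on₃ with
  | hp => exact isClosed_eq (by fun_prop) (by fun_prop)
  | ih x y t => simp only [act_coe, ip_coe, form_act, Completion.coe_mul]

theorem star_ip' (x y : ModTensor A E Q) : star (ip x y) = ip y x := by
  induction x, y using Completion.induction_on₂ with
  | hp => exact isClosed_eq (SpatialTensor.continuous_star'.comp (by fun_prop)) (by fun_prop)
  | ih x y => simp only [ip_coe, ← SpatialTensor.coe_star, star_form]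

theorem exists_ip_self (x : ModTensor A E Q) : ∃ b, ip x x = star b * b := by
  let _ := CStarAlgebra.spectralOrder (SpatialTensor A Q)
  have _ := CStarAlgebra.spectralOrderedRing (SpatialTensor A Q)
  suffices h : 0 ≤ ip x x from CStarAlgebra.nonneg_iff_eq_star_mul_self.1 h
  induction x using Completion.induction_on with
  | hp =>
    have h : Continuous fun x : ModTensor A E Q => ip x x := by fun_prop
    exact CStarAlgebra.isClosed_nonneg.preimage h
  | ih x => rw [ip_coe]; exact form_self_nonneg x

theorem norm_eq' (x : ModTensor A E Q) : ‖x‖ = √‖ip x x‖ := by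
  induction x using Completion.induction_on with
  | hp => exact isClosed_eq (by fun_prop) (by fun_prop)
  | ih x => rw [ip_coe, Completion.norm_coe, Completion.norm_coe, norm_def]

instance : HilbertModule (SpatialTensor A Q) (ModTensor A E Q) where
  ip := ip
  ip_add_right := ip_add
  ip_smul_right := ip_smul
  ip_op_smul_right t x y := ip_act x y t
  star_ip := star_ip'
  ip_self_nonneg := exists_ip_self
  norm_eq := norm_eq'

theorem ip_def (z w : ModTensor A E Q) :
    HilbertModule.ip (A := SpatialTensor A Q) z w = ip z w := rfl

variable {Q' : Type v} [CStarAlgebra Q']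

variable (A E) in
/-- The map `id ⊙ μ : E ⊙ Q → E ⊙ Q'`. -/
def algMap (μ : Q →⋆ₐ[ℂ] Q') : AlgModTensor A E Q →ₗ[ℂ] AlgModTensor A E Q' :=
  TensorProduct.map LinearMap.id μ.toAlgHom.toLinearMap

theorem form_algMap (μ : Q →⋆ₐ[ℂ] Q') (z w : AlgModTensor A E Q) :
    form (algMap A E μ z) (algMap A E μ w) = AlgTensor.map (.id ℂ A) μ (form z w) := by
  induction z using AlgModTensor.induction with
  | h0 => simp
  | ha z z' h h' => simp only [map_add, LinearMap.add_apply, h, h']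
  | ht ξ x =>
    induction w using AlgModTensor.induction with
    | h0 => simp
    | ha z z' h h' => simp only [map_add, h, h']
    | ht η y =>
      have h1 : ∀ (ζ : E) (x : Q), algMap A E μ (AlgModTensor.tmul ζ x) =
        AlgModTensor.tmul ζ (μ x) := fun _ _ => rfl
      rw [h1, h1, form_tmul, form_tmul, ← map_star, ← map_mul]
      rfl

theorem norm_algMap_le (μ : Q →⋆ₐ[ℂ] Q') (z : AlgModTensor A E Q) :
    ‖algMap A E μ z‖ ≤ ‖z‖ := by
  rw [norm_def, norm_def, form_algMap]
  exact Real.sqrt_le_sqrt (AlgTensor.norm_map_le _ _ _)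

variable (A E) in
theorem uniformContinuous_algMap (μ : Q →⋆ₐ[ℂ] Q') : UniformContinuous (algMap A E μ) :=
  ((algMap A E μ).mkContinuous 1 (fun x => by simpa using norm_algMap_le μ x)).uniformContinuous

variable (A E) in
/-- The map `id ⊗ μ : E ⊗ Q → E ⊗ Q'`, for a ⋆-morphism `μ : Q → Q'`. -/
def map (μ : Q →⋆ₐ[ℂ] Q') : ModTensor A E Q →L[ℂ] ModTensor A E Q' where
  toFun := Completion.map (algMap A E μ)
  map_add' x y := by
    induction x, y using Completion.induction_on₂ with
    | hp =>
      exact isClosed_eq (Completion.continuous_map.comp continuous_add)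
        (continuous_add.comp ((Completion.continuous_map.comp continuous_fst).prodMk
          (Completion.continuous_map.comp continuous_snd)))
    | ih x y => simp only [← Completion.coe_add,
        Completion.map_coe (uniformContinuous_algMap A E μ), map_add]
  map_smul' c x := by
    induction x using Completion.induction_on with
    | hp =>
      exact isClosed_eq (Completion.continuous_map.comp (continuous_const_smul _))
        ((continuous_const_smul _).comp Completion.continuous_map)
    | ih x => simp only [← Completion.coe_smul, RingHom.id_apply,
        Completion.map_coe (uniformContinuous_algMap A E μ), map_smul]
  cont := Completion.continuous_map

theorem map_coe (μ : Q →⋆ₐ[ℂ] Q') (x : AlgModTensor A E Q) :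
    map A E μ (x : ModTensor A E Q) = (algMap A E μ x : AlgModTensor A E Q') :=
  Completion.map_coe (uniformContinuous_algMap A E μ) x

end ModTensor

end ModTensor

/-! ### Woronowicz C⋆-algebras and their coactions -/

noncomputable section Coactions

/-- For a bounded linear map `f` on a dense subspace `X` of its completion, `ExtendsTo f x y` says
that the bounded extension of `f` to the completion of `X` sends `x` to `y`: the graph of this
extension is the closure of the graph of `f`. -/
def ExtendsTo {X : Type*} {Y : Type*} [UniformSpace X] [TopologicalSpace Y] (f : X → Y)
    (x : Completion X) (y : Y) : Prop :=
  (x, y) ∈ closure (Set.range fun t : X => ((t : Completion X), f t))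

namespace SpatialTensor

variable {A : Type u} {B : Type v} [CStarAlgebra A] [CStarAlgebra B]

theorem add_tmul (a a' : A) (b : B) : tmul (a + a') b = tmul a b + tmul a' b := by
  have h : AlgTensor.tmul (a + a') b = AlgTensor.tmul a b + AlgTensor.tmul a' b :=
    TensorProduct.add_tmul _ _ _
  rw [tmul, h, Completion.coe_add]; rfl

theorem tmul_add (a : A) (b b' : B) : tmul a (b + b') = tmul a b + tmul a b' := by
  have h : AlgTensor.tmul a (b + b') = AlgTensor.tmul a b + AlgTensor.tmul a b' :=
    TensorProduct.tmul_add _ _ _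
  rw [tmul, h, Completion.coe_add]; rfl

theorem smul_tmul (c : ℂ) (a : A) (b : B) : tmul (c • a) b = c • tmul a b := by
  have h : AlgTensor.tmul (c • a) b = c • AlgTensor.tmul a b := TensorProduct.smul_tmul' _ _ _
  rw [tmul, h, Completion.coe_smul]; rfl

theorem tmul_smul (c : ℂ) (a : A) (b : B) : tmul a (c • b) = c • tmul a b := by
  have h : AlgTensor.tmul a (c • b) = c • AlgTensor.tmul a b := TensorProduct.tmul_smul _ _ _
  rw [tmul, h, Completion.coe_smul]; rfl

theorem tmul_mul_tmul (a a' : A) (b b' : B) :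
    tmul a b * tmul a' b' = tmul (a * a') (b * b') := by
  simp only [tmul, ← Completion.coe_mul, AlgTensor.tmul_mul_tmul]

theorem one_def : (1 : SpatialTensor A B) = tmul 1 1 := rfl

theorem star_tmul (a : A) (b : B) : star (tmul a b) = tmul (star a) (star b) := by
  simp only [tmul, ← coe_star, AlgTensor.star_tmul]

variable (A B) in
/-- The ⋆-morphism `A → A ⊗ B`, `a ↦ a ⊗ 1`. -/
def inl : A →⋆ₐ[ℂ] SpatialTensor A B where
  toFun a := tmul a 1
  map_one' := rfl
  map_mul' a a' := by rw [tmul_mul_tmul, mul_one]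
  map_zero' := by simpa using smul_tmul (0 : ℂ) (0 : A) (1 : B)
  map_add' a a' := add_tmul a a' 1
  commutes' c := by
    rw [Algebra.algebraMap_eq_smul_one, Algebra.algebraMap_eq_smul_one, smul_tmul, one_def]
  map_star' a := by rw [star_tmul, star_one]

/-- For `α : A → A ⊗ Q`, the map `α ⊙ id : A ⊙ Q → A ⊗ Q ⊗ Q`, `a ⊗ x ↦ α(a) ⊗ x`.  Here
`α(a) ⊗ x` is written as the product of `α(a) ⊗ 1` and `1 ⊗ 1 ⊗ x` in `A ⊗ (Q ⊗ Q)`. -/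
def algTensorId {Q : Type v} [CStarAlgebra Q] (α : A →⋆ₐ[ℂ] SpatialTensor A Q) :
    AlgTensor A Q →ₗ[ℂ] SpatialTensor A (SpatialTensor Q Q) :=
  TensorProduct.lift (LinearMap.mk₂ ℂ
    (fun a x => map (.id ℂ A) (inl Q Q) (α a) * tmul 1 (tmul 1 x))
    (fun a a' x => by rw [map_add, map_add, add_mul])
    (fun c a x => by rw [map_smul, map_smul, smul_mul_assoc])
    (fun a x x' => by rw [tmul_add, tmul_add, mul_add])
    (fun c a x => by rw [tmul_smul, tmul_smul, mul_smul_comm]))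

/-- For a linear functional `τ` on `A`, the slice map `τ ⊙ id : A ⊙ Q → Q`. -/
def algSlice (τ : A →ₗ[ℂ] ℂ) : AlgTensor A B →ₗ[ℂ] B :=
  TensorProduct.lift (LinearMap.mk₂ ℂ (fun a x => τ a • x)
    (fun a a' x => by rw [map_add, add_smul])
    (fun c a x => by rw [map_smul, smul_assoc])
    (fun a x x' => smul_add _ _ _)
    (fun c a x => smul_comm _ _ _))

end SpatialTensor

/-- For `β : E → E ⊗ Q`, the map `β ⊙ id : E ⊙ Q → E ⊗ Q ⊗ Q`, `ξ ⊗ x ↦ β(ξ) ⊗ x`.  Here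
`β(ξ) ⊗ x` is obtained from `β(ξ) ⊗ 1` in `E ⊗ (Q ⊗ Q)` by acting with `1 ⊗ 1 ⊗ x`. -/
def ModTensor.algTensorId {A : Type u} {E : Type w} {Q : Type v} [CStarAlgebra A]
    [NormedAddCommGroup E] [NormedSpace ℂ E] [Module Aᵐᵒᵖ E] [HilbertModule A E] [CStarAlgebra Q]
    (β : E →ₗ[ℂ] ModTensor A E Q) :
    AlgModTensor A E Q →ₗ[ℂ] ModTensor A E (SpatialTensor Q Q) :=
  TensorProduct.lift (LinearMap.mk₂ ℂ
    (fun ξ x => HilbertModule.actₗ (SpatialTensor A (SpatialTensor Q Q))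
      (ModTensor A E (SpatialTensor Q Q)) (ModTensor.map A E (SpatialTensor.inl Q Q) (β ξ))
        (SpatialTensor.tmul 1 (SpatialTensor.tmul 1 x)))
    (fun ξ ξ' x => by rw [map_add, map_add, map_add, LinearMap.add_apply])
    (fun c ξ x => by rw [map_smul, map_smul, map_smul, LinearMap.smul_apply])
    (fun ξ x x' => by rw [SpatialTensor.tmul_add, SpatialTensor.tmul_add, map_add])
    (fun c ξ x => by rw [SpatialTensor.tmul_smul, SpatialTensor.tmul_smul, map_smul]))

/-- The structure of a Woronowicz C⋆-algebra on a unital C⋆-algebra `Q`.  The tensor product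
`Q ⊗ Q ⊗ Q` is taken to be `Q ⊗ (Q ⊗ Q)`. -/
class WoronowiczAlgebra (Q : Type v) [CStarAlgebra Q] where
  /-- The comultiplication. -/
  comul : Q →⋆ₐ[ℂ] SpatialTensor Q Q
  /-- `(Δ ⊗ id) ∘ Δ = (id ⊗ Δ) ∘ Δ` -/
  coassoc : ∀ a, ExtendsTo (SpatialTensor.algTensorId comul) (comul a)
    (SpatialTensor.map (.id ℂ Q) comul (comul a))
  /-- `span {Δ(Q) (Q ⊗ 1)}` is dense in `Q ⊗ Q`. -/
  dense_left : Dense (Submodule.span ℂ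
    {z | ∃ a b : Q, z = comul a * SpatialTensor.tmul b 1} : Set (SpatialTensor Q Q))
  /-- `span {Δ(Q) (1 ⊗ Q)}` is dense in `Q ⊗ Q`. -/
  dense_right : Dense (Submodule.span ℂ
    {z | ∃ a b : Q, z = comul a * SpatialTensor.tmul 1 b} : Set (SpatialTensor Q Q))

/-- A ⋆-morphism `μ` is a morphism of Woronowicz C⋆-algebras if `(μ ⊗ μ) ∘ Δ₀ = Δ₁ ∘ μ`. -/
def IsWoronowiczHom {Q₀ Q₁ : Type v} [CStarAlgebra Q₀] [WoronowiczAlgebra Q₀] [CStarAlgebra Q₁]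
    [WoronowiczAlgebra Q₁] (μ : Q₀ →⋆ₐ[ℂ] Q₁) : Prop :=
  ∀ a, SpatialTensor.map μ μ (WoronowiczAlgebra.comul a) = WoronowiczAlgebra.comul (μ a)

/-- A coaction of a Woronowicz C⋆-algebra `Q` on a unital C⋆-algebra `A`. -/
structure Coaction (A : Type u) (Q : Type v) [CStarAlgebra A] [CStarAlgebra Q]
    [WoronowiczAlgebra Q] where
  /-- The ⋆-morphism `α : A → A ⊗ Q`. -/
  toHom : A →⋆ₐ[ℂ] SpatialTensor A Q
  /-- `(α ⊗ id) ∘ α = (id ⊗ Δ) ∘ α` -/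
  coassoc : ∀ a, ExtendsTo (SpatialTensor.algTensorId toHom) (toHom a)
    (SpatialTensor.map (.id ℂ A) WoronowiczAlgebra.comul (toHom a))
  /-- `span {α(A) (1 ⊗ Q)}` is dense in `A ⊗ Q`. -/
  dense : Dense (Submodule.span ℂ
    {z | ∃ (a : A) (x : Q), z = toHom a * SpatialTensor.tmul 1 x} : Set (SpatialTensor A Q))

/-- A coaction `(α, β)` of a Woronowicz C⋆-algebra `Q` on a Hilbert `A`-module `E`. -/
structure ModCoaction (A : Type u) (E : Type w) (Q : Type v) [CStarAlgebra A]
    [NormedAddCommGroup E] [NormedSpace ℂ E] [Module Aᵐᵒᵖ E] [HilbertModule A E] [CStarAlgebra Q]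
    [WoronowiczAlgebra Q] where
  /-- The coaction `α` on `A`. -/
  α : Coaction A Q
  /-- The linear map `β : E → E ⊗ Q`. -/
  β : E →ₗ[ℂ] ModTensor A E Q
  /-- `span {β(E) (1 ⊗ Q)}` is dense in `E ⊗ Q`. -/
  dense : Dense (Submodule.span ℂ {z | ∃ (ξ : E) (x : Q),
    z = MulOpposite.op (SpatialTensor.tmul (1 : A) x) • β ξ} : Set (ModTensor A E Q))
  /-- `(β ⊗ id) ∘ β = (id ⊗ Δ) ∘ β` -/
  coassoc : ∀ ξ, ExtendsTo (ModTensor.algTensorId β) (β ξ)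
    (ModTensor.map A E WoronowiczAlgebra.comul (β ξ))
  /-- `⟨β(ξ) | β(η)⟩ = α(⟨ξ | η⟩)` -/
  ip_eq : ∀ ξ η, HilbertModule.ip (A := SpatialTensor A Q) (β ξ) (β η) =
    α.toHom (HilbertModule.ip ξ η)
  /-- `β(ξ a) = β(ξ) α(a)` -/
  map_act : ∀ (ξ : E) (a : A), β (MulOpposite.op a • ξ) = MulOpposite.op (α.toHom a) • β ξ

open scoped ComplexOrder in
/-- An orthogonal filtration `(τ, (V i), J, ξ₀)` of a Hilbert `A`-module `E`. -/
structure OrthogonalFiltration (A : Type u) (E : Type w) (I : Type*) [CStarAlgebra A]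
    [NormedAddCommGroup E] [NormedSpace ℂ E] [Module Aᵐᵒᵖ E] [HilbertModule A E] where
  /-- The faithful state `τ` on `A`. -/
  τ : A →ₗ[ℂ] ℂ
  τ_nonneg : ∀ a, 0 ≤ τ (star a * a)
  τ_one : τ 1 = 1
  τ_faithful : ∀ a, τ (star a * a) = 0 → a = 0
  /-- The finite-dimensional subspaces `V i`. -/
  V : I → Submodule ℂ E
  finiteDimensional : ∀ i, FiniteDimensional ℂ (V i)
  orthogonal : ∀ i j, i ≠ j → ∀ ξ ∈ V i, ∀ η ∈ V j, τ (HilbertModule.ip ξ η) = 0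
  dense : Dense ((⨆ i, V i : Submodule ℂ E) : Set E)
  /-- The one-to-one antilinear operator `J` on `∑ i, V i`. -/
  J : ↥(⨆ i, V i) →ₗ⋆[ℂ] ↥(⨆ i, V i)
  J_injective : Function.Injective J
  /-- The distinguished element `ξ₀`. -/
  ξ₀ : E

section Preserving

variable {A : Type u} {E : Type w} {I : Type*} [CStarAlgebra A] [NormedAddCommGroup E]
  [NormedSpace ℂ E] [Module Aᵐᵒᵖ E] [HilbertModule A E]

/-- For a subspace `W` of `E`, the canonical map `W ⊙ Q → E ⊙ Q`. -/
def algSubTensor (A : Type u) {E : Type w} [CStarAlgebra A] [NormedAddCommGroup E]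
    [NormedSpace ℂ E] [Module Aᵐᵒᵖ E] [HilbertModule A E] (Q : Type v) [CStarAlgebra Q]
    (W : Submodule ℂ E) : W ⊗[ℂ] Q → AlgModTensor A E Q :=
  TensorProduct.map W.subtype (LinearMap.id : Q →ₗ[ℂ] Q)

/-- For a subspace `W` of `E`, the canonical map `W ⊙ Q → E ⊗ Q`. -/
def subTensor (A : Type u) {E : Type w} [CStarAlgebra A] [NormedAddCommGroup E]
    [NormedSpace ℂ E] [Module Aᵐᵒᵖ E] [HilbertModule A E] (Q : Type v) [CStarAlgebra Q]
    (W : Submodule ℂ E) (t : W ⊗[ℂ] Q) : ModTensor A E Q :=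
  (algSubTensor A Q W t : Completion (AlgModTensor A E Q))

/-- A coaction `(α, β)` of `Q` on `E` that preserves a given orthogonal filtration. -/
structure IsFiltrationPreserving (F : OrthogonalFiltration A E I) {Q : Type v} [CStarAlgebra Q]
    [WoronowiczAlgebra Q] (c : ModCoaction A E Q) : Prop where
  /-- `(τ ⊗ id) ∘ α = τ(·) 1` -/
  map_τ : ∀ a, ExtendsTo (SpatialTensor.algSlice F.τ) (c.α.toHom a) (F.τ a • (1 : Q))
  /-- `β(V i) ⊆ V i ⊙ Q` -/
  map_V : ∀ i, ∀ ξ ∈ F.V i, ∃ t : F.V i ⊗[ℂ] Q, c.β ξ = subTensor A Q (F.V i) t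
  /-- `(J ⊗ ⋆) ∘ β = β ∘ J` on `∑ i, V i` -/
  map_J : ∀ ξ : ↥(⨆ i, F.V i), ∃ t : ↥(⨆ i, F.V i) ⊗[ℂ] Q,
    c.β ξ = subTensor A Q (⨆ i, F.V i) t ∧
    subTensor A Q (⨆ i, F.V i)
      (TensorProduct.map F.J (starLinearEquiv ℂ (A := Q)).toLinearMap t) = c.β (F.J ξ)
  /-- `β(ξ₀) = ξ₀ ⊗ 1` -/
  map_ξ₀ : c.β F.ξ₀ = ModTensor.tmul F.ξ₀ 1

/-- Morphisms of the category of Woronowicz C⋆-algebras coacting on `E` in a filtration preserving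
way: a morphism `μ : Q₀ → Q₁` of Woronowicz C⋆-algebras such that `α₁ = (id ⊗ μ) ∘ α₀` and
`β₁ = (id ⊗ μ) ∘ β₀`. -/
structure IsCoactionHom {Q₀ Q₁ : Type v} [CStarAlgebra Q₀] [WoronowiczAlgebra Q₀]
    [CStarAlgebra Q₁] [WoronowiczAlgebra Q₁] (c₀ : ModCoaction A E Q₀) (c₁ : ModCoaction A E Q₁)
    (μ : Q₀ →⋆ₐ[ℂ] Q₁) : Prop where
  isWoronowiczHom : IsWoronowiczHom μ
  map_α : ∀ a, c₁.α.toHom a = SpatialTensor.map (.id ℂ A) μ (c₀.α.toHom a)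
  map_β : ∀ ξ, c₁.β ξ = ModTensor.map A E μ (c₀.β ξ)

/-- `(Q, c)` is an initial object in the category of Woronowicz C⋆-algebras coacting on `E` in a
filtration preserving way; that is, the quantum group associated with `Q` is the quantum symmetry
group of `E` with the filtration `F`, acting through `c`. -/
structure IsQuantumSymmetryGroup (F : OrthogonalFiltration A E I) (Q : Type v) [CStarAlgebra Q]
    [WoronowiczAlgebra Q] (c : ModCoaction A E Q) : Prop where
  isFiltrationPreserving : IsFiltrationPreserving F c
  existsUnique_hom : ∀ (R : Type v) [CStarAlgebra R] [WoronowiczAlgebra R]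
    (d : ModCoaction A E R), IsFiltrationPreserving F d → ∃! μ : Q →⋆ₐ[ℂ] R, IsCoactionHom c d μ

end Preserving

/-! ### Free orthogonal quantum groups -/

/-- The relations of the free orthogonal quantum group of an invertible complex matrix `P`: the
matrix `u` over the Woronowicz C⋆-algebra `Q` is multiplicative and unitary and satisfies
`u = P ū P⁻¹`, where `ū` is the matrix of the adjoints of the entries of `u`. -/
structure IsOrthogonalMatrix {n : ℕ} (P : Matrix (Fin n) (Fin n) ℂ) {Q : Type v} [CStarAlgebra Q]
    [WoronowiczAlgebra Q] (u : Matrix (Fin n) (Fin n) Q) : Prop where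
  multiplicative : ∀ i j,
    WoronowiczAlgebra.comul (u i j) = ∑ k, SpatialTensor.tmul (u i k) (u k j)
  star_mul_self : u.conjTranspose * u = 1
  mul_star_self : u * u.conjTranspose = 1
  eq_conj : u = P.map (algebraMap ℂ Q) * u.map star * P⁻¹.map (algebraMap ℂ Q)

/-- `(Q, u)` is the Woronowicz C⋆-algebra `A_o(P)` of the free orthogonal quantum group of `P` with
its canonical matrix: the universal Woronowicz C⋆-algebra generated by (the entries of) a
multiplicative and unitary matrix `u` with `u = P ū P⁻¹`. -/
structure IsFreeOrthogonal {n : ℕ} (P : Matrix (Fin n) (Fin n) ℂ) (Q : Type v) [CStarAlgebra Q]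
    [WoronowiczAlgebra Q] (u : Matrix (Fin n) (Fin n) Q) : Prop where
  isOrthogonalMatrix : IsOrthogonalMatrix P u
  generates : (StarAlgebra.adjoin ℂ
    (Set.range fun p : Fin n × Fin n => u p.1 p.2)).topologicalClosure = ⊤
  universal : ∀ (R : Type v) [CStarAlgebra R] [WoronowiczAlgebra R]
    (v : Matrix (Fin n) (Fin n) R), IsOrthogonalMatrix P v →
    ∃! μ : Q →⋆ₐ[ℂ] R, IsWoronowiczHom μ ∧ ∀ i j, μ (u i j) = v i j

/-- `ℂⁿ` with its canonical Hilbert space structure is a Hilbert `ℂ`-module. -/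
instance (n : ℕ) : HilbertModule ℂ (EuclideanSpace ℂ (Fin n)) where
  ip x y := inner ℂ x y
  ip_add_right := inner_add_right
  ip_smul_right c x y := inner_smul_right x y c
  ip_op_smul_right a x y := by
    have h : MulOpposite.op a • y = a • y := by
      ext i
      simp [mul_comm]
    rw [h, inner_smul_right, mul_comm]
  star_ip x y := inner_conj_symm y x
  ip_self_nonneg x := ⟨(‖x‖ : ℂ), by
    rw [inner_self_eq_norm_sq_to_K, pow_two]; simp⟩
  norm_eq x := by
    rw [inner_self_eq_norm_sq_to_K]; simp

open scoped ComplexOrder in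
/-- The orthogonal filtration `(id, (V₀), J, 0)` of `ℂⁿ` with `V₀ = ℂⁿ` as its only subspace. -/
def euclideanFiltration {n : ℕ}
    (J : EuclideanSpace ℂ (Fin n) ≃ₛₗ[starRingEnd ℂ] EuclideanSpace ℂ (Fin n)) :
    OrthogonalFiltration ℂ (EuclideanSpace ℂ (Fin n)) Unit where
  τ := LinearMap.id
  τ_nonneg a := star_mul_self_nonneg a
  τ_one := rfl
  τ_faithful a h := (CStarRing.star_mul_self_eq_zero_iff a).1 h
  V _ := ⊤
  finiteDimensional _ := inferInstance
  orthogonal i j hij := absurd (Subsingleton.elim i j) hij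
  dense := by simp
  J := (J.toLinearMap.comp (Submodule.subtype _)).codRestrict _ (fun _ => by simp)
  J_injective x y h := Subtype.ext (J.injective (congrArg Subtype.val h))
  ξ₀ := 0

/-- The matrix `P` of an antilinear map `J` of `ℂⁿ` in the canonical basis:
`J(e j) = ∑ i, P i j • e i`. -/
def antilinearMatrix {n : ℕ}
    (J : EuclideanSpace ℂ (Fin n) ≃ₛₗ[starRingEnd ℂ] EuclideanSpace ℂ (Fin n)) :
    Matrix (Fin n) (Fin n) ℂ :=
  Matrix.of fun i j => J (EuclideanSpace.single j 1) i

end Coactions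

end CQG

/-! A linear map `β : ℂⁿ → ℂⁿ ⊙ Q` is the same thing as a matrix `u` over `Q`, through `β(e i) = ∑
k, e k ⊗ u k i`, and each axiom of a filtration preserving coaction becomes a relation on `u`.
Coassociativity says that `u` is multiplicative, compatibility with the inner products says `u⋆ u =
1`, and `(J ⊗ ⋆) β = β J` says `P ū = u P`. The density axiom supplies the remaining half of
unitarity: if `u⋆ u = 1`, then `p = 1 - u u⋆` satisfies `p u = 0`, hence kills the dense span of
`β(ℂⁿ)(1 ⊗ Q)`, hence vanishes. The coaction on `ℂ` carries no information, since a unital morphism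
out of `ℂ` is unique. Morphisms of coactions are the morphisms `μ` with `μ(u i j) = v i j`. So
initial coactions and universal matrices are the same objects; the translation is
`exists_isOrthogonalMatrix`, `matrixCoaction`, `isFiltrationPreserving_matrixCoaction` and
`isCoactionHom_iff`.

For this dictionary `ℂⁿ ⊙ Q` must embed in its completion and its coordinates must be continuous.
Both follow from the fact that `x ↦ 1 ⊗ x` embeds `Q` isometrically in `ℂ ⊗ Q`, which rests on the
GNS construction (`inr_complex_injective`, `ip_single_coe`).

Existence (`exists_isFreeOrthogonal`) starts from the universal C⋆-algebra of a unitary matrix with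
`u = P ū P⁻¹`, without any comultiplication. It exists because the entries of a unitary matrix have
norm at most 1. The two copies `u ⊗ 1` and `1 ⊗ u` have commuting entries, so their product is again
a solution of the relations, and universality turns it into a comultiplication `Δ`. The density
conditions hold because `u` and `ū` are both invertible (`mul_mem_closure_span`,
`map_entry_mem_span`).

In the converse direction an initial object has the universal property, but generation by the
entries of `u` is an additional claim. It follows by comparison with the algebra already
constructed, to which the initial object is isomorphic. -/

namespace CQG

/-! ### Positive functionals and representations separate points. -/

noncomputable section Faithful

open scoped ComplexOrder in
-- Hahn–Banach separation of `-a` from the closed real cone of positive elements.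
theorem exists_positive_functional {A : Type u} [CStarAlgebra A] [PartialOrder A]
    [StarOrderedRing A] {a : A} (ha : 0 ≤ a) (ha0 : a ≠ 0) :
    ∃ φ : A →ₚ[ℂ] ℂ, φ a ≠ 0 := by
  have hna : -a ∉ ProperCone.positive ℝ A := fun h => by
    have h1 : 0 ≤ -a := h
    exact ha0 (le_antisymm (neg_nonneg.1 h1) ha)
  obtain ⟨f, hf, hfa⟩ := (ProperCone.positive ℝ A).hyperplane_separation_point hna
  have hf' : ∀ b : A, 0 ≤ b → 0 ≤ f b := fun b hb => hf b hb
  -- The separating functional is only real linear, and its values off the self-adjoint part are not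
  -- controlled. Composing with the real part first makes the complex-linear extension agree with
  -- `f` on self-adjoint elements.
  let g : Module.Dual ℝ A := f.toLinearMap.comp ((selfAdjoint.submodule ℝ A).subtype.comp realPart)
  let ψ : A →ₗ[ℂ] ℂ := g.extendRCLike
  have hψ : ∀ b : A, IsSelfAdjoint b → ψ b = f b := fun b hb => by
    have h1 : ((realPart b : selfAdjoint A) : A) = b := hb.coe_realPart
    have h2 : realPart (Complex.I • b) = 0 := by
      rw [realPart_I_smul, hb.imaginaryPart, neg_zero]
    have h3 : ∀ c, g c = f (realPart c : selfAdjoint A) := fun _ => rfl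
    simp [ψ, Module.Dual.extendRCLike_apply, h3, h1, h2]
  refine ⟨PositiveLinearMap.mk₀ ψ fun b hb => ?_, ?_⟩
  · rw [hψ b (IsSelfAdjoint.of_nonneg hb)]
    exact_mod_cast hf' b hb
  · change ψ a ≠ 0
    rw [hψ a (IsSelfAdjoint.of_nonneg ha)]
    rw [map_neg] at hfa
    exact_mod_cast (by linarith : f a ≠ 0)

open scoped ComplexOrder in
/-- Every nonzero element of a C⋆-algebra is nonzero in some representation on a Hilbert space. -/
theorem exists_representation_ne_zero {A : Type u} [CStarAlgebra A] {x : A} (hx : x ≠ 0) :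
    ∃ (H : Type u) (_ : NormedAddCommGroup H) (_ : InnerProductSpace ℂ H) (_ : CompleteSpace H)
      (π : A →⋆ₐ[ℂ] (H →L[ℂ] H)), π x ≠ 0 := by
  let _ := CStarAlgebra.spectralOrder A
  have _ := CStarAlgebra.spectralOrderedRing A
  obtain ⟨φ, hφ⟩ := exists_positive_functional (star_mul_self_nonneg x)
    (mt (CStarRing.star_mul_self_eq_zero_iff x).1 hx)
  refine ⟨φ.GNS, inferInstance, inferInstance, inferInstance, φ.gnsStarAlgHom, fun h => hφ ?_⟩
  -- The class of `1` is the GNS vector on which `x` acts with squared norm `φ (star x * x)`.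
  have h1 : φ.gnsStarAlgHom x (φ.toPreGNS 1 : φ.PreGNS) = 0 := by rw [h]; rfl
  have h2 : φ.gnsStarAlgHom x (φ.toPreGNS 1 : φ.PreGNS) = ((φ.toPreGNS x : φ.PreGNS) : φ.GNS) := by
    simp
  have h3 : ‖φ.toPreGNS x‖ = 0 := by
    rw [← Completion.norm_coe (E := φ.PreGNS), ← h2, h1, norm_zero]
  have h4 := φ.preGNS_norm_sq (φ.toPreGNS x)
  rw [h3] at h4
  simpa using h4.symm

end Faithful

/-! ### The two legs of a spatial tensor product, and extensions given by closures of graphs. -/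

noncomputable section

namespace SpatialTensor

variable {A : Type u} {B : Type v} [CStarAlgebra A] [CStarAlgebra B]

variable (A B) in
/-- The ⋆-morphism `B → A ⊗ B`, `b ↦ 1 ⊗ b`. -/
def inr : B →⋆ₐ[ℂ] SpatialTensor A B where
  toFun b := tmul 1 b
  map_one' := rfl
  map_mul' a a' := by rw [tmul_mul_tmul, mul_one]
  map_zero' := by simpa using tmul_smul (0 : ℂ) (1 : A) (0 : B)
  map_add' a a' := tmul_add 1 a a'
  commutes' c := by
    rw [Algebra.algebraMap_eq_smul_one, Algebra.algebraMap_eq_smul_one, tmul_smul, one_def]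
  map_star' a := by rw [star_tmul, star_one]

theorem inl_apply (a : A) : inl A B a = tmul a 1 := rfl

theorem inr_apply (b : B) : inr A B b = tmul 1 b := rfl

theorem inl_mul_inr (a : A) (b : B) : inl A B a * inr A B b = tmul a b := by
  rw [inl_apply, inr_apply, tmul_mul_tmul, mul_one, one_mul]

theorem inr_mul_inl (a : A) (b : B) : inr A B b * inl A B a = tmul a b := by
  rw [inl_apply, inr_apply, tmul_mul_tmul, mul_one, one_mul]

theorem commute_inl_inr (a : A) (b : B) : Commute (inl A B a) (inr A B b) := by
  rw [Commute, SemiconjBy, inl_mul_inr, inr_mul_inl]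

theorem map_tmul {A' : Type u} {B' : Type v} [CStarAlgebra A'] [CStarAlgebra B']
    (f : A →⋆ₐ[ℂ] A') (g : B →⋆ₐ[ℂ] B') (a : A) (b : B) :
    map f g (tmul a b) = tmul (f a) (g b) := by
  rw [tmul, map_coe, AlgTensor.map_tmul]; rfl

/-- Scalars move to the second leg, so `ℂ ⊗ B` is `B` via `inr`; all computations in `ℂ ⊗ R` below
are reduced to `R` in this way. -/
theorem tmul_complex (z : ℂ) (b : B) : (tmul z b : SpatialTensor ℂ B) = inr ℂ B (z • b) := by
  rw [inr_apply, tmul_smul, ← smul_tmul, smul_eq_mul, mul_one]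

variable (B) in
-- The spatial norm dominates every pair of representations. Pairing the scalar representation of
-- `ℂ` with a representation of `B` that does not kill `x` bounds the norm of `1 ⊗ x` away from
-- zero.
theorem inr_complex_injective : Function.Injective (inr ℂ B) := by
  rw [injective_iff_map_eq_zero]
  intro x hx
  by_contra hx0
  obtain ⟨K, _, _, _, ρ, hρ⟩ := exists_representation_ne_zero hx0
  have h1 : spatialNorm ((1 : ℂ) ⊗ₜ[ℂ] x) = 0 := by
    have h2 : ‖(AlgTensor.tmul (1 : ℂ) x : AlgTensor ℂ B)‖ = 0 := by
      rw [← Completion.norm_coe]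
      exact norm_eq_zero.2 hx
    exact h2
  have h3 := norm_tensorRep_le (StarAlgHom.ofId ℂ (ℂ →L[ℂ] ℂ)) ρ ((1 : ℂ) ⊗ₜ[ℂ] x)
  rw [h1, tensorRep_tmul, map_one] at h3
  apply hρ
  ext k
  have h4 := (TensorProduct.mapL (1 : ℂ →L[ℂ] ℂ) (ρ x)).le_opNorm ((1 : ℂ) ⊗ₜ[ℂ] k)
  rw [TensorProduct.mapL_tmul, TensorProduct.norm_tmul] at h4
  have h5 : ‖ρ x k‖ ≤ 0 := by
    have h6 := h4.trans (mul_le_mul_of_nonneg_right h3 (norm_nonneg _))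
    simpa using h6
  simpa using h5

variable (B) in
theorem isometry_inr_complex : Isometry (inr ℂ B) :=
  NonUnitalStarAlgHom.isometry (inr ℂ B) (inr_complex_injective B)

end SpatialTensor

theorem extendsTo_coe {X Y : Type*} [UniformSpace X] [TopologicalSpace Y] (f : X → Y) (x : X) :
    ExtendsTo f (x : Completion X) (f x) :=
  subset_closure ⟨x, rfl⟩

/-- Turns coassociativity, stated through closures of graphs, into an honest equation. The topology
of `X` is induced from its completion even if `X` is not separated, so points of the graph near `(x,
y)` have second coordinates near `f x`. -/
theorem ExtendsTo.eq_of_continuous {X Y : Type*} [UniformSpace X] [TopologicalSpace Y] [T2Space Y]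
    {f : X → Y} (hf : Continuous f) {x : X} {y : Y} (h : ExtendsTo f (x : Completion X) y) :
    y = f x := by
  by_contra hne
  obtain ⟨U, V, hU, hV, hyU, hxV, hUV⟩ := t2_separation hne
  have h1 : f ⁻¹' V ∈ Filter.comap ((↑) : X → Completion X) (nhds (x : Completion X)) := by
    rw [← (Completion.isDenseInducing_coe (α := X)).isInducing.nhds_eq_comap]
    exact hf.continuousAt.preimage_mem_nhds (hV.mem_nhds hxV)
  obtain ⟨W, hW, hWV⟩ := Filter.mem_comap.1 h1
  obtain ⟨_, ⟨h2, h3⟩, ⟨t, rfl⟩⟩ :=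
    mem_closure_iff_nhds.1 h _ (prod_mem_nhds hW (hU.mem_nhds hyU))
  exact Set.disjoint_left.1 hUV h3 (hWV h2)

end

/-! ### Universal C⋆-algebras of bounded relations. -/

noncomputable section Universal

/-- Relations between the elements of a family `v : X → R` in a C⋆-algebra `R` which bound the norms
of these elements. -/
structure CStarRelation (X : Type u) where
  /-- The relations. -/
  Holds : ∀ (R : Type u) [CStarAlgebra R], (X → R) → Prop
  /-- A bound for the norms of the elements. -/
  bound : X → ℝ
  norm_le : ∀ (R : Type u) [CStarAlgebra R] (v : X → R), Holds R v → ∀ x, ‖v x‖ ≤ bound x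

/-- The involution of a free algebra reverses words and fixes generators and scalars, so it is
linear and not antilinear. Real coefficients, followed by complexification, therefore yield the
complex ⋆-algebra with self-adjoint free generators. -/
instance {Y : Type*} : StarModule ℝ (FreeAlgebra ℝ Y) where
  star_smul r a := by
    rw [Algebra.smul_def, star_mul, FreeAlgebra.star_algebraMap, ← Algebra.commutes,
      ← Algebra.smul_def, star_trivial r]

variable {X : Type u}

/-- The free complex ⋆-algebra on `X`, generated by the real and imaginary parts of its generators,
to be endowed with the largest C⋆-seminorm that is compatible with the relations `r`. -/
@[nolint unusedArguments]
def FreeStarAlgebra (_ : CStarRelation X) : Type u := ℂ ⊗[ℝ] FreeAlgebra ℝ (X × Bool)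

namespace FreeStarAlgebra

variable (r : CStarRelation X)

instance : Ring (FreeStarAlgebra r) := inferInstanceAs (Ring (ℂ ⊗[ℝ] FreeAlgebra ℝ (X × Bool)))
instance : Algebra ℂ (FreeStarAlgebra r) :=
  inferInstanceAs (Algebra ℂ (ℂ ⊗[ℝ] FreeAlgebra ℝ (X × Bool)))
instance : StarRing (FreeStarAlgebra r) :=
  inferInstanceAs (StarRing (ℂ ⊗[ℝ] FreeAlgebra ℝ (X × Bool)))

variable {r}

/-- The elementary tensor `c ⊗ w`. -/
def mk (c : ℂ) (w : FreeAlgebra ℝ (X × Bool)) : FreeStarAlgebra r := c ⊗ₜ[ℝ] w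

theorem induction {p : FreeStarAlgebra r → Prop} (h0 : p 0) (ht : ∀ c w, p (mk c w))
    (ha : ∀ z w, p z → p w → p (z + w)) (z : FreeStarAlgebra r) : p z :=
  TensorProduct.induction_on (motive := p) z h0 ht ha

theorem smul_mk (c d : ℂ) (w : FreeAlgebra ℝ (X × Bool)) :
    c • (mk d w : FreeStarAlgebra r) = mk (c * d) w := rfl

theorem star_mk (c : ℂ) (w : FreeAlgebra ℝ (X × Bool)) :
    star (mk c w : FreeStarAlgebra r) = mk (star c) (star w) := rfl

theorem mk_mul_mk (c d : ℂ) (w w' : FreeAlgebra ℝ (X × Bool)) :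
    (mk c w * mk d w' : FreeStarAlgebra r) = mk (c * d) (w * w') :=
  Algebra.TensorProduct.tmul_mul_tmul _ _ _ _

theorem mk_add (c : ℂ) (w w' : FreeAlgebra ℝ (X × Bool)) :
    (mk c (w + w') : FreeStarAlgebra r) = mk c w + mk c w' :=
  TensorProduct.tmul_add _ _ _

instance : StarModule ℂ (FreeStarAlgebra r) where
  star_smul c z := by
    induction z using induction with
    | h0 => simp
    | ht d w => rw [smul_mk, star_mk, star_mk, smul_mk, star_mul']
    | ha z w hz hw => rw [smul_add, star_add, hz, hw, star_add, smul_add]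

variable (r) in
/-- The generators of the free ⋆-algebra. -/
def gen (x : X) : FreeStarAlgebra r :=
  mk 1 (FreeAlgebra.ι ℝ (x, false)) + mk Complex.I (FreeAlgebra.ι ℝ (x, true))

section Eval

variable {R : Type v} [CStarAlgebra R]

/-- The values of the real and imaginary parts of the generators at a family of elements of a
C⋆-algebra. -/
def evalReal (v : X → R) : FreeAlgebra ℝ (X × Bool) →ₐ[ℝ] R :=
  FreeAlgebra.lift ℝ fun p =>
    bif p.2 then (imaginaryPart (v p.1) : R) else (realPart (v p.1) : R)

theorem evalReal_false (v : X → R) (x : X) :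
    evalReal v (FreeAlgebra.ι ℝ (x, false)) = realPart (v x) :=
  FreeAlgebra.lift_ι_apply _ _

theorem evalReal_true (v : X → R) (x : X) :
    evalReal v (FreeAlgebra.ι ℝ (x, true)) = imaginaryPart (v x) :=
  FreeAlgebra.lift_ι_apply _ _

/-- Generators are fixed by the involution and take self-adjoint values, so reversing words
corresponds to the involution of `R`. -/
theorem evalReal_star (v : X → R) (w : FreeAlgebra ℝ (X × Bool)) :
    evalReal v (star w) = star (evalReal v w) := by
  induction w using FreeAlgebra.induction with
  | grade0 t =>
    rw [FreeAlgebra.star_algebraMap, AlgHom.commutes, Algebra.algebraMap_eq_smul_one, star_smul,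
      star_one, star_trivial]
  | grade1 p =>
    obtain ⟨x, _ | _⟩ := p
    · rw [FreeAlgebra.star_ι, evalReal_false]
      exact (realPart (v x)).2.star_eq.symm
    · rw [FreeAlgebra.star_ι, evalReal_true]
      exact (imaginaryPart (v x)).2.star_eq.symm
  | mul w w' hw hw' => rw [star_mul, map_mul, map_mul, star_mul, hw, hw']
  | add w w' hw hw' => rw [star_add, map_add, map_add, star_add, hw, hw']

/-- The evaluation `eval` as a morphism of algebras. -/
def evalAlgHom (v : X → R) : FreeStarAlgebra r →ₐ[ℂ] R :=
  Algebra.TensorProduct.lift (Algebra.ofId ℂ R) (evalReal v) (fun c _ => Algebra.commutes c _)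

theorem evalAlgHom_mk (v : X → R) (c : ℂ) (w : FreeAlgebra ℝ (X × Bool)) :
    evalAlgHom v (mk c w : FreeStarAlgebra r) = c • evalReal v w := by
  rw [Algebra.smul_def]
  rfl

/-- The evaluation of the elements of the free ⋆-algebra at a family of elements of a
C⋆-algebra. -/
def eval (v : X → R) : FreeStarAlgebra r →⋆ₐ[ℂ] R where
  __ := (evalAlgHom v : FreeStarAlgebra r →ₐ[ℂ] R)
  map_star' z := by
    change evalAlgHom v (star z) = star (evalAlgHom v z)
    induction z using induction with
    | h0 => rw [star_zero, map_zero, star_zero]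
    | ht c w => rw [star_mk, evalAlgHom_mk, evalAlgHom_mk, evalReal_star, star_smul]
    | ha z w hz hw => rw [star_add, map_add, hz, hw, map_add, star_add]

theorem eval_mk (v : X → R) (c : ℂ) (w : FreeAlgebra ℝ (X × Bool)) :
    eval v (mk c w : FreeStarAlgebra r) = c • evalReal v w :=
  evalAlgHom_mk v c w

theorem eval_gen (v : X → R) (x : X) : eval v (gen r x) = v x := by
  rw [gen, map_add, eval_mk, eval_mk, evalReal_false, evalReal_true, one_smul]
  exact realPart_add_I_smul_imaginaryPart (v x)

end Eval

/-- Guarantees that the supremum defining the seminorm is finite: the bounds on the generators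
propagate through sums and products, uniformly in the algebra `R`. -/
theorem exists_norm_eval_le (z : FreeStarAlgebra r) : ∃ C : ℝ, ∀ (R : Type u) [CStarAlgebra R]
    (v : X → R), r.Holds R v → ‖eval v z‖ ≤ C := by
  induction z using induction with
  | h0 => exact ⟨0, fun R _ v hv => by simp⟩
  | ha z w hz hw =>
    obtain ⟨C, hC⟩ := hz
    obtain ⟨D, hD⟩ := hw
    refine ⟨C + D, fun R _ v hv => ?_⟩
    rw [map_add]
    exact (norm_add_le _ _).trans (add_le_add (hC R v hv) (hD R v hv))
  | ht c w =>
    -- Pulling out the scalar leaves `1 ⊗ w`, which is multiplicative in `w`.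
    suffices h : ∃ C : ℝ, ∀ (R : Type u) [CStarAlgebra R] (v : X → R), r.Holds R v →
        ‖eval v (mk 1 w : FreeStarAlgebra r)‖ ≤ C by
      obtain ⟨C, hC⟩ := h
      refine ⟨‖c‖ * C, fun R _ v hv => ?_⟩
      rw [← mul_one c, ← smul_mk, map_smul, mul_one, norm_smul]
      gcongr
      exact hC R v hv
    induction w using FreeAlgebra.induction with
    | grade0 t =>
      refine ⟨‖t‖ * 1, fun R _ v hv => ?_⟩
      rw [eval_mk, one_smul, AlgHom.commutes, Algebra.algebraMap_eq_smul_one, norm_smul]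
      gcongr
      -- The zero algebra is admitted, and there `‖1‖ = 0`; only `‖1‖ ≤ 1` holds in general.
      rcases subsingleton_or_nontrivial R with _ | _
      · rw [Subsingleton.elim (1 : R) 0, norm_zero]
        exact zero_le_one
      · rw [CStarRing.norm_one]
    | grade1 p =>
      obtain ⟨x, _ | _⟩ := p
      · refine ⟨r.bound x, fun R _ v hv => ?_⟩
        rw [eval_mk, one_smul, evalReal_false]
        exact (realPart.norm_le (v x)).trans (r.norm_le R v hv x)
      · refine ⟨r.bound x, fun R _ v hv => ?_⟩
        rw [eval_mk, one_smul, evalReal_true]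
        exact (imaginaryPart.norm_le (v x)).trans (r.norm_le R v hv x)
    | mul w w' hw hw' =>
      obtain ⟨C, hC⟩ := hw
      obtain ⟨D, hD⟩ := hw'
      refine ⟨C * D, fun R _ v hv => ?_⟩
      rw [← mul_one (1 : ℂ), ← mk_mul_mk, map_mul]
      exact (norm_mul_le _ _).trans (mul_le_mul (hC R v hv) (hD R v hv) (norm_nonneg _)
        ((norm_nonneg _).trans (hC R v hv)))
    | add w w' hw hw' =>
      obtain ⟨C, hC⟩ := hw
      obtain ⟨D, hD⟩ := hw'
      refine ⟨C + D, fun R _ v hv => ?_⟩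
      rw [mk_add, map_add]
      exact (norm_add_le _ _).trans (add_le_add (hC R v hv) (hD R v hv))

/-- The norms of the evaluations of an element at the families which satisfy the relations. -/
def evalNorms (z : FreeStarAlgebra r) : Set ℝ :=
  {t | ∃ (R : Type u) (_ : CStarAlgebra R) (v : X → R), r.Holds R v ∧ t = ‖eval v z‖}

theorem norm_eval_le_sSup {R : Type u} [CStarAlgebra R] {v : X → R} (hv : r.Holds R v)
    (z : FreeStarAlgebra r) : ‖eval v z‖ ≤ sSup (evalNorms z) := by
  obtain ⟨C, hC⟩ := exists_norm_eval_le z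
  refine le_csSup ⟨C, ?_⟩ ⟨R, _, v, hv, rfl⟩
  rintro _ ⟨R, _, v, hv, rfl⟩
  exact hC R v hv

/-- The assumption `0 ≤ C` covers the case in which no family satisfies the relations, where the
supremum has the default value 0. -/
theorem sSup_evalNorms_le {z : FreeStarAlgebra r} {C : ℝ} (hC : 0 ≤ C)
    (h : ∀ (R : Type u) [CStarAlgebra R] (v : X → R), r.Holds R v → ‖eval v z‖ ≤ C) :
    sSup (evalNorms z) ≤ C :=
  Real.sSup_le (by rintro _ ⟨R, _, v, hv, rfl⟩; exact h R v hv) hC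

theorem sSup_evalNorms_nonneg (z : FreeStarAlgebra r) : 0 ≤ sSup (evalNorms z) :=
  Real.sSup_nonneg (by rintro _ ⟨R, _, v, hv, rfl⟩; exact norm_nonneg _)

variable (r) in
/-- The largest C⋆-seminorm that is compatible with the relations. -/
def ringSeminorm : RingSeminorm (FreeStarAlgebra r) where
  toFun z := sSup (evalNorms z)
  map_zero' := le_antisymm (sSup_evalNorms_le le_rfl fun R _ v _ => by simp)
    (sSup_evalNorms_nonneg _)
  add_le' z w := sSup_evalNorms_le
    (add_nonneg (sSup_evalNorms_nonneg _) (sSup_evalNorms_nonneg _)) fun R _ v hv => by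
      rw [map_add]
      exact (norm_add_le _ _).trans (add_le_add (norm_eval_le_sSup hv z) (norm_eval_le_sSup hv w))
  neg' z := by simp only [evalNorms, map_neg, norm_neg]
  mul_le' z w := sSup_evalNorms_le
    (mul_nonneg (sSup_evalNorms_nonneg _) (sSup_evalNorms_nonneg _)) fun R _ v hv => by
      rw [map_mul]
      exact (norm_mul_le _ _).trans (mul_le_mul (norm_eval_le_sSup hv z) (norm_eval_le_sSup hv w)
        (norm_nonneg _) (sSup_evalNorms_nonneg _))

instance : SeminormedRing (FreeStarAlgebra r) := (ringSeminorm r).toSeminormedRing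

theorem norm_eval_le {R : Type u} [CStarAlgebra R] {v : X → R} (hv : r.Holds R v)
    (z : FreeStarAlgebra r) : ‖eval v z‖ ≤ ‖z‖ :=
  norm_eval_le_sSup hv z

theorem norm_le {z : FreeStarAlgebra r} {C : ℝ} (hC : 0 ≤ C)
    (h : ∀ (R : Type u) [CStarAlgebra R] (v : X → R), r.Holds R v → ‖eval v z‖ ≤ C) : ‖z‖ ≤ C :=
  sSup_evalNorms_le hC h

instance : NormedAlgebra ℂ (FreeStarAlgebra r) where
  norm_smul_le c z := norm_le (by positivity) fun R _ v hv => by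
    rw [map_smul, norm_smul]
    gcongr
    exact norm_eval_le hv z

instance : NormedStarGroup (FreeStarAlgebra r) where
  norm_star_le z := norm_le (norm_nonneg _) fun R _ v hv => by
    rw [map_star, norm_star]
    exact norm_eval_le hv z

/-- The C⋆-identity holds in each evaluation and so passes to the supremum. -/
theorem norm_mul_self_le (z : FreeStarAlgebra r) : ‖z‖ * ‖z‖ ≤ ‖star z * z‖ := by
  have h : ‖z‖ ≤ √‖star z * z‖ := norm_le (Real.sqrt_nonneg _) fun R _ v hv => by
    refine Real.le_sqrt_of_sq_le ?_
    rw [pow_two, ← CStarRing.norm_star_mul_self, ← map_star, ← map_mul]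
    exact norm_eval_le hv _
  calc ‖z‖ * ‖z‖ ≤ √‖star z * z‖ * √‖star z * z‖ := by gcongr
    _ = _ := Real.mul_self_sqrt (norm_nonneg _)

end FreeStarAlgebra

/-- The universal C⋆-algebra generated by a family that satisfies the relations `r`. -/
abbrev UniversalCStarAlgebra (r : CStarRelation X) : Type u := Completion (FreeStarAlgebra r)

namespace UniversalCStarAlgebra

variable {r : CStarRelation X}

instance : Star (UniversalCStarAlgebra r) := ⟨Completion.map star⟩

theorem coe_star (x : FreeStarAlgebra r) :
    ((star x : FreeStarAlgebra r) : UniversalCStarAlgebra r) = star (x : UniversalCStarAlgebra r) :=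
  (Completion.map_coe
    (starNormedAddGroupHom (E := FreeStarAlgebra r)).uniformContinuous x).symm

theorem continuous_star' : Continuous (star : UniversalCStarAlgebra r → UniversalCStarAlgebra r) :=
  Completion.continuous_map

instance : StarRing (UniversalCStarAlgebra r) where
  star_involutive x := by
    induction x using Completion.induction_on with
    | hp => exact isClosed_eq (continuous_star'.comp continuous_star') continuous_id
    | ih x => rw [← coe_star, ← coe_star, star_star]
  star_mul x y := by
    induction x, y using Completion.induction_on₂ with
    | hp =>
      exact isClosed_eq (continuous_star'.comp continuous_mul)
        ((continuous_star'.comp continuous_snd).mul (continuous_star'.comp continuous_fst))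
    | ih x y => rw [← coe_star, ← coe_star, ← Completion.coe_mul, ← coe_star, star_mul,
        Completion.coe_mul]
  star_add x y := by
    induction x, y using Completion.induction_on₂ with
    | hp =>
      exact isClosed_eq (continuous_star'.comp continuous_add)
        ((continuous_star'.comp continuous_fst).add (continuous_star'.comp continuous_snd))
    | ih x y => rw [← coe_star, ← coe_star, ← Completion.coe_add, ← coe_star, star_add,
        Completion.coe_add]

instance : NormedAlgebra ℂ (UniversalCStarAlgebra r) where
  norm_smul_le := norm_smul_le

instance : CStarAlgebra (UniversalCStarAlgebra r) where
  star_smul c x := by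
    induction x using Completion.induction_on with
    | hp =>
      exact isClosed_eq (continuous_star'.comp (continuous_const_smul c))
        ((continuous_const_smul _).comp continuous_star')
    | ih x => rw [← coe_star, ← Completion.coe_smul, ← coe_star, star_smul, Completion.coe_smul]
  norm_mul_self_le x := by
    induction x using Completion.induction_on with
    | hp =>
      exact isClosed_le (continuous_norm.mul continuous_norm)
        (continuous_norm.comp (continuous_star'.mul continuous_id))
    | ih x =>
      rw [← coe_star, ← Completion.coe_mul, Completion.norm_coe, Completion.norm_coe]
      exact FreeStarAlgebra.norm_mul_self_le x

variable (r) in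
/-- The canonical ⋆-morphism from the free ⋆-algebra to the universal C⋆-algebra. -/
def ofFree : FreeStarAlgebra r →⋆ₐ[ℂ] UniversalCStarAlgebra r where
  toFun x := (x : UniversalCStarAlgebra r)
  map_one' := Completion.coe_one _
  map_mul' := Completion.coe_mul
  map_zero' := Completion.coe_zero
  map_add' := Completion.coe_add
  commutes' c := by
    rw [Algebra.algebraMap_eq_smul_one, Algebra.algebraMap_eq_smul_one, Completion.coe_smul,
      Completion.coe_one]
  map_star' := coe_star

variable (r) in
/-- The generators of the universal C⋆-algebra. -/
def gen (x : X) : UniversalCStarAlgebra r := ofFree r (FreeStarAlgebra.gen r x)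

/-- Elements of seminorm zero die in the completion. Hence every identity that holds under all
admissible evaluations holds in the universal algebra, without taking an explicit quotient. -/
theorem ofFree_eq_zero {z : FreeStarAlgebra r} (h : ∀ (R : Type u) [CStarAlgebra R] (v : X → R),
    r.Holds R v → FreeStarAlgebra.eval v z = 0) : ofFree r z = 0 := by
  refine norm_le_zero_iff.1 ?_
  refine (Completion.norm_coe z).trans_le (FreeStarAlgebra.norm_le le_rfl fun R _ v hv => ?_)
  rw [h R v hv, norm_zero]

theorem uniformContinuous_eval {R : Type u} [CStarAlgebra R] {v : X → R} (hv : r.Holds R v) :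
    UniformContinuous (FreeStarAlgebra.eval v : FreeStarAlgebra r → R) :=
  ((FreeStarAlgebra.eval v).toAlgHom.toLinearMap.mkContinuous 1
    (fun z => by simpa using FreeStarAlgebra.norm_eval_le hv z)).uniformContinuous

/-- The ⋆-morphism from the universal C⋆-algebra that is given by a family which satisfies the
relations. -/
def lift {R : Type u} [CStarAlgebra R] {v : X → R} (hv : r.Holds R v) :
    UniversalCStarAlgebra r →⋆ₐ[ℂ] R where
  toFun := Completion.extension (FreeStarAlgebra.eval v)
  map_one' := by
    rw [← Completion.coe_one, Completion.extension_coe (uniformContinuous_eval hv), map_one]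
  map_mul' x y := by
    induction x, y using Completion.induction_on₂ with
    | hp =>
      exact isClosed_eq (Completion.continuous_extension.comp continuous_mul)
        ((Completion.continuous_extension.comp continuous_fst).mul
          (Completion.continuous_extension.comp continuous_snd))
    | ih x y => simp only [← Completion.coe_mul, Completion.extension_coe (uniformContinuous_eval hv),
        map_mul]
  map_zero' := by
    rw [← Completion.coe_zero, Completion.extension_coe (uniformContinuous_eval hv), map_zero]
  map_add' x y := by
    induction x, y using Completion.induction_on₂ with
    | hp =>
      exact isClosed_eq (Completion.continuous_extension.comp continuous_add)
        ((Completion.continuous_extension.comp continuous_fst).add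
          (Completion.continuous_extension.comp continuous_snd))
    | ih x y => simp only [← Completion.coe_add, Completion.extension_coe (uniformContinuous_eval hv),
        map_add]
  commutes' c := by
    rw [← AlgHomClass.commutes (ofFree r) c]
    exact (Completion.extension_coe (uniformContinuous_eval hv) _).trans (AlgHomClass.commutes _ c)
  map_star' x := by
    induction x using Completion.induction_on with
    | hp =>
      exact isClosed_eq (Completion.continuous_extension.comp continuous_star')
        (continuous_star.comp Completion.continuous_extension)
    | ih x => simp only [← coe_star, Completion.extension_coe (uniformContinuous_eval hv), map_star]

theorem lift_gen {R : Type u} [CStarAlgebra R] {v : X → R} (hv : r.Holds R v) (x : X) :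
    lift hv (gen r x) = v x :=
  (Completion.extension_coe (uniformContinuous_eval hv) _).trans (FreeStarAlgebra.eval_gen v x)

variable (r) in
-- The free algebra is generated by the real and imaginary parts, which are linear combinations of
-- `gen` and its adjoint; its image in the completion is dense.
theorem topologicalClosure_adjoin_gen :
    (StarAlgebra.adjoin ℂ (Set.range (gen r))).topologicalClosure = ⊤ := by
  have h : ∀ z, ofFree r z ∈ StarAlgebra.adjoin ℂ (Set.range (gen r)) := by
    intro z
    set S := StarAlgebra.adjoin ℂ (Set.range (gen r))
    have hg : ∀ x, gen r x ∈ S := fun x => StarAlgebra.subset_adjoin ℂ _ ⟨x, rfl⟩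
    induction z using FreeStarAlgebra.induction with
    | h0 => rw [map_zero]; exact zero_mem _
    | ha z w hz hw => rw [map_add]; exact add_mem hz hw
    | ht c w =>
      rw [← mul_one c, ← FreeStarAlgebra.smul_mk, map_smul]
      refine SMulMemClass.smul_mem c ?_
      induction w using FreeAlgebra.induction with
      | grade0 t =>
        have h1 : (FreeStarAlgebra.mk 1 (algebraMap ℝ _ t) : FreeStarAlgebra r) =
            algebraMap ℂ _ (t : ℂ) := by
          have h2 : (FreeStarAlgebra.mk 1 (1 : FreeAlgebra ℝ (X × Bool)) : FreeStarAlgebra r) = 1 :=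
            rfl
          have h3 : (FreeStarAlgebra.mk 1 (t • 1 : FreeAlgebra ℝ (X × Bool)) : FreeStarAlgebra r) =
            FreeStarAlgebra.mk (t • 1) 1 := (TensorProduct.smul_tmul _ _ _).symm
          rw [Algebra.algebraMap_eq_smul_one, h3, Algebra.algebraMap_eq_smul_one, ← h2,
            FreeStarAlgebra.smul_mk, mul_one, Complex.real_smul, mul_one]
        rw [h1, AlgHomClass.commutes]
        exact algebraMap_mem S _
      | grade1 p =>
        obtain ⟨x, b⟩ := p
        have hs : star (FreeStarAlgebra.gen r x) =
            FreeStarAlgebra.mk 1 (FreeAlgebra.ι ℝ (x, false)) -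
            FreeStarAlgebra.mk Complex.I (FreeAlgebra.ι ℝ (x, true)) := by
          rw [FreeStarAlgebra.gen, star_add, FreeStarAlgebra.star_mk, FreeStarAlgebra.star_mk,
            FreeAlgebra.star_ι, FreeAlgebra.star_ι, star_one, sub_eq_add_neg, Complex.star_def,
            Complex.conj_I]
          exact congrArg _ (TensorProduct.neg_tmul _ _)
        have hI : (FreeStarAlgebra.mk Complex.I (FreeAlgebra.ι ℝ (x, true)) : FreeStarAlgebra r) =
            Complex.I • FreeStarAlgebra.mk 1 (FreeAlgebra.ι ℝ (x, true)) := by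
          rw [FreeStarAlgebra.smul_mk, mul_one]
        cases b
        · have h2 : (FreeStarAlgebra.mk 1 (FreeAlgebra.ι ℝ (x, false)) : FreeStarAlgebra r) =
              (1 / 2 : ℂ) • (FreeStarAlgebra.gen r x + star (FreeStarAlgebra.gen r x)) := by
            rw [hs, FreeStarAlgebra.gen]
            module
          rw [h2, map_smul, map_add, map_star]
          exact SMulMemClass.smul_mem _ (add_mem (hg x) (star_mem (hg x)))
        -- The imaginary part `(g - g⋆) / (2i)`, with `1 / (2i) = -i / 2`.
        · have h2 : (FreeStarAlgebra.mk 1 (FreeAlgebra.ι ℝ (x, true)) : FreeStarAlgebra r) =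
              (-Complex.I / 2 : ℂ) • (FreeStarAlgebra.gen r x - star (FreeStarAlgebra.gen r x)) := by
            rw [hs, FreeStarAlgebra.gen, hI]
            have h3 : Complex.I * Complex.I = -1 := Complex.I_mul_I
            match_scalars
            · linear_combination h3
            · ring
          rw [h2, map_smul, map_sub, map_star]
          exact SMulMemClass.smul_mem _ (sub_mem (hg x) (star_mem (hg x)))
      | mul w w' hw hw' =>
        rw [← mul_one (1 : ℂ), ← FreeStarAlgebra.mk_mul_mk, map_mul]
        exact mul_mem hw hw'
      | add w w' hw hw' =>
        rw [FreeStarAlgebra.mk_add, map_add]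
        exact add_mem hw hw'
  rw [eq_top_iff]
  intro x _
  exact closure_mono (Set.range_subset_iff.2 h) (Completion.denseRange_coe x)

end UniversalCStarAlgebra

end Universal

/-! ### Unitary matrices with `u = P ū P⁻¹`, and their universal C⋆-algebra. -/

noncomputable section ConjUnitary

theorem continuous_starAlgHom {A B : Type*} [CStarAlgebra A] [CStarAlgebra B] (f : A →⋆ₐ[ℂ] B) :
    Continuous f :=
  AddMonoidHomClass.continuous_of_bound f 1 fun x => by
    simpa using NonUnitalStarAlgHom.norm_apply_le f x

variable {n : ℕ} {P : Matrix (Fin n) (Fin n) ℂ}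

/-- The matrix `u` over a C⋆-algebra is unitary and satisfies `u = P ū P⁻¹`. -/
structure IsConjUnitary (P : Matrix (Fin n) (Fin n) ℂ) {R : Type*} [CStarAlgebra R]
    (u : Matrix (Fin n) (Fin n) R) : Prop where
  star_mul_self : u.conjTranspose * u = 1
  mul_star_self : u * u.conjTranspose = 1
  eq_conj : u = P.map (algebraMap ℂ R) * u.map star * P⁻¹.map (algebraMap ℂ R)

/-- Separates the relations that make sense in any C⋆-algebra from multiplicativity, which
presupposes a comultiplication. Only the former enter the construction of the universal algebra. -/
theorem isOrthogonalMatrix_iff {Q : Type u} [CStarAlgebra Q] [WoronowiczAlgebra Q]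
    {u : Matrix (Fin n) (Fin n) Q} : IsOrthogonalMatrix P u ↔ IsConjUnitary P u ∧
      ∀ i j, WoronowiczAlgebra.comul (u i j) = ∑ k, SpatialTensor.tmul (u i k) (u k j) :=
  ⟨fun h => ⟨⟨h.star_mul_self, h.mul_star_self, h.eq_conj⟩, h.multiplicative⟩,
    fun h => ⟨h.2, h.1.star_mul_self, h.1.mul_star_self, h.1.eq_conj⟩⟩

theorem map_algebraMap_map {A B : Type*} [Semiring A] [Algebra ℂ A] [Star A] [Semiring B]
    [Algebra ℂ B] [Star B] (f : A →⋆ₐ[ℂ] B) (M : Matrix (Fin n) (Fin n) ℂ) :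
    (M.map (algebraMap ℂ A)).map f = M.map (algebraMap ℂ B) := by
  ext i j
  simp only [Matrix.map_apply, AlgHomClass.commutes]

theorem map_algebraMap_mul_inv (hP : IsUnit P.det) (A : Type*) [Semiring A] [Algebra ℂ A] :
    P.map (algebraMap ℂ A) * P⁻¹.map (algebraMap ℂ A) = 1 := by
  rw [← Matrix.map_mul, Matrix.mul_nonsing_inv P hP, Matrix.map_one _ (map_zero _) (map_one _)]

theorem map_algebraMap_inv_mul (hP : IsUnit P.det) (A : Type*) [Semiring A] [Algebra ℂ A] :
    P⁻¹.map (algebraMap ℂ A) * P.map (algebraMap ℂ A) = 1 := by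
  rw [← Matrix.map_mul, Matrix.nonsing_inv_mul P hP, Matrix.map_one _ (map_zero _) (map_one _)]

theorem map_star_map {A B : Type*} [Star A] [Star B] {F : Type*} [FunLike F A B]
    [StarHomClass F A B] (f : F) (M : Matrix (Fin n) (Fin n) A) :
    (M.map star).map f = (M.map f).map star := by
  ext i j
  exact map_star f _

theorem conjTranspose_map_starHom {A B : Type*} [Star A] [Star B] {F : Type*} [FunLike F A B]
    [StarHomClass F A B] (f : F) (M : Matrix (Fin n) (Fin n) A) :
    M.conjTranspose.map f = (M.map f).conjTranspose :=
  Matrix.conjTranspose_map f fun x => map_star f x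

namespace IsConjUnitary

variable {R : Type u} [CStarAlgebra R] {u : Matrix (Fin n) (Fin n) R}

theorem map {S : Type v} [CStarAlgebra S] (h : IsConjUnitary P u) (f : R →⋆ₐ[ℂ] S) :
    IsConjUnitary P (u.map f) where
  star_mul_self := by
    rw [← conjTranspose_map_starHom, ← Matrix.map_mul, h.star_mul_self,
      Matrix.map_one _ (map_zero f) (map_one f)]
  mul_star_self := by
    rw [← conjTranspose_map_starHom, ← Matrix.map_mul, h.mul_star_self,
      Matrix.map_one _ (map_zero f) (map_one f)]
  eq_conj := by
    conv_lhs => rw [h.eq_conj]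
    rw [Matrix.map_mul, Matrix.map_mul, map_algebraMap_map, map_algebraMap_map, map_star_map]

theorem map_star_eq (h : IsConjUnitary P u) (hP : IsUnit P.det) :
    u.map star = P⁻¹.map (algebraMap ℂ R) * u * P.map (algebraMap ℂ R) := by
  conv_rhs => rw [h.eq_conj]
  have h1 := map_algebraMap_inv_mul hP R
  simp only [mul_assoc, h1, mul_one]
  rw [← mul_assoc, h1, one_mul]

/-- The matrix `ū` is invertible. -/
theorem exists_inv_map_star (h : IsConjUnitary P u) (hP : IsUnit P.det) :
    ∃ w : Matrix (Fin n) (Fin n) R, u.map star * w = 1 ∧ w * u.map star = 1 := by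
  have h1 := map_algebraMap_inv_mul hP R
  have h2 := map_algebraMap_mul_inv hP R
  -- Since `ū = P⁻¹ u P` with `u` unitary, the inverse is `P⁻¹ u⋆ P`.
  refine ⟨P⁻¹.map (algebraMap ℂ R) * u.conjTranspose * P.map (algebraMap ℂ R), ?_, ?_⟩
  · rw [h.map_star_eq hP]
    calc _ = P⁻¹.map (algebraMap ℂ R) * (u * (P.map (algebraMap ℂ R) * P⁻¹.map (algebraMap ℂ R)) *
          u.conjTranspose) * P.map (algebraMap ℂ R) := by simp only [mul_assoc]
      _ = 1 := by rw [h2, mul_one, h.mul_star_self, mul_one, h1]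
  · rw [h.map_star_eq hP]
    calc _ = P⁻¹.map (algebraMap ℂ R) * (u.conjTranspose * (P.map (algebraMap ℂ R) *
          P⁻¹.map (algebraMap ℂ R)) * u) * P.map (algebraMap ℂ R) := by simp only [mul_assoc]
      _ = 1 := by rw [h2, mul_one, h.star_mul_self, mul_one, h1]

/-- The closure property behind the comultiplication. Commuting entries are what makes the entrywise
adjoint of `u v` equal to `ū v̄`; over a noncommutative algebra the factors would otherwise appear
in the wrong order. -/
theorem mul {v : Matrix (Fin n) (Fin n) R} (hu : IsConjUnitary P u) (hv : IsConjUnitary P v)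
    (hP : IsUnit P.det) (huv : ∀ i k l j, Commute (u i k) (v l j)) : IsConjUnitary P (u * v) where
  star_mul_self := by
    rw [Matrix.conjTranspose_mul, mul_assoc, ← mul_assoc _ u, hu.star_mul_self, one_mul,
      hv.star_mul_self]
  mul_star_self := by
    rw [Matrix.conjTranspose_mul, mul_assoc, ← mul_assoc v, hv.mul_star_self, one_mul,
      hu.mul_star_self]
  eq_conj := by
    have h1 : (u * v).map star = u.map star * v.map star := by
      ext i j
      simp only [Matrix.map_apply, Matrix.mul_apply, star_sum]
      refine Finset.sum_congr rfl fun k _ => ?_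
      rw [(huv i k k j).eq, star_mul]
    rw [h1, hu.map_star_eq hP, hv.map_star_eq hP]
    have h2 := map_algebraMap_mul_inv hP R
    symm
    calc _ = P.map (algebraMap ℂ R) * P⁻¹.map (algebraMap ℂ R) * u * (P.map (algebraMap ℂ R) *
          P⁻¹.map (algebraMap ℂ R)) * v * (P.map (algebraMap ℂ R) * P⁻¹.map (algebraMap ℂ R)) := by
          simp only [mul_assoc]
      _ = u * v := by simp only [h2, mul_one, one_mul]

/-- In column `j` the positive elements `star (u k j) * u k j` add up to 1, so each of them is at
most 1. This is the bound required by `CStarRelation`. -/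
theorem norm_le_one (h : IsConjUnitary P u) (i j : Fin n) : ‖u i j‖ ≤ 1 := by
  let _ := CStarAlgebra.spectralOrder R
  have _ := CStarAlgebra.spectralOrderedRing R
  have h1 : ∑ k, star (u k j) * u k j = 1 := by
    have h2 := congrFun (congrFun h.star_mul_self j) j
    rwa [Matrix.mul_apply, Matrix.one_apply_eq] at h2
  have h2 : star (u i j) * u i j ≤ 1 := by
    rw [← h1]
    exact Finset.single_le_sum (f := fun k => star (u k j) * u k j)
      (fun k _ => star_mul_self_nonneg _) (Finset.mem_univ i)
  have h3 : ‖star (u i j) * u i j‖ ≤ ‖(1 : R)‖ :=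
    CStarAlgebra.norm_le_norm_of_nonneg_of_le (star_mul_self_nonneg _) h2
  have h4 : ‖(1 : R)‖ ≤ 1 := by
    rcases subsingleton_or_nontrivial R with _ | _
    · rw [Subsingleton.elim (1 : R) 0, norm_zero]
      exact zero_le_one
    · rw [CStarRing.norm_one]
  rw [CStarRing.norm_star_mul_self] at h3
  nlinarith [norm_nonneg (u i j)]

end IsConjUnitary

/-- The relations of the universal C⋆-algebra of a unitary matrix `u` with `u = P ū P⁻¹`. -/
def conjUnitaryRelation (P : Matrix (Fin n) (Fin n) ℂ) :
    CStarRelation (ULift.{u} (Fin n × Fin n)) where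
  Holds _ _ v := IsConjUnitary P (Matrix.of fun i j => v ⟨i, j⟩)
  bound _ := 1
  norm_le _ _ _ hv x := hv.norm_le_one x.down.1 x.down.2

variable (P) in
/-- The canonical matrix over the universal C⋆-algebra of a unitary matrix `u` with
`u = P ū P⁻¹`. -/
def universalMatrix :
    Matrix (Fin n) (Fin n) (UniversalCStarAlgebra (conjUnitaryRelation.{u} P)) :=
  Matrix.of fun i j => UniversalCStarAlgebra.gen _ ⟨i, j⟩

/-- Each relation is an equality of matrices over the free ⋆-algebra after any admissible
evaluation, so the entries of the difference of its two sides vanish by `ofFree_eq_zero`. -/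
theorem isConjUnitary_universalMatrix : IsConjUnitary P (universalMatrix.{u} P) := by
  let M : Matrix (Fin n) (Fin n) (FreeStarAlgebra (conjUnitaryRelation.{u} P)) :=
    Matrix.of fun i j => FreeStarAlgebra.gen _ ⟨i, j⟩
  let φ := UniversalCStarAlgebra.ofFree (conjUnitaryRelation.{u} P)
  have hM : M.map φ = universalMatrix P := rfl
  have key : ∀ Z Z' : Matrix (Fin n) (Fin n) (FreeStarAlgebra (conjUnitaryRelation.{u} P)),
      (∀ (R : Type u) [CStarAlgebra R] (v : ULift.{u} (Fin n × Fin n) → R),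
        (conjUnitaryRelation.{u} P).Holds R v →
        Z.map (FreeStarAlgebra.eval v) = Z'.map (FreeStarAlgebra.eval v)) →
      Z.map φ = Z'.map φ := fun Z Z' h => by
    ext i j
    refine sub_eq_zero.1 ((map_sub φ _ _).symm.trans (UniversalCStarAlgebra.ofFree_eq_zero
      fun R _ v hv => ?_))
    rw [map_sub]
    exact sub_eq_zero.2 (congrFun (congrFun (h R v hv) i) j)
  have hMv : ∀ (R : Type u) [CStarAlgebra R] (v : ULift.{u} (Fin n × Fin n) → R),
      M.map (FreeStarAlgebra.eval v) = Matrix.of fun i j => v ⟨i, j⟩ := fun R _ v => by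
    ext i j
    exact FreeStarAlgebra.eval_gen (r := conjUnitaryRelation.{u} P) v _
  constructor
  · have h1 := key (M.conjTranspose * M) 1 fun R _ v hv => by
      rw [Matrix.map_mul, conjTranspose_map_starHom, hMv, hv.star_mul_self,
        Matrix.map_one _ (map_zero _) (map_one _)]
    rwa [Matrix.map_mul, conjTranspose_map_starHom, hM,
      Matrix.map_one _ (map_zero _) (map_one _)] at h1
  · have h1 := key (M * M.conjTranspose) 1 fun R _ v hv => by
      rw [Matrix.map_mul, conjTranspose_map_starHom, hMv, hv.mul_star_self,
        Matrix.map_one _ (map_zero _) (map_one _)]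
    rwa [Matrix.map_mul, conjTranspose_map_starHom, hM,
      Matrix.map_one _ (map_zero _) (map_one _)] at h1
  · have h1 := key M (P.map (algebraMap ℂ _) * M.map star * P⁻¹.map (algebraMap ℂ _))
      fun R _ v hv => by
        rw [Matrix.map_mul, Matrix.map_mul, map_algebraMap_map, map_algebraMap_map, map_star_map,
          hMv]
        exact hv.eq_conj
    rwa [Matrix.map_mul, Matrix.map_mul, map_algebraMap_map, map_algebraMap_map, map_star_map,
      hM] at h1

theorem range_universalMatrix :
    Set.range (fun p : Fin n × Fin n => universalMatrix.{u} P p.1 p.2) =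
      Set.range (UniversalCStarAlgebra.gen (conjUnitaryRelation.{u} P)) := by
  ext x
  exact ⟨fun ⟨p, hp⟩ => ⟨⟨p⟩, hp⟩, fun ⟨p, hp⟩ => ⟨p.down, hp⟩⟩

theorem topologicalClosure_adjoin_universalMatrix :
    (StarAlgebra.adjoin ℂ (Set.range fun p : Fin n × Fin n =>
      universalMatrix.{u} P p.1 p.2)).topologicalClosure = ⊤ := by
  rw [range_universalMatrix]
  exact UniversalCStarAlgebra.topologicalClosure_adjoin_gen _

theorem exists_hom_universalMatrix {R : Type u} [CStarAlgebra R] {v : Matrix (Fin n) (Fin n) R}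
    (hv : IsConjUnitary P v) :
    ∃ μ : UniversalCStarAlgebra (conjUnitaryRelation.{u} P) →⋆ₐ[ℂ] R,
      (universalMatrix P).map μ = v := by
  have h : (conjUnitaryRelation.{u} P).Holds R fun x => v x.down.1 x.down.2 := hv
  refine ⟨UniversalCStarAlgebra.lift h, ?_⟩
  ext i j
  exact UniversalCStarAlgebra.lift_gen h _

theorem starAlgHom_ext_of_topologicalClosure {A B : Type*} [CStarAlgebra A] [CStarAlgebra B]
    {s : Set A} (hs : (StarAlgebra.adjoin ℂ s).topologicalClosure = ⊤) {φ ψ : A →⋆ₐ[ℂ] B}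
    (h : ∀ x ∈ s, φ x = ψ x) : φ = ψ := by
  have h1 : StarAlgebra.adjoin ℂ s ≤ StarAlgHom.equalizer φ ψ :=
    StarAlgebra.adjoin_le fun x hx => h x hx
  have h2 : IsClosed (StarAlgHom.equalizer φ ψ : Set A) :=
    isClosed_eq (continuous_starAlgHom φ) (continuous_starAlgHom ψ)
  have h3 := StarSubalgebra.topologicalClosure_minimal h1 h2
  rw [hs] at h3
  ext x
  exact h3 (show x ∈ (⊤ : StarSubalgebra ℂ A) from trivial)

theorem starAlgHom_ext_matrix {A B : Type*} [CStarAlgebra A] [CStarAlgebra B]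
    {u : Matrix (Fin n) (Fin n) A} (hu : (StarAlgebra.adjoin ℂ
      (Set.range fun p : Fin n × Fin n => u p.1 p.2)).topologicalClosure = ⊤) {φ ψ : A →⋆ₐ[ℂ] B}
    (h : u.map φ = u.map ψ) : φ = ψ :=
  starAlgHom_ext_of_topologicalClosure hu (by
    rintro _ ⟨p, rfl⟩
    exact congrFun (congrFun h p.1) p.2)

end ConjUnitary

/-! ### The map `α ⊙ id` as a ⋆-morphism. -/

noncomputable section Comul

namespace SpatialTensor

variable {A : Type u} {B : Type v} [CStarAlgebra A] [CStarAlgebra B]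

theorem coe_tmul (a : A) (b : B) :
    ((AlgTensor.tmul a b : AlgTensor A B) : SpatialTensor A B) = tmul a b := rfl

theorem sum_tmul {ι : Type*} (s : Finset ι) (f : ι → A) (b : B) :
    tmul (∑ i ∈ s, f i) b = ∑ i ∈ s, tmul (f i) b := by
  simp only [← inl_mul_inr, map_sum, Finset.sum_mul]

theorem tmul_sum {ι : Type*} (s : Finset ι) (a : A) (f : ι → B) :
    tmul a (∑ i ∈ s, f i) = ∑ i ∈ s, tmul a (f i) := by
  simp only [← inl_mul_inr, map_sum, Finset.mul_sum]

theorem coe_sum {ι : Type*} (s : Finset ι) (f : ι → AlgTensor A B) :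
    ((∑ i ∈ s, f i : AlgTensor A B) : SpatialTensor A B) = ∑ i ∈ s, (f i : SpatialTensor A B) :=
  map_sum (Completion.toCompl (α := AlgTensor A B)) _ _

/-- A subspace whose closure contains all the elementary tensors is dense. -/
theorem dense_of_tmul_mem_closure {D : Submodule ℂ (SpatialTensor A B)}
    (hD : ∀ a b, tmul a b ∈ closure (D : Set (SpatialTensor A B))) :
    Dense (D : Set (SpatialTensor A B)) := by
  have h1 : ∀ z : AlgTensor A B, (z : SpatialTensor A B) ∈ D.topologicalClosure := fun z => by
    induction z using AlgTensor.induction with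
    | h0 => rw [Completion.coe_zero]; exact zero_mem _
    | ht a b => exact hD a b
    | ha z w hz hw => rw [Completion.coe_add]; exact add_mem hz hw
  intro x
  exact closure_minimal (Set.range_subset_iff.2 h1) isClosed_closure (Completion.denseRange_coe x)

variable {Q : Type v} [CStarAlgebra Q]

theorem algTensorId_tmul (α : A →⋆ₐ[ℂ] SpatialTensor A Q) (a : A) (x : Q) :
    algTensorId α (AlgTensor.tmul a x) = map (.id ℂ A) (inl Q Q) (α a) * tmul 1 (tmul 1 x) := rfl

/-- The element `z` occupies the first two legs of `A ⊗ (Q ⊗ Q)` and `x` the third. This commutation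
makes `α ⊙ id` multiplicative. -/
theorem commute_map_inl (z : SpatialTensor A Q) (x : Q) :
    Commute (map (.id ℂ A) (inl Q Q) z) (tmul 1 (tmul 1 x)) := by
  induction z using Completion.induction_on with
  | hp =>
    have h : Continuous fun z : SpatialTensor A Q => map (.id ℂ A) (inl Q Q) z :=
      continuous_starAlgHom _
    exact isClosed_eq (h.mul continuous_const) (continuous_const.mul h)
  | ih z =>
    induction z using AlgTensor.induction with
    | h0 => rw [Completion.coe_zero, map_zero]; exact Commute.zero_left _
    | ha z w hz hw => rw [Completion.coe_add, map_add]; exact hz.add_left hw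
    | ht a y =>
      rw [coe_tmul, map_tmul, inl_apply, Commute, SemiconjBy, tmul_mul_tmul, tmul_mul_tmul,
        tmul_mul_tmul, tmul_mul_tmul]
      simp

/-- The map `α ⊙ id` is multiplicative and compatible with the involutions. -/
def algTensorIdHom (α : A →⋆ₐ[ℂ] SpatialTensor A Q) :
    AlgTensor A Q →⋆ₐ[ℂ] SpatialTensor A (SpatialTensor Q Q) where
  __ := AlgHom.ofLinearMap (algTensorId α)
    (by
      refine (algTensorId_tmul α 1 1).trans ?_
      rw [map_one, map_one, ← one_def, ← one_def, mul_one])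
    (fun s t => by
      induction s using AlgTensor.induction with
      | h0 => simp
      | ha s s' h h' => rw [add_mul, map_add, h, h', map_add, add_mul]
      | ht a x =>
        induction t using AlgTensor.induction with
        | h0 => simp
        | ha s s' h h' => rw [mul_add, map_add, h, h', map_add, mul_add]
        | ht b y =>
          rw [AlgTensor.tmul_mul_tmul, algTensorId_tmul, algTensorId_tmul, algTensorId_tmul,
            map_mul, map_mul, mul_assoc, mul_assoc]
          congr 1
          -- The third-leg factor of the first tensor is moved past `α(b) ⊗ 1`.
          rw [← mul_assoc, ← (commute_map_inl (α b) x).eq, mul_assoc, tmul_mul_tmul, tmul_mul_tmul,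
            one_mul, one_mul])
  map_star' s := by
    change algTensorId α (star s) = star (algTensorId α s)
    induction s using AlgTensor.induction with
    | h0 => simp
    | ha s s' h h' => rw [star_add, map_add, h, h', map_add, star_add]
    | ht a x =>
      rw [AlgTensor.star_tmul, algTensorId_tmul, algTensorId_tmul, star_mul, star_tmul, star_tmul,
        star_one, star_one, ← map_star, ← map_star, (commute_map_inl _ _).eq]

theorem algTensorIdHom_apply (α : A →⋆ₐ[ℂ] SpatialTensor A Q) (z : AlgTensor A Q) :
    algTensorIdHom α z = algTensorId α z := rfl

end SpatialTensor

end Comul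

/-! ### Woronowicz structures from a generating matrix, and existence of the free orthogonal quantum
group. -/

noncomputable section Generated

variable {n : ℕ} {P : Matrix (Fin n) (Fin n) ℂ} {Q : Type u} [CStarAlgebra Q]
  {u : Matrix (Fin n) (Fin n) Q}

theorem mem_of_topologicalClosure_eq_top {s : StarSubalgebra ℂ Q}
    (hs : s.topologicalClosure = ⊤) {C : Set Q} (hC : IsClosed C) (hsC : ∀ a ∈ s, a ∈ C) (a : Q) :
    a ∈ C := by
  have h : a ∈ s.topologicalClosure := by rw [hs]; trivial
  exact closure_minimal hsC hC h

open SpatialTensor in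
-- On the ⋆-algebra generated by the entries, `Δ` takes values in `Q ⊙ Q`, where `Δ ⊙ id` is a
-- ⋆-morphism; on `u i j` both sides are `∑ u i k ⊗ u k l ⊗ u l j`. The rest follows by density,
-- since membership in the closure of a graph is a closed condition.
theorem comul_coassoc_of_matrix (hgen : (StarAlgebra.adjoin ℂ
      (Set.range fun p : Fin n × Fin n => u p.1 p.2)).topologicalClosure = ⊤)
    {Δ : Q →⋆ₐ[ℂ] SpatialTensor Q Q} (hΔ : ∀ i j, Δ (u i j) = ∑ k, tmul (u i k) (u k j)) (a : Q) :
    ExtendsTo (algTensorId Δ) (Δ a) (map (.id ℂ Q) Δ (Δ a)) := by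
  -- Asking only for some preimage `t` of `Δ a` avoids the injectivity of `Q ⊙ Q → Q ⊗ Q`: preimages
  -- can be added, multiplied and starred.
  have h1 : ∀ a ∈ StarAlgebra.adjoin ℂ (Set.range fun p : Fin n × Fin n => u p.1 p.2),
      ∃ t : AlgTensor Q Q, (t : SpatialTensor Q Q) = Δ a ∧
        algTensorIdHom Δ t = map (.id ℂ Q) Δ (Δ a) := by
    intro a ha
    induction ha using StarAlgebra.adjoin_induction with
    | mem x hx =>
      obtain ⟨⟨i, j⟩, rfl⟩ := hx
      refine ⟨∑ k, AlgTensor.tmul (u i k) (u k j), ?_, ?_⟩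
      · rw [hΔ, coe_sum]
        rfl
      · rw [map_sum, hΔ, map_sum]
        simp only [algTensorIdHom_apply, algTensorId_tmul, map_tmul, hΔ, map_sum, tmul_sum,
          Finset.sum_mul, inl_apply, tmul_mul_tmul, mul_one, one_mul, StarAlgHom.coe_id, id_eq]
        exact Finset.sum_comm
    | algebraMap c =>
      refine ⟨algebraMap ℂ _ c, ?_, ?_⟩
      · rw [AlgHomClass.commutes, Algebra.algebraMap_eq_smul_one, Algebra.algebraMap_eq_smul_one,
          Completion.coe_smul, Completion.coe_one]
      · simp only [AlgHomClass.commutes]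
    | add x y _ _ hx hy =>
      obtain ⟨s, hs, hs'⟩ := hx
      obtain ⟨t, ht, ht'⟩ := hy
      refine ⟨s + t, ?_, ?_⟩
      · rw [Completion.coe_add, hs, ht, map_add]
      · rw [map_add, map_add, map_add, hs', ht']
    | mul x y _ _ hx hy =>
      obtain ⟨s, hs, hs'⟩ := hx
      obtain ⟨t, ht, ht'⟩ := hy
      refine ⟨s * t, ?_, ?_⟩
      · rw [Completion.coe_mul, hs, ht, map_mul]
      · rw [map_mul, map_mul, map_mul, hs', ht']
    | star x _ hx =>
      obtain ⟨s, hs, hs'⟩ := hx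
      refine ⟨star s, ?_, ?_⟩
      · rw [coe_star, hs, map_star]
      · rw [map_star, map_star, map_star, hs']
  have h2 : IsClosed {a : Q | ExtendsTo (algTensorId Δ) (Δ a) (map (.id ℂ Q) Δ (Δ a))} :=
    isClosed_closure.preimage ((continuous_starAlgHom Δ).prodMk
      ((continuous_starAlgHom (map (.id ℂ Q) Δ)).comp (continuous_starAlgHom Δ)))
  refine mem_of_topologicalClosure_eq_top hgen h2 (fun b hb => ?_) a
  obtain ⟨t, ht, ht'⟩ := h1 b hb
  have h3 := extendsTo_coe (algTensorId Δ) t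
  rw [← algTensorIdHom_apply, ht', ht] at h3
  exact h3

/-- If `Q` is generated by a matrix whose entries `a` and their adjoints satisfy
`f a ∈ span {Δ(Q) g(Q)}`, then `f(Q) g(Q)` is contained in the closure of this span. -/
theorem mul_mem_closure_span {S : Type v} [CStarAlgebra S] {f g Δ : Q →⋆ₐ[ℂ] S}
    (hfg : ∀ a b, Commute (f a) (g b)) {s : Set Q}
    (hs : (StarAlgebra.adjoin ℂ s).topologicalClosure = ⊤)
    (hfs : ∀ a ∈ s, f a ∈ Submodule.span ℂ {z | ∃ a b : Q, z = Δ a * g b} ∧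
      f (star a) ∈ Submodule.span ℂ {z | ∃ a b : Q, z = Δ a * g b}) (a b : Q) :
    f a * g b ∈ closure (Submodule.span ℂ {z | ∃ a b : Q, z = Δ a * g b} : Set S) := by
  set D := Submodule.span ℂ {z | ∃ a b : Q, z = Δ a * g b} with hD
  have hmem : ∀ a b, Δ a * g b ∈ D := fun a b => Submodule.subset_span ⟨a, b, rfl⟩
  have hr : ∀ z ∈ D, ∀ b, z * g b ∈ D := fun z hz b => by
    induction hz using Submodule.span_induction with
    | mem z hz =>
      obtain ⟨x, y, rfl⟩ := hz
      rw [mul_assoc, ← map_mul]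
      exact hmem _ _
    | zero => rw [zero_mul]; exact zero_mem _
    | add z w _ _ hz hw => rw [add_mul]; exact add_mem hz hw
    | smul c z _ hz => rw [smul_mul_assoc]; exact D.smul_mem c hz
  have hl : ∀ z ∈ D, ∀ a, Δ a * z ∈ D := fun z hz a => by
    induction hz using Submodule.span_induction with
    | mem z hz =>
      obtain ⟨x, y, rfl⟩ := hz
      rw [← mul_assoc, ← map_mul]
      exact hmem _ _
    | zero => rw [mul_zero]; exact zero_mem _
    | add z w _ _ hz hw => rw [mul_add]; exact add_mem hz hw
    | smul c z _ hz => rw [mul_smul_comm]; exact D.smul_mem c hz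
  -- As `f b` commutes with `g y`, `Δ x * g y * f b = Δ x * f b * g y`, and `D` is stable under
  -- `Δ(Q)` on the left and `g(Q)` on the right. So the elements `b` with `f b ∈ D` are closed under
  -- products.
  have hm : ∀ z ∈ D, ∀ b, f b ∈ D → z * f b ∈ D := fun z hz b hb => by
    induction hz using Submodule.span_induction with
    | mem z hz =>
      obtain ⟨x, y, rfl⟩ := hz
      rw [mul_assoc, ← (hfg b y).eq, ← mul_assoc]
      exact hr _ (hl _ hb x) y
    | zero => rw [zero_mul]; exact zero_mem _
    | add z w _ _ hz hw => rw [add_mul]; exact add_mem hz hw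
    | smul c z _ hz => rw [smul_mul_assoc]; exact D.smul_mem c hz
  have h1 : ∀ a ∈ StarAlgebra.adjoin ℂ s, f a ∈ D := fun a ha => by
    -- `D` is not visibly stable under the involution, so induction runs over the plain algebra
    -- generated by `s` and its adjoints; this is why `hfs` also speaks of `star a`.
    rw [← StarSubalgebra.mem_toSubalgebra, StarAlgebra.adjoin_toSubalgebra] at ha
    induction ha using Algebra.adjoin_induction with
    | mem x hx =>
      rcases hx with hx | hx
      · exact (hfs x hx).1
      · simpa using (hfs _ hx).2
    | algebraMap c =>
      rw [AlgHomClass.commutes, Algebra.algebraMap_eq_smul_one]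
      have h2 := hmem 1 1
      rw [map_one, map_one, mul_one] at h2
      exact D.smul_mem c h2
    | add x y _ _ hx hy => rw [map_add]; exact add_mem hx hy
    | mul x y _ _ hx hy => rw [map_mul]; exact hm _ hx _ hy
  have h2 : IsClosed {a : Q | f a * g b ∈ closure (D : Set S)} :=
    isClosed_closure.preimage ((continuous_starAlgHom f).mul continuous_const)
  exact mem_of_topologicalClosure_eq_top hs h2
    (fun x hx => subset_closure (hr _ (h1 x hx) b)) a

/-- A right inverse `N` of `M` solves `Δ(M) = f(M) g(M)` for `f(M) = Δ(M) g(N)`, whose entries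
visibly lie in the span. -/
theorem map_entry_mem_span {S : Type v} [CStarAlgebra S] {f g Δ : Q →⋆ₐ[ℂ] S}
    {M N : Matrix (Fin n) (Fin n) Q} (hM : M.map Δ = M.map f * M.map g) (hMN : M * N = 1)
    (i j : Fin n) : f (M i j) ∈ Submodule.span ℂ {z | ∃ a b : Q, z = Δ a * g b} := by
  have h : M.map f = M.map Δ * N.map g := by
    rw [hM, mul_assoc, ← Matrix.map_mul, hMN, Matrix.map_one _ (map_zero g) (map_one g), mul_one]
  have h1 := congrFun (congrFun h i) j
  rw [Matrix.map_apply, Matrix.mul_apply] at h1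
  rw [h1]
  exact Submodule.sum_mem _ fun k _ => Submodule.subset_span ⟨_, _, rfl⟩

open SpatialTensor in
/-- The structure of a Woronowicz C⋆-algebra on a C⋆-algebra that is generated by the entries of a
unitary matrix `u` with `u = P ū P⁻¹`. -/
@[reducible]
def WoronowiczAlgebra.ofMatrix (hP : IsUnit P.det) (hu : IsConjUnitary P u)
    (hgen : (StarAlgebra.adjoin ℂ
      (Set.range fun p : Fin n × Fin n => u p.1 p.2)).topologicalClosure = ⊤)
    (Δ : Q →⋆ₐ[ℂ] SpatialTensor Q Q) (hΔ : ∀ i j, Δ (u i j) = ∑ k, tmul (u i k) (u k j)) :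
    WoronowiczAlgebra Q where
  comul := Δ
  coassoc := comul_coassoc_of_matrix hgen hΔ
  dense_left := by
    refine dense_of_tmul_mem_closure fun a b => ?_
    rw [← inr_mul_inl]
    -- With the second leg in front, the summation index of `Δ(u i j) = ∑ k, (1 ⊗ u k j) (u i k ⊗
    -- 1)` forms a matrix product only for the transposed matrices `uᵀ` and `u⋆`.
    refine mul_mem_closure_span (f := inr Q Q) (g := inl Q Q)
      (fun a b => (commute_inl_inr b a).symm) hgen ?_ b a
    rintro _ ⟨⟨i, j⟩, rfl⟩
    obtain ⟨w, hw, hw'⟩ := hu.exists_inv_map_star hP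
    constructor
    -- `uᵀ` is the adjoint of `ū`, so the adjoint of a left inverse of `ū` is a right inverse of
    -- `uᵀ`.
    · refine map_entry_mem_span (M := u.transpose) (N := w.conjTranspose) (i := j) (j := i) ?_ ?_
      · ext i j
        simp only [Matrix.map_apply, Matrix.transpose_apply, Matrix.mul_apply, hΔ, inr_mul_inl]
      · rw [← Matrix.conjTranspose_one, ← hw', Matrix.conjTranspose_mul]
        congr 1
        ext i j
        simp
    · refine map_entry_mem_span (M := u.conjTranspose) (N := u) (i := j) (j := i) ?_
        hu.star_mul_self
      ext i j
      rw [Matrix.map_apply, Matrix.conjTranspose_apply, map_star, hΔ]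
      simp only [Matrix.map_apply, Matrix.conjTranspose_apply, Matrix.mul_apply, inr_mul_inl,
        star_sum, star_tmul]
  dense_right := by
    refine dense_of_tmul_mem_closure fun a b => ?_
    rw [← inl_mul_inr]
    refine mul_mem_closure_span (f := inl Q Q) (g := inr Q Q) commute_inl_inr hgen ?_ a b
    rintro _ ⟨⟨i, j⟩, rfl⟩
    obtain ⟨w, hw, hw'⟩ := hu.exists_inv_map_star hP
    constructor
    · refine map_entry_mem_span (M := u) (N := u.conjTranspose) (i := i) (j := j) ?_
        hu.mul_star_self
      ext i j
      simp only [Matrix.map_apply, Matrix.mul_apply, hΔ, inl_mul_inr]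
    -- Adjoints of the entries require `ū` to be invertible, which unitarity of `u` alone does not
    -- give; here `u = P ū P⁻¹` is used.
    · refine map_entry_mem_span (M := u.map star) (N := w) (i := i) (j := j) ?_ hw
      ext i j
      rw [Matrix.map_apply, Matrix.map_apply, map_star, hΔ]
      simp only [Matrix.map_apply, Matrix.mul_apply, inl_mul_inr, star_sum, star_tmul]

open SpatialTensor in
theorem map_inl_mul_map_inr (v : Matrix (Fin n) (Fin n) Q) (i j : Fin n) :
    (v.map (inl Q Q) * v.map (inr Q Q)) i j = ∑ k, tmul (v i k) (v k j) := by
  simp only [Matrix.mul_apply, Matrix.map_apply, inl_mul_inr]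

/-- Both composites send `u i j` to `∑ k, μ (u i k) ⊗ μ (u k j)`, and the entries generate.
Compatibility with the comultiplications is thus automatic. -/
theorem isWoronowiczHom_of_matrix {R : Type u} [CStarAlgebra R] [WoronowiczAlgebra Q]
    [WoronowiczAlgebra R] (hgen : (StarAlgebra.adjoin ℂ
      (Set.range fun p : Fin n × Fin n => u p.1 p.2)).topologicalClosure = ⊤)
    (hu : IsOrthogonalMatrix P u) {μ : Q →⋆ₐ[ℂ] R} (hv : IsOrthogonalMatrix P (u.map μ)) :
    IsWoronowiczHom μ := by
  have h : (SpatialTensor.map μ μ).comp WoronowiczAlgebra.comul = WoronowiczAlgebra.comul.comp μ :=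
    starAlgHom_ext_matrix hgen (by
      ext i j
      have h1 := hv.multiplicative i j
      simp only [Matrix.map_apply] at h1
      rw [Matrix.map_apply, Matrix.map_apply, StarAlgHom.comp_apply, StarAlgHom.comp_apply,
        hu.multiplicative, h1, map_sum]
      simp only [SpatialTensor.map_tmul])
  exact fun a => DFunLike.congr_fun h a

theorem exists_isFreeOrthogonal (hP : IsUnit P.det) :
    ∃ (Q : Type u) (_ : CStarAlgebra Q) (_ : WoronowiczAlgebra Q)
      (u : Matrix (Fin n) (Fin n) Q), IsFreeOrthogonal P Q u := by
  have hu := isConjUnitary_universalMatrix.{u} (P := P)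
  have hgen := topologicalClosure_adjoin_universalMatrix.{u} (P := P)
  -- The comultiplication is the morphism classified by the product of `u ⊗ 1` and `1 ⊗ u`;
  -- multiplicativity of `u` then holds by construction.
  obtain ⟨Δ, hΔ⟩ := exists_hom_universalMatrix
    (((hu.map (SpatialTensor.inl _ _)).mul (hu.map (SpatialTensor.inr _ _)) hP
      fun i k l j => SpatialTensor.commute_inl_inr _ _))
  have hΔ' : ∀ i j, Δ (universalMatrix P i j) =
      ∑ k, SpatialTensor.tmul (universalMatrix P i k) (universalMatrix P k j) := fun i j => by
    rw [← map_inl_mul_map_inr, ← hΔ]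
    rfl
  let _ : WoronowiczAlgebra (UniversalCStarAlgebra (conjUnitaryRelation.{u} P)) :=
    .ofMatrix hP hu hgen Δ hΔ'
  have hu' : IsOrthogonalMatrix P (universalMatrix.{u} P) :=
    isOrthogonalMatrix_iff.2 ⟨hu, hΔ'⟩
  refine ⟨_, inferInstance, inferInstance, universalMatrix P, hu', hgen, ?_⟩
  intro R _ _ v hv
  obtain ⟨μ, hμ⟩ := exists_hom_universalMatrix (isOrthogonalMatrix_iff.1 hv).1
  refine ⟨μ, ⟨isWoronowiczHom_of_matrix hgen hu' (by rwa [hμ]), fun i j => by rw [← hμ]; rfl⟩, ?_⟩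
  rintro ν ⟨_, hν⟩
  refine starAlgHom_ext_matrix hgen ?_
  rw [hμ]
  ext i j
  exact hν i j

end Generated

/-! ### Elementary tensors in `E ⊗ Q`. -/

noncomputable section ModTensorLemmas

namespace ModTensor

variable {A : Type u} {E : Type w} {Q : Type v} [CStarAlgebra A] [NormedAddCommGroup E]
  [NormedSpace ℂ E] [Module Aᵐᵒᵖ E] [HilbertModule A E] [CStarAlgebra Q]

variable (A E Q) in
/-- The canonical map from `E ⊙ Q` to `E ⊗ Q`. -/
def ofAlg : AlgModTensor A E Q →L[ℂ] ModTensor A E Q := Completion.toComplL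

theorem ofAlg_apply (z : AlgModTensor A E Q) : ofAlg A E Q z = (z : ModTensor A E Q) := rfl

theorem ofAlg_tmul (ξ : E) (x : Q) : ofAlg A E Q (AlgModTensor.tmul ξ x) = tmul ξ x := rfl

theorem tmul_sum {ι : Type*} (s : Finset ι) (ξ : E) (f : ι → Q) :
    (tmul ξ (∑ i ∈ s, f i) : ModTensor A E Q) = ∑ i ∈ s, tmul ξ (f i) := by
  simp only [← ofAlg_tmul, ← map_sum]
  exact congrArg _ (TensorProduct.tmul_sum _ _ _)

theorem smul_tmul (c : ℂ) (ξ : E) (x : Q) :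
    (tmul (c • ξ) x : ModTensor A E Q) = c • tmul ξ x := by
  rw [← ofAlg_tmul, ← ofAlg_tmul, ← map_smul]
  rfl

theorem sum_tmul {ι : Type*} (s : Finset ι) (f : ι → E) (x : Q) :
    (tmul (∑ i ∈ s, f i) x : ModTensor A E Q) = ∑ i ∈ s, tmul (f i) x := by
  simp only [← ofAlg_tmul, ← map_sum]
  exact congrArg _ (TensorProduct.sum_tmul _ _ _)

theorem map_tmul {Q' : Type v} [CStarAlgebra Q'] (μ : Q →⋆ₐ[ℂ] Q') (ξ : E) (x : Q) :
    map A E μ (tmul ξ x) = tmul ξ (μ x) :=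
  map_coe μ _

theorem act_tmul (ξ : E) (x : Q) (a : A) (y : Q) :
    MulOpposite.op (SpatialTensor.tmul a y) • (tmul ξ x : ModTensor A E Q) =
      tmul (MulOpposite.op a • ξ) (x * y) :=
  act_coe _ _

theorem ip_tmul (ξ η : E) (x y : Q) : ip (tmul ξ x) (tmul η y) =
    SpatialTensor.tmul (HilbertModule.ip ξ η : A) (star x * y) :=
  ip_coe _ _

variable (A E Q) in
/-- The inner product as a linear map in its second variable. -/
def ipₗ (z : ModTensor A E Q) : ModTensor A E Q →ₗ[ℂ] SpatialTensor A Q where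
  toFun := ip z
  map_add' := ip_add z
  map_smul' c := ip_smul c z

theorem ipₗ_apply (z w : ModTensor A E Q) : ipₗ A E Q z w = ip z w := rfl

theorem dense_of_tmul_mem {D : Submodule ℂ (ModTensor A E Q)} (hD : ∀ ξ x, tmul ξ x ∈ D) :
    Dense (D : Set (ModTensor A E Q)) := by
  have h1 : ∀ z : AlgModTensor A E Q, (z : ModTensor A E Q) ∈ D := fun z => by
    induction z using AlgModTensor.induction with
    | h0 => rw [Completion.coe_zero]; exact zero_mem _
    | ht a b => exact hD a b
    | ha z w hz hw => rw [Completion.coe_add]; exact add_mem hz hw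
  exact Completion.denseRange_coe.mono (Set.range_subset_iff.2 h1)

end ModTensor

end ModTensorLemmas

/-! ### Coordinates on `ℂⁿ ⊗ R`. -/

noncomputable section Euclidean

variable {n : ℕ} {R : Type u} [CStarAlgebra R]

theorem euclidean_ext {M : Type*} [AddCommMonoid M] [Module ℂ M] {σ : ℂ →+* ℂ}
    {f g : EuclideanSpace ℂ (Fin n) →ₛₗ[σ] M}
    (h : ∀ i, f (EuclideanSpace.single i 1) = g (EuclideanSpace.single i 1)) : f = g :=
  (EuclideanSpace.basisFun (Fin n) ℂ).toBasis.ext fun i => by simpa using h i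

theorem euclidean_eq_sum (ξ : EuclideanSpace ℂ (Fin n)) :
    ξ = ∑ i, ξ i • EuclideanSpace.single i (1 : ℂ) := by
  conv_lhs => rw [← (EuclideanSpace.basisFun (Fin n) ℂ).sum_repr ξ]
  simp

theorem ip_single (i j : Fin n) : (HilbertModule.ip (EuclideanSpace.single i (1 : ℂ))
    (EuclideanSpace.single j (1 : ℂ)) : ℂ) = if i = j then 1 else 0 := by
  change inner ℂ (EuclideanSpace.single i (1 : ℂ)) (EuclideanSpace.single j (1 : ℂ)) = _
  rw [EuclideanSpace.inner_single_left, map_one, one_mul]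
  simp

theorem op_smul_euclidean (a : ℂ) (ξ : EuclideanSpace ℂ (Fin n)) :
    MulOpposite.op a • ξ = a • ξ := by
  ext i
  simp [mul_comm]

theorem isUnit_det_antilinearMatrix
    (J : EuclideanSpace ℂ (Fin n) ≃ₛₗ[starRingEnd ℂ] EuclideanSpace ℂ (Fin n)) :
    IsUnit (antilinearMatrix J).det := by
  -- The inverse of `P` is the entrywise conjugate of the matrix of `J⁻¹`, because `J` conjugates
  -- the coefficients of `J⁻¹(e j)`.
  refine Matrix.isUnit_det_of_right_inverse
    (B := Matrix.of fun i j => star (J.symm (EuclideanSpace.single j 1) i)) ?_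
  ext i j
  have h1 : J (∑ k, J.symm (EuclideanSpace.single j 1) k • EuclideanSpace.single k (1 : ℂ)) =
      EuclideanSpace.single j 1 := by
    rw [← euclidean_eq_sum, LinearEquiv.apply_symm_apply]
  rw [map_sum] at h1
  have h2 := congrArg (fun ξ : EuclideanSpace ℂ (Fin n) => ξ i) h1
  simp only [LinearEquiv.map_smulₛₗ] at h2
  simpa [Matrix.mul_apply, antilinearMatrix, Matrix.one_apply, mul_comm, Pi.single_apply] using h2

variable (R) in
/-- The `k`-th coordinate map `ℂⁿ ⊙ R → R`. -/
def coord (k : Fin n) : AlgModTensor ℂ (EuclideanSpace ℂ (Fin n)) R →ₗ[ℂ] R :=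
  TensorProduct.lift (LinearMap.mk₂ ℂ (fun (ξ : EuclideanSpace ℂ (Fin n)) (x : R) => ξ k • x)
    (fun ξ η x => by simp [add_smul]) (fun c ξ x => by simp [mul_smul])
    (fun ξ x y => smul_add _ _ _) (fun c ξ x => smul_comm _ _ _))

theorem coord_tmul (k : Fin n) (ξ : EuclideanSpace ℂ (Fin n)) (x : R) :
    coord R k (AlgModTensor.tmul ξ x) = ξ k • x := rfl

theorem coord_sum (k : Fin n) (x : Fin n → R) :
    coord R k (∑ l, AlgModTensor.tmul (EuclideanSpace.single l (1 : ℂ)) (x l)) = x k := by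
  simp [coord_tmul, map_sum, ite_smul]

theorem sum_coord (z : AlgModTensor ℂ (EuclideanSpace ℂ (Fin n)) R) :
    ∑ k, AlgModTensor.tmul (EuclideanSpace.single k (1 : ℂ)) (coord R k z) = z := by
  induction z using AlgModTensor.induction with
  | h0 =>
    refine Finset.sum_eq_zero fun k _ => ?_
    rw [map_zero]
    exact TensorProduct.tmul_zero _ _
  | ha z w hz hw =>
    conv_rhs => rw [← hz, ← hw]
    rw [← Finset.sum_add_distrib]
    refine Finset.sum_congr rfl fun k _ => ?_
    rw [map_add]
    exact TensorProduct.tmul_add _ _ _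
  | ht ξ x =>
    simp only [coord_tmul]
    conv_rhs => rw [euclidean_eq_sum ξ]
    refine Eq.trans ?_ (TensorProduct.sum_tmul _ _ _).symm
    exact Finset.sum_congr rfl fun k _ => (TensorProduct.smul_tmul _ _ _).symm

/-- Expresses a coordinate through the inner product with `e l ⊗ 1`, which is defined and continuous
on the completion. Injectivity and continuity of the coordinates both come from here. -/
theorem ip_single_coe (l : Fin n) (z : AlgModTensor ℂ (EuclideanSpace ℂ (Fin n)) R) :
    ModTensor.ip (ModTensor.tmul (EuclideanSpace.single l (1 : ℂ)) 1)
      (z : ModTensor ℂ (EuclideanSpace ℂ (Fin n)) R) = SpatialTensor.inr ℂ R (coord R l z) := by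
  conv_lhs => rw [← sum_coord z]
  rw [← ModTensor.ofAlg_apply, map_sum, ← ModTensor.ipₗ_apply, map_sum]
  simp only [ModTensor.ofAlg_tmul, ModTensor.ipₗ_apply, ModTensor.ip_tmul, ip_single, star_one,
    one_mul, SpatialTensor.tmul_complex, ite_smul, one_smul, zero_smul,
    apply_ite (SpatialTensor.inr ℂ R), map_zero]
  simp

/-- The map to a completion only separates points at positive distance; here the coordinates can be
read off in `ℂⁿ ⊗ R` because `inr` is injective on `R`. -/
theorem coe_modTensor_injective {z w : AlgModTensor ℂ (EuclideanSpace ℂ (Fin n)) R}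
    (h : (z : ModTensor ℂ (EuclideanSpace ℂ (Fin n)) R) = w) : z = w := by
  rw [← sum_coord z, ← sum_coord w]
  refine Finset.sum_congr rfl fun k _ => ?_
  rw [SpatialTensor.inr_complex_injective R
    ((ip_single_coe k z).symm.trans ((congrArg _ h).trans (ip_single_coe k w)))]

theorem eq_of_sum_tmul_eq {x y : Fin n → R}
    (h : (∑ k, ModTensor.tmul (EuclideanSpace.single k (1 : ℂ)) (x k) :
      ModTensor ℂ (EuclideanSpace ℂ (Fin n)) R) =
      ∑ k, ModTensor.tmul (EuclideanSpace.single k (1 : ℂ)) (y k)) (k : Fin n) : x k = y k := by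
  simp only [← ModTensor.ofAlg_tmul, ← map_sum] at h
  rw [← coord_sum k x, ← coord_sum k y, coe_modTensor_injective h]

/-- `inr` is isometric, so continuity can be tested after composing with it, where the coordinate is
an inner product. -/
theorem continuous_coord (k : Fin n) : Continuous (coord (n := n) R k) := by
  rw [(SpatialTensor.isometry_inr_complex R).isEmbedding.isInducing.continuous_iff]
  have h : (SpatialTensor.inr ℂ R ∘ coord (n := n) R k) = fun z :
      AlgModTensor ℂ (EuclideanSpace ℂ (Fin n)) R =>
      ModTensor.ip (ModTensor.tmul (EuclideanSpace.single k (1 : ℂ)) 1)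
        (z : ModTensor ℂ (EuclideanSpace ℂ (Fin n)) R) :=
    funext fun z => (ip_single_coe k z).symm
  rw [h]
  exact continuous_const.modTensor_ip (Completion.continuous_coe _)

/-- In coordinates `β ⊙ id` is a finite sum of continuous maps, for any `β`. With
`ExtendsTo.eq_of_continuous`, this gives a literal form to the coassociativity of an arbitrary
coaction on `ℂⁿ`. -/
theorem continuous_modTensor_algTensorId
    (β : EuclideanSpace ℂ (Fin n) →ₗ[ℂ] ModTensor ℂ (EuclideanSpace ℂ (Fin n)) R) :
    Continuous (ModTensor.algTensorId β) := by
  have h : ⇑(ModTensor.algTensorId β) = fun z => ∑ k, ModTensor.act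
      (ModTensor.map ℂ _ (SpatialTensor.inl R R) (β (EuclideanSpace.single k (1 : ℂ))))
      (SpatialTensor.inr ℂ (SpatialTensor R R) (SpatialTensor.inr R R (coord R k z))) := by
    funext z
    conv_lhs => rw [← sum_coord z]
    rw [map_sum]
    rfl
  rw [h]
  refine continuous_finsetSum _ fun k _ => continuous_const.modTensor_act ?_
  exact (continuous_starAlgHom _).comp ((continuous_starAlgHom _).comp (continuous_coord k))

/-! ### The linear map `ℂⁿ → ℂⁿ ⊗ R` of a matrix over `R` -/

/-- The linear map `ℂⁿ → ℂⁿ ⊙ R` with `e i ↦ ∑ k, e k ⊗ v k i`. -/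
def algMatrixMap (v : Matrix (Fin n) (Fin n) R) :
    EuclideanSpace ℂ (Fin n) →ₗ[ℂ] AlgModTensor ℂ (EuclideanSpace ℂ (Fin n)) R :=
  (EuclideanSpace.basisFun (Fin n) ℂ).toBasis.constr ℂ fun i =>
    ∑ k, AlgModTensor.tmul (EuclideanSpace.single k (1 : ℂ)) (v k i)

theorem algMatrixMap_single (v : Matrix (Fin n) (Fin n) R) (i : Fin n) :
    algMatrixMap v (EuclideanSpace.single i 1) =
      ∑ k, AlgModTensor.tmul (EuclideanSpace.single k (1 : ℂ)) (v k i) := by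
  have h : EuclideanSpace.single i (1 : ℂ) = (EuclideanSpace.basisFun (Fin n) ℂ).toBasis i := by
    simp
  rw [h]
  exact Module.Basis.constr_basis _ _ _ _

/-- The linear map `ℂⁿ → ℂⁿ ⊗ R` with `e i ↦ ∑ k, e k ⊗ v k i`. -/
def matrixMap (v : Matrix (Fin n) (Fin n) R) :
    EuclideanSpace ℂ (Fin n) →ₗ[ℂ] ModTensor ℂ (EuclideanSpace ℂ (Fin n)) R :=
  (ModTensor.ofAlg _ _ _).toLinearMap.comp (algMatrixMap v)

theorem matrixMap_apply (v : Matrix (Fin n) (Fin n) R) (ξ : EuclideanSpace ℂ (Fin n)) :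
    matrixMap v ξ = (algMatrixMap v ξ : ModTensor ℂ (EuclideanSpace ℂ (Fin n)) R) := rfl

theorem matrixMap_single (v : Matrix (Fin n) (Fin n) R) (i : Fin n) :
    matrixMap v (EuclideanSpace.single i 1) =
      ∑ k, ModTensor.tmul (EuclideanSpace.single k (1 : ℂ)) (v k i) := by
  rw [matrixMap_apply, algMatrixMap_single, ← ModTensor.ofAlg_apply, map_sum]
  rfl

theorem matrixMap_injective {v w : Matrix (Fin n) (Fin n) R} (h : matrixMap v = matrixMap w) :
    v = w := by
  ext k i
  refine eq_of_sum_tmul_eq (x := fun k => v k i) (y := fun k => w k i) ?_ k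
  rw [← matrixMap_single, ← matrixMap_single, h]

theorem map_matrixMap {R' : Type u} [CStarAlgebra R'] (μ : R →⋆ₐ[ℂ] R')
    (v : Matrix (Fin n) (Fin n) R) :
    (ModTensor.map ℂ _ μ).toLinearMap.comp (matrixMap v) = matrixMap (v.map μ) :=
  euclidean_ext fun i => by
    rw [LinearMap.comp_apply, matrixMap_single, matrixMap_single, map_sum]
    exact Finset.sum_congr rfl fun k _ => ModTensor.map_tmul _ _ _

theorem act_matrixMap_single (v : Matrix (Fin n) (Fin n) R) (i : Fin n) (x : R) :
    MulOpposite.op (SpatialTensor.tmul (1 : ℂ) x) • matrixMap v (EuclideanSpace.single i 1) =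
      ∑ k, ModTensor.tmul (EuclideanSpace.single k (1 : ℂ)) (v k i * x) := by
  rw [matrixMap_single, Finset.smul_sum]
  simp only [ModTensor.act_tmul, MulOpposite.op_one, one_smul]

theorem ip_matrixMap_single (v : Matrix (Fin n) (Fin n) R) (i j : Fin n) :
    ModTensor.ip (matrixMap v (EuclideanSpace.single i 1))
      (matrixMap v (EuclideanSpace.single j 1)) =
      SpatialTensor.inr ℂ R ((v.conjTranspose * v) i j) := by
  rw [matrixMap_single, matrixMap_single, ← ModTensor.ip_def, ← HilbertModule.ipₛₗ_apply, map_sum,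
    map_sum, Matrix.mul_apply, map_sum]
  refine Finset.sum_congr rfl fun k _ => ?_
  rw [LinearMap.sum_apply]
  simp only [HilbertModule.ipₛₗ_apply, ModTensor.ip_def, ModTensor.ip_tmul, ip_single,
    SpatialTensor.tmul_complex, ite_smul, one_smul, zero_smul, apply_ite (SpatialTensor.inr ℂ R),
    map_zero]
  simp

theorem algTensorId_matrixMap_single (v : Matrix (Fin n) (Fin n) R) (i : Fin n) :
    ModTensor.algTensorId (matrixMap v) (algMatrixMap v (EuclideanSpace.single i 1)) =
      ∑ k, ModTensor.tmul (EuclideanSpace.single k (1 : ℂ))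
        (∑ l, SpatialTensor.tmul (v k l) (v l i)) := by
  have h : ∀ (ξ : EuclideanSpace ℂ (Fin n)) (x : R),
      ModTensor.algTensorId (matrixMap v) (AlgModTensor.tmul ξ x) =
        MulOpposite.op (SpatialTensor.tmul (1 : ℂ) (SpatialTensor.tmul (1 : R) x)) •
          ModTensor.map ℂ _ (SpatialTensor.inl R R) (matrixMap v ξ) := fun _ _ => rfl
  rw [algMatrixMap_single, map_sum]
  simp only [h, matrixMap_single, map_sum, ModTensor.map_tmul, Finset.smul_sum, ModTensor.act_tmul,
    MulOpposite.op_one, one_smul, SpatialTensor.inl_apply, SpatialTensor.tmul_mul_tmul, one_mul,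
    mul_one, ModTensor.tmul_sum]
  exact Finset.sum_comm

end Euclidean

/-! ### The correspondence between matrices and coactions on `ℂⁿ`. -/

noncomputable section Coact

/-- The trivial coaction `a ↦ a ⊗ 1`. -/
def Coaction.trivial (A : Type u) (Q : Type v) [CStarAlgebra A] [CStarAlgebra Q]
    [WoronowiczAlgebra Q] : Coaction A Q where
  toHom := SpatialTensor.inl A Q
  coassoc a := by
    have h := extendsTo_coe (SpatialTensor.algTensorId (SpatialTensor.inl A Q))
      (AlgTensor.tmul a 1)
    rw [SpatialTensor.algTensorId_tmul, SpatialTensor.inl_apply, SpatialTensor.map_tmul, map_one,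
      ← SpatialTensor.one_def, ← SpatialTensor.one_def, mul_one] at h
    rw [SpatialTensor.inl_apply, SpatialTensor.map_tmul, map_one]
    exact h
  dense := SpatialTensor.dense_of_tmul_mem_closure fun a x => subset_closure
    (Submodule.subset_span ⟨a, x, (SpatialTensor.inl_mul_inr a x).symm⟩)

variable {n : ℕ} {R : Type u} [CStarAlgebra R] {P : Matrix (Fin n) (Fin n) ℂ}
  {J : EuclideanSpace ℂ (Fin n) ≃ₛₗ[starRingEnd ℂ] EuclideanSpace ℂ (Fin n)}

theorem ip_matrixMap {v : Matrix (Fin n) (Fin n) R} (hv : v.conjTranspose * v = 1)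
    (ξ η : EuclideanSpace ℂ (Fin n)) :
    ModTensor.ip (matrixMap v ξ) (matrixMap v η) =
      SpatialTensor.inl ℂ R (HilbertModule.ip ξ η) := by
  have h1 : ∀ j i : Fin n, ModTensor.ip (matrixMap v (EuclideanSpace.single j 1))
      (matrixMap v (EuclideanSpace.single i 1)) =
      SpatialTensor.inl ℂ R (HilbertModule.ip (EuclideanSpace.single j (1 : ℂ))
        (EuclideanSpace.single i (1 : ℂ))) := fun j i => by
    rw [ip_matrixMap_single, hv, ip_single, SpatialTensor.inl_apply, SpatialTensor.tmul_complex,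
      Matrix.one_apply, ite_smul, one_smul, zero_smul]
  -- Linearity extends from basis vectors in the second variable; the first variable is then reached
  -- by taking adjoints.
  have h2 : ∀ ζ : EuclideanSpace ℂ (Fin n),
      (∀ i, ModTensor.ip (matrixMap v ζ) (matrixMap v (EuclideanSpace.single i 1)) =
        SpatialTensor.inl ℂ R (HilbertModule.ip ζ (EuclideanSpace.single i (1 : ℂ)))) →
      ∀ η, ModTensor.ip (matrixMap v ζ) (matrixMap v η) =
        SpatialTensor.inl ℂ R (HilbertModule.ip ζ η) := fun ζ hζ η => by
    have h3 : (ModTensor.ipₗ _ _ _ (matrixMap v ζ)).comp (matrixMap v) =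
        (SpatialTensor.inl ℂ R).toAlgHom.toLinearMap.comp (HilbertModule.ipₛₗ ℂ _ ζ) :=
      euclidean_ext hζ
    exact LinearMap.congr_fun h3 η
  refine h2 ξ (fun i => ?_) η
  rw [← ModTensor.star_ip', h2 _ (h1 i), ← map_star, HilbertModule.star_ip]

theorem map_act_matrixMap (v : Matrix (Fin n) (Fin n) R) (ξ : EuclideanSpace ℂ (Fin n)) (a : ℂ) :
    matrixMap v (MulOpposite.op a • ξ) =
      MulOpposite.op (SpatialTensor.inl ℂ R a) • matrixMap v ξ := by
  have h : SpatialTensor.inl ℂ R a = a • (1 : SpatialTensor ℂ R) := by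
    rw [SpatialTensor.inl_apply, SpatialTensor.one_def, ← SpatialTensor.smul_tmul, smul_eq_mul,
      mul_one]
  rw [op_smul_euclidean, map_smul, h, HilbertModule.op_complex_smul_smul, MulOpposite.op_one,
    one_smul]

/-- From `v v⋆ = 1`, `e l ⊗ x = ∑ i, β(e i) (1 ⊗ (v⋆ i l) x)`, so the span already contains all
elementary tensors. -/
theorem dense_span_matrixMap {v : Matrix (Fin n) (Fin n) R} (hv : v * v.conjTranspose = 1) :
    Dense (Submodule.span ℂ {z | ∃ (ξ : EuclideanSpace ℂ (Fin n)) (x : R),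
      z = MulOpposite.op (SpatialTensor.tmul (1 : ℂ) x) • matrixMap v ξ} :
      Set (ModTensor ℂ (EuclideanSpace ℂ (Fin n)) R)) := by
  refine ModTensor.dense_of_tmul_mem fun ξ x => ?_
  rw [euclidean_eq_sum ξ, ModTensor.sum_tmul]
  refine Submodule.sum_mem _ fun l _ => ?_
  rw [ModTensor.smul_tmul]
  refine Submodule.smul_mem _ _ ?_
  have h : (ModTensor.tmul (EuclideanSpace.single l (1 : ℂ)) x :
      ModTensor ℂ (EuclideanSpace ℂ (Fin n)) R) = ∑ i, MulOpposite.op (SpatialTensor.tmul (1 : ℂ)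
        (v.conjTranspose i l * x)) • matrixMap v (EuclideanSpace.single i 1) := by
    simp only [act_matrixMap_single]
    rw [Finset.sum_comm]
    simp only [← ModTensor.tmul_sum, ← mul_assoc, ← Finset.sum_mul, ← Matrix.mul_apply, hv]
    rw [Finset.sum_eq_single l]
    · rw [Matrix.one_apply_eq, one_mul]
    · intro k _ hk
      rw [Matrix.one_apply_ne hk, zero_mul]
      exact congrArg _ (TensorProduct.tmul_zero _ _)
    · intro hl
      exact absurd (Finset.mem_univ l) hl
  rw [h]
  exact Submodule.sum_mem _ fun i _ => Submodule.subset_span ⟨_, _, rfl⟩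

theorem ip_single_matrixMap (v : Matrix (Fin n) (Fin n) R) (l i : Fin n) :
    ModTensor.ip (ModTensor.tmul (EuclideanSpace.single l (1 : ℂ)) 1)
      (matrixMap v (EuclideanSpace.single i 1)) = SpatialTensor.inr ℂ R (v l i) := by
  rw [matrixMap_apply, ip_single_coe, algMatrixMap_single, coord_sum]

/-- If `span {β(ℂⁿ) (1 ⊗ R)}` is dense for the map `β` of the matrix `v`, then `v` has no left
annihilator. -/
theorem eq_zero_of_mul_eq_zero_of_dense {p v : Matrix (Fin n) (Fin n) R}
    (hv : Dense (Submodule.span ℂ {z | ∃ (ξ : EuclideanSpace ℂ (Fin n)) (x : R),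
      z = MulOpposite.op (SpatialTensor.tmul (1 : ℂ) x) • matrixMap v ξ} :
      Set (ModTensor ℂ (EuclideanSpace ℂ (Fin n)) R))) (hp : p * v = 0) (k l : Fin n) :
    p k l = 0 := by
  -- `T` applies row `k` of `p` to the coordinates. Writing these as inner products defines it on
  -- the whole completion, where it is continuous and vanishes on the dense span.
  let T : ModTensor ℂ (EuclideanSpace ℂ (Fin n)) R →ₗ[ℂ] SpatialTensor ℂ R :=
    ∑ l, (LinearMap.mulLeft ℂ (SpatialTensor.inr ℂ R (p k l))).comp
      (ModTensor.ipₗ _ _ _ (ModTensor.tmul (EuclideanSpace.single l (1 : ℂ)) 1))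
  have hT : ∀ z, T z = ∑ l, SpatialTensor.inr ℂ R (p k l) *
      ModTensor.ip (ModTensor.tmul (EuclideanSpace.single l (1 : ℂ)) 1) z := fun z => by
    simp only [T, LinearMap.sum_apply]
    rfl
  have hTc : Continuous T := by
    rw [show ⇑T = _ from funext hT]
    exact continuous_finsetSum _ fun l _ =>
      continuous_const.mul (continuous_const.modTensor_ip continuous_id)
  have hTv : T.comp (matrixMap v) = 0 := euclidean_ext fun i => by
    rw [LinearMap.comp_apply, hT, LinearMap.zero_apply]
    simp only [ip_single_matrixMap, ← map_mul, ← map_sum]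
    rw [← Matrix.mul_apply, hp, Matrix.zero_apply, map_zero]
  have hTD : ∀ z, T z = 0 := by
    have h1 : Submodule.span ℂ {z | ∃ (ξ : EuclideanSpace ℂ (Fin n)) (x : R),
        z = MulOpposite.op (SpatialTensor.tmul (1 : ℂ) x) • matrixMap v ξ} ≤ LinearMap.ker T := by
      rw [Submodule.span_le]
      rintro _ ⟨ξ, x, rfl⟩
      have h2 := LinearMap.congr_fun hTv ξ
      rw [LinearMap.comp_apply, LinearMap.zero_apply, hT] at h2
      change T _ = 0
      rw [hT]
      simp only [ModTensor.op_smul_def, ModTensor.ip_act, ← mul_assoc, ← Finset.sum_mul, h2,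
        zero_mul]
    have h3 : IsClosed (LinearMap.ker T : Set (ModTensor ℂ (EuclideanSpace ℂ (Fin n)) R)) :=
      isClosed_singleton.preimage hTc
    intro z
    exact closure_minimal h1 h3 (hv z)
  -- At `e l ⊗ 1` the value of `T` is the entry `p k l`.
  have h4 := hTD (ModTensor.tmul (EuclideanSpace.single l (1 : ℂ)) 1)
  rw [hT] at h4
  simp only [ModTensor.ip_tmul, ip_single, SpatialTensor.tmul_complex, ← map_mul, ← map_sum] at h4
  have h5 := SpatialTensor.inr_complex_injective R (h4.trans (map_zero _).symm)
  simpa using h5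

/-! ### The antilinear operator -/

variable (R) (J) in
/-- The map `J ⊗ ⋆` on `ℂⁿ ⊙ R`. -/
def algConj : AlgModTensor ℂ (EuclideanSpace ℂ (Fin n)) R →ₗ⋆[ℂ]
    AlgModTensor ℂ (EuclideanSpace ℂ (Fin n)) R :=
  TensorProduct.map J.toLinearMap (starLinearEquiv ℂ (A := R)).toLinearMap

theorem algConj_tmul (ξ : EuclideanSpace ℂ (Fin n)) (x : R) :
    algConj R J (AlgModTensor.tmul ξ x) = AlgModTensor.tmul (J ξ) (star x) := rfl

theorem antilinear_single (i : Fin n) : J (EuclideanSpace.single i 1) =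
    ∑ k, antilinearMatrix J k i • EuclideanSpace.single k (1 : ℂ) :=
  euclidean_eq_sum _

theorem AlgModTensor.sum_smul_tmul (c : Fin n → ℂ) (x : R) :
    (AlgModTensor.tmul (∑ k, c k • EuclideanSpace.single k (1 : ℂ)) x :
      AlgModTensor ℂ (EuclideanSpace ℂ (Fin n)) R) =
      ∑ k, AlgModTensor.tmul (EuclideanSpace.single k (1 : ℂ)) (c k • x) :=
  (TensorProduct.sum_tmul _ _ _).trans
    (Finset.sum_congr rfl fun _ _ => TensorProduct.smul_tmul _ _ _)

theorem coord_algConj_algMatrixMap (v : Matrix (Fin n) (Fin n) R) (m i : Fin n) :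
    coord R m (algConj R J (algMatrixMap v (EuclideanSpace.single i 1))) =
      ((antilinearMatrix J).map (algebraMap ℂ R) * v.map star) m i := by
  rw [algMatrixMap_single, map_sum, map_sum, Matrix.mul_apply]
  refine Finset.sum_congr rfl fun k _ => ?_
  rw [algConj_tmul, antilinear_single, AlgModTensor.sum_smul_tmul, coord_sum, Matrix.map_apply,
    Matrix.map_apply, Algebra.smul_def]

theorem coord_algMatrixMap_antilinear (v : Matrix (Fin n) (Fin n) R) (m i : Fin n) :
    coord R m (algMatrixMap v (J (EuclideanSpace.single i 1))) =
      (v * (antilinearMatrix J).map (algebraMap ℂ R)) m i := by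
  rw [antilinear_single, map_sum, map_sum, Matrix.mul_apply]
  refine Finset.sum_congr rfl fun k _ => ?_
  rw [map_smul, map_smul, algMatrixMap_single, coord_sum, Matrix.map_apply, Algebra.smul_def,
    Algebra.commutes]

/-- `P v̄ = v P` is the coordinate form of `(J ⊗ ⋆) β = β J`; both sides are antilinear in `ξ`, so
basis vectors suffice. -/
theorem algConj_algMatrixMap {v : Matrix (Fin n) (Fin n) R}
    (hv : (antilinearMatrix J).map (algebraMap ℂ R) * v.map star =
      v * (antilinearMatrix J).map (algebraMap ℂ R)) (ξ : EuclideanSpace ℂ (Fin n)) :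
    algConj R J (algMatrixMap v ξ) = algMatrixMap v (J ξ) := by
  have h : ((algConj R J).comp (algMatrixMap v) : EuclideanSpace ℂ (Fin n) →ₗ⋆[ℂ]
      AlgModTensor ℂ (EuclideanSpace ℂ (Fin n)) R) = (algMatrixMap v).comp J.toLinearMap :=
    euclidean_ext fun i => by
      refine (sum_coord _).symm.trans ((Finset.sum_congr rfl fun k _ => ?_).trans (sum_coord _))
      rw [LinearMap.comp_apply, LinearMap.comp_apply, coord_algConj_algMatrixMap, hv, ← coord_algMatrixMap_antilinear]
      rfl
  exact LinearMap.congr_fun h ξ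

/-- `W` is kept variable because the supremum of the filtration equals `⊤` only propositionally. -/
theorem exists_algSubTensor_eq {W : Submodule ℂ (EuclideanSpace ℂ (Fin n))} (hW : W = ⊤)
    (z : AlgModTensor ℂ (EuclideanSpace ℂ (Fin n)) R) : ∃ t, algSubTensor ℂ R W t = z := by
  induction z using AlgModTensor.induction with
  | h0 => exact ⟨0, TensorProduct.map _ _ |>.map_zero⟩
  | ht ξ x => exact ⟨(⟨ξ, hW ▸ Submodule.mem_top⟩ : W) ⊗ₜ x, rfl⟩
  | ha z w hz hw =>
    obtain ⟨s, rfl⟩ := hz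
    obtain ⟨t, rfl⟩ := hw
    exact ⟨s + t, TensorProduct.map _ _ |>.map_add s t⟩

theorem algSubTensor_map_J (t : ↥(⨆ i, (euclideanFiltration J).V i) ⊗[ℂ] R) :
    algSubTensor ℂ R _ (TensorProduct.map (euclideanFiltration J).J
      (starLinearEquiv ℂ (A := R)).toLinearMap t) = algConj R J (algSubTensor ℂ R _ t) := by
  induction t with
  | zero =>
    simp only [algSubTensor, map_zero]
    exact (map_zero (algConj R J)).symm
  | add s t hs ht =>
    simp only [algSubTensor, map_add] at hs ht ⊢
    rw [hs, ht]
    exact (map_add (algConj R J) _ _).symm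
  | tmul ξ x => rfl

theorem iSup_euclideanFiltration : (⨆ i, (euclideanFiltration J).V i) = ⊤ :=
  iSup_const

variable [WoronowiczAlgebra R]

/-- The coaction on `ℂⁿ` of a Woronowicz C⋆-algebra with a unitary multiplicative matrix. -/
def matrixCoaction (v : Matrix (Fin n) (Fin n) R) (hv : IsOrthogonalMatrix P v) :
    ModCoaction ℂ (EuclideanSpace ℂ (Fin n)) R where
  α := .trivial ℂ R
  β := matrixMap v
  dense := dense_span_matrixMap hv.mul_star_self
  coassoc ξ := by
    have h : (ModTensor.algTensorId (matrixMap v)).comp (algMatrixMap v) =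
        (ModTensor.map ℂ (EuclideanSpace ℂ (Fin n))
          WoronowiczAlgebra.comul).toLinearMap.comp (matrixMap v) :=
      euclidean_ext fun i => by
        rw [map_matrixMap, LinearMap.comp_apply, algTensorId_matrixMap_single, matrixMap_single]
        simp only [Matrix.map_apply, hv.multiplicative]
    -- `β ξ` already lies in the algebraic tensor product, where the extension is `β ⊙ id` itself.
    have h1 := extendsTo_coe (ModTensor.algTensorId (matrixMap v)) (algMatrixMap v ξ)
    have h2 := LinearMap.congr_fun h ξ
    rw [LinearMap.comp_apply] at h2
    rw [h2] at h1
    exact h1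
  ip_eq := ip_matrixMap hv.star_mul_self
  map_act := map_act_matrixMap v

theorem isFiltrationPreserving_matrixCoaction {v : Matrix (Fin n) (Fin n) R}
    (hv : IsOrthogonalMatrix (antilinearMatrix J) v) :
    IsFiltrationPreserving (euclideanFiltration J) (matrixCoaction v hv) where
  map_τ z := extendsTo_coe (SpatialTensor.algSlice (euclideanFiltration J).τ) (AlgTensor.tmul z 1)
  map_V i ξ _ := by
    obtain ⟨t, ht⟩ := exists_algSubTensor_eq (W := (euclideanFiltration J).V i) rfl
      (algMatrixMap v ξ)
    exact ⟨t, congrArg (ModTensor.ofAlg ℂ _ R) ht.symm⟩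
  map_J ξ := by
    obtain ⟨t, ht⟩ := exists_algSubTensor_eq iSup_euclideanFiltration (algMatrixMap v (ξ : _))
    refine ⟨t, congrArg (ModTensor.ofAlg ℂ _ R) ht.symm, congrArg (ModTensor.ofAlg ℂ _ R) ?_⟩
    rw [algSubTensor_map_J, ht]
    refine algConj_algMatrixMap ?_ _
    conv_rhs => rw [hv.eq_conj]
    rw [mul_assoc, map_algebraMap_inv_mul (isUnit_det_antilinearMatrix J), mul_one]
  map_ξ₀ := ((matrixCoaction v hv).β.map_zero).trans
    (congrArg (ModTensor.ofAlg ℂ _ R) (TensorProduct.zero_tmul _ _)).symm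

/-! ### The matrix of a filtration preserving coaction -/

/-- Unital algebra morphisms out of `ℂ` are unique, so every coaction on `ℂ` is trivial. -/
theorem Coaction.toHom_complex (d : Coaction ℂ R) (z : ℂ) :
    d.toHom z = SpatialTensor.inl ℂ R z :=
  (AlgHomClass.commutes d.toHom z).trans (AlgHomClass.commutes (SpatialTensor.inl ℂ R) z).symm

/-- The matrix exists because `β` maps `V₀ = ℂⁿ` into the algebraic tensor product, so each `β(e i)`
has coordinates in `R`; the axioms are then read off coordinate by coordinate. -/
theorem exists_isOrthogonalMatrix {d : ModCoaction ℂ (EuclideanSpace ℂ (Fin n)) R}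
    (hd : IsFiltrationPreserving (euclideanFiltration J) d) :
    ∃ v : Matrix (Fin n) (Fin n) R, d.β = matrixMap v ∧
      IsOrthogonalMatrix (antilinearMatrix J) v := by
  have h1 : ∀ i, ∃ z : AlgModTensor ℂ (EuclideanSpace ℂ (Fin n)) R,
      d.β (EuclideanSpace.single i 1) = (z : ModTensor ℂ (EuclideanSpace ℂ (Fin n)) R) := fun i => by
    obtain ⟨t, ht⟩ := hd.map_V () (EuclideanSpace.single i 1) trivial
    exact ⟨_, ht⟩
  choose z hz using h1
  let v : Matrix (Fin n) (Fin n) R := Matrix.of fun k i => coord R k (z i)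
  have hβ : d.β = matrixMap v := euclidean_ext fun i => by
    rw [hz, matrixMap_apply, algMatrixMap_single]
    exact congrArg _ (sum_coord _).symm
  have hvv : v.conjTranspose * v = 1 := by
    ext i j
    apply SpatialTensor.inr_complex_injective R
    have h2 := d.ip_eq (EuclideanSpace.single i 1) (EuclideanSpace.single j 1)
    rw [ModTensor.ip_def, hβ, ip_matrixMap_single, Coaction.toHom_complex, ip_single,
      SpatialTensor.inl_apply, SpatialTensor.tmul_complex, ite_smul, one_smul, zero_smul] at h2
    rw [h2, Matrix.one_apply]
  refine ⟨v, hβ, ?_, hvv, ?_, ?_⟩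
  · intro i j
    have h2 := d.coassoc (EuclideanSpace.single j 1)
    rw [hβ, matrixMap_apply] at h2
    -- Comparing the coordinates of the two sides at `e j` gives multiplicativity.
    have h3 := h2.eq_of_continuous (continuous_modTensor_algTensorId _)
    rw [algTensorId_matrixMap_single, ← matrixMap_apply] at h3
    have h4 := LinearMap.congr_fun (map_matrixMap WoronowiczAlgebra.comul v)
      (EuclideanSpace.single j 1)
    rw [matrixMap_single] at h4
    exact eq_of_sum_tmul_eq (h4.symm.trans h3) i
  · ext k l
    -- The inner products only show that `v` is an isometry. The defect `p` annihilates `v`, and the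
    -- density axiom forces it to vanish.
    let p : Matrix (Fin n) (Fin n) R := 1 - v * v.conjTranspose
    have hp : p * v = 0 := by
      rw [sub_mul, one_mul, mul_assoc, hvv, mul_one, sub_self]
    have h2 := eq_zero_of_mul_eq_zero_of_dense (hβ ▸ d.dense) hp k l
    have h3 : p k l = (1 : Matrix (Fin n) (Fin n) R) k l - (v * v.conjTranspose) k l := rfl
    rw [h3] at h2
    exact (sub_eq_zero.1 h2).symm
  · have h2 : (antilinearMatrix J).map (algebraMap ℂ R) * v.map star =
        v * (antilinearMatrix J).map (algebraMap ℂ R) := by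
      ext m i
      -- The axiom provides some representative `t` of `β(e i)`; by injectivity into the completion
      -- its image is the algebraic one, so `J ⊗ ⋆` can be computed in coordinates.
      obtain ⟨t, ht, ht'⟩ := hd.map_J ⟨EuclideanSpace.single i 1,
        iSup_euclideanFiltration (J := J) ▸ Submodule.mem_top⟩
      rw [hβ] at ht ht'
      have h3 := coe_modTensor_injective ht
      have h4 := coe_modTensor_injective ht'
      rw [algSubTensor_map_J, ← h3] at h4
      rw [← coord_algConj_algMatrixMap, ← coord_algMatrixMap_antilinear, h4]
      rfl
    rw [h2, mul_assoc, map_algebraMap_mul_inv (isUnit_det_antilinearMatrix J), mul_one]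

end Coact

/-! ### Initial coactions and universal matrices coincide. -/

section Initial

variable {n : ℕ} {Q R : Type u} [CStarAlgebra Q] [WoronowiczAlgebra Q] [CStarAlgebra R]
  [WoronowiczAlgebra R] {P : Matrix (Fin n) (Fin n) ℂ}
  {J : EuclideanSpace ℂ (Fin n) ≃ₛₗ[starRingEnd ℂ] EuclideanSpace ℂ (Fin n)}

/-- The condition on `α` is automatic, both coactions on `ℂ` being trivial, and a matrix is
determined by its linear map. Hence the two universal properties quantify over the same morphisms.
-/
theorem isCoactionHom_iff {c : ModCoaction ℂ (EuclideanSpace ℂ (Fin n)) Q}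
    {d : ModCoaction ℂ (EuclideanSpace ℂ (Fin n)) R} {u : Matrix (Fin n) (Fin n) Q}
    {v : Matrix (Fin n) (Fin n) R} (hc : c.β = matrixMap u) (hd : d.β = matrixMap v)
    {μ : Q →⋆ₐ[ℂ] R} :
    IsCoactionHom c d μ ↔ IsWoronowiczHom μ ∧ ∀ i j, μ (u i j) = v i j := by
  have h : (∀ ξ, d.β ξ = ModTensor.map ℂ _ μ (c.β ξ)) ↔ ∀ i j, μ (u i j) = v i j := by
    rw [hc, hd]
    constructor
    · intro h i j
      have h1 : matrixMap v = (ModTensor.map ℂ _ μ).toLinearMap.comp (matrixMap u) :=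
        LinearMap.ext h
      rw [map_matrixMap] at h1
      exact (congrFun (congrFun (matrixMap_injective h1) i) j).symm
    · intro h ξ
      have h1 : u.map μ = v := Matrix.ext h
      rw [← h1, ← map_matrixMap]
      rfl
  refine ⟨fun hμ => ⟨hμ.isWoronowiczHom, h.1 hμ.map_β⟩, fun hμ => ⟨hμ.1, fun a => ?_, h.2 hμ.2⟩⟩
  rw [Coaction.toHom_complex, Coaction.toHom_complex, SpatialTensor.inl_apply,
    SpatialTensor.inl_apply, SpatialTensor.map_tmul, map_one]
  rfl

theorem IsFreeOrthogonal.isQuantumSymmetryGroup {u : Matrix (Fin n) (Fin n) Q}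
    (hu : IsFreeOrthogonal (antilinearMatrix J) Q u) :
    IsQuantumSymmetryGroup (euclideanFiltration J) Q (matrixCoaction u hu.isOrthogonalMatrix) where
  isFiltrationPreserving := isFiltrationPreserving_matrixCoaction hu.isOrthogonalMatrix
  existsUnique_hom R _ _ d hd := by
    obtain ⟨v, hdv, hv⟩ := exists_isOrthogonalMatrix hd
    obtain ⟨μ, hμ, hμ'⟩ := hu.universal R v hv
    have hc : (matrixCoaction u hu.isOrthogonalMatrix).β = matrixMap u := rfl
    exact ⟨μ, (isCoactionHom_iff hc hdv).2 hμ, fun ν hν => hμ' ν ((isCoactionHom_iff hc hdv).1 hν)⟩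

theorem IsWoronowiczHom.comp {S : Type u} [CStarAlgebra S] [WoronowiczAlgebra S]
    {ν : R →⋆ₐ[ℂ] S} {μ : Q →⋆ₐ[ℂ] R} (hν : IsWoronowiczHom ν) (hμ : IsWoronowiczHom μ) :
    IsWoronowiczHom (ν.comp μ) := fun a => by
  have h : ∀ z : SpatialTensor Q Q, SpatialTensor.map (ν.comp μ) (ν.comp μ) z =
      SpatialTensor.map ν ν (SpatialTensor.map μ μ z) := fun z => by
    induction z using Completion.induction_on with
    | hp =>
      exact isClosed_eq (continuous_starAlgHom _)
        ((continuous_starAlgHom _).comp (continuous_starAlgHom _))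
    | ih z =>
      induction z using AlgTensor.induction with
      | h0 => simp only [Completion.coe_zero, map_zero]
      | ht a b => simp only [SpatialTensor.coe_tmul, SpatialTensor.map_tmul, StarAlgHom.comp_apply]
      | ha z w hz hw => simp only [Completion.coe_add, map_add, hz, hw]
  rw [h, hμ, hν, StarAlgHom.comp_apply]

theorem IsWoronowiczHom.id : IsWoronowiczHom (StarAlgHom.id ℂ Q) := fun a => by
  have h : ∀ z : SpatialTensor Q Q, SpatialTensor.map (StarAlgHom.id ℂ Q) (StarAlgHom.id ℂ Q) z =
      z := fun z => by
    induction z using Completion.induction_on with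
    | hp => exact isClosed_eq (continuous_starAlgHom _) continuous_id
    | ih z =>
      induction z using AlgTensor.induction with
      | h0 => simp only [Completion.coe_zero, map_zero]
      | ht a b => simp only [SpatialTensor.coe_tmul, SpatialTensor.map_tmul, StarAlgHom.coe_id,
          id_eq]
      | ha z w hz hw => simp only [Completion.coe_add, map_add, hz, hw]
  exact h _

/-- The universal property is a translation of initiality. Generation is not, and is transported
from the algebra of `exists_isFreeOrthogonal`. -/
theorem IsQuantumSymmetryGroup.exists_isFreeOrthogonal
    {c : ModCoaction ℂ (EuclideanSpace ℂ (Fin n)) Q}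
    (hc : IsQuantumSymmetryGroup (euclideanFiltration J) Q c) :
    ∃ u : Matrix (Fin n) (Fin n) Q, c.β = matrixMap u ∧
      IsFreeOrthogonal (antilinearMatrix J) Q u := by
  obtain ⟨u, hcu, hu⟩ := exists_isOrthogonalMatrix hc.isFiltrationPreserving
  have huniv : ∀ (R : Type u) [CStarAlgebra R] [WoronowiczAlgebra R]
      (v : Matrix (Fin n) (Fin n) R), IsOrthogonalMatrix (antilinearMatrix J) v →
      ∃! μ : Q →⋆ₐ[ℂ] R, IsWoronowiczHom μ ∧ ∀ i j, μ (u i j) = v i j := fun R _ _ v hv => by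
    obtain ⟨μ, hμ, hμ'⟩ := hc.existsUnique_hom R (matrixCoaction v hv)
      (isFiltrationPreserving_matrixCoaction hv)
    have hd : (matrixCoaction v hv).β = matrixMap v := rfl
    exact ⟨μ, (isCoactionHom_iff hcu hd).1 hμ,
      fun ν hν => hμ' ν ((isCoactionHom_iff hcu hd).2 hν)⟩
  refine ⟨u, hcu, hu, ?_, huniv⟩
  obtain ⟨Q₀, _, _, u₀, hu₀⟩ := CQG.exists_isFreeOrthogonal.{u} (isUnit_det_antilinearMatrix J)
  obtain ⟨φ, ⟨hφ, hφu⟩, -⟩ := huniv Q₀ u₀ hu₀.isOrthogonalMatrix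
  obtain ⟨ψ, ⟨hψ, hψu⟩, -⟩ := hu₀.universal Q u hu
  -- Both are endomorphisms fixing the entries of `u`, so uniqueness applies; in particular `ψ` is
  -- surjective.
  have hid : ψ.comp φ = StarAlgHom.id ℂ Q :=
    (huniv Q u hu).unique ⟨hψ.comp hφ, fun i j => by rw [StarAlgHom.comp_apply, hφu, hψu]⟩
      ⟨.id, fun i j => rfl⟩
  rw [eq_top_iff]
  intro a _
  have ha : ψ (φ a) = a := DFunLike.congr_fun hid a
  rw [← ha]
  -- By continuity, `ψ` carries the closed ⋆-algebra generated by the entries of `u₀`, which is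
  -- everything, into the one generated by those of `u`.
  refine mem_of_topologicalClosure_eq_top hu₀.generates
    (C := ψ ⁻¹' (StarAlgebra.adjoin ℂ
      (Set.range fun p : Fin n × Fin n => u p.1 p.2)).topologicalClosure)
    (isClosed_closure.preimage (continuous_starAlgHom ψ)) (fun b hb => subset_closure ?_) (φ a)
  have h1 : StarAlgebra.adjoin ℂ (Set.range fun p : Fin n × Fin n => u₀ p.1 p.2) ≤
      (StarAlgebra.adjoin ℂ (Set.range fun p : Fin n × Fin n => u p.1 p.2)).comap ψ :=
    StarAlgebra.adjoin_le (by
      rintro _ ⟨p, rfl⟩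
      exact StarAlgebra.subset_adjoin ℂ _ ⟨p, (hψu p.1 p.2).symm⟩)
  exact h1 hb

end Initial

end CQG

theorem mainTheorem5 (n : ℕ)
    (J : EuclideanSpace ℂ (Fin n) ≃ₛₗ[starRingEnd ℂ] EuclideanSpace ℂ (Fin n)) :
    (∃ (Q : Type u) (_ : CStarAlgebra Q) (_ : CQG.WoronowiczAlgebra Q)
      (u : Matrix (Fin n) (Fin n) Q), CQG.IsFreeOrthogonal (CQG.antilinearMatrix J) Q u) ∧
    (∀ (Q : Type u) [CStarAlgebra Q] [CQG.WoronowiczAlgebra Q] (u : Matrix (Fin n) (Fin n) Q),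
      CQG.IsFreeOrthogonal (CQG.antilinearMatrix J) Q u →
      ∃ c : CQG.ModCoaction ℂ (EuclideanSpace ℂ (Fin n)) Q,
        (∀ z : ℂ, c.α.toHom z = CQG.SpatialTensor.tmul z 1) ∧
        (∀ i, c.β (EuclideanSpace.single i 1) =
          ∑ k, CQG.ModTensor.tmul (EuclideanSpace.single k 1) (u k i)) ∧
        CQG.IsQuantumSymmetryGroup (CQG.euclideanFiltration J) Q c) ∧
    (∀ (Q : Type u) [CStarAlgebra Q] [CQG.WoronowiczAlgebra Q]
      (c : CQG.ModCoaction ℂ (EuclideanSpace ℂ (Fin n)) Q),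
      CQG.IsQuantumSymmetryGroup (CQG.euclideanFiltration J) Q c →
      ∃ u : Matrix (Fin n) (Fin n) Q,
        (∀ i, c.β (EuclideanSpace.single i 1) =
          ∑ k, CQG.ModTensor.tmul (EuclideanSpace.single k 1) (u k i)) ∧
        CQG.IsFreeOrthogonal (CQG.antilinearMatrix J) Q u) := by
  refine ⟨CQG.exists_isFreeOrthogonal (CQG.isUnit_det_antilinearMatrix J),
    fun Q _ _ u hu => ⟨CQG.matrixCoaction u hu.isOrthogonalMatrix, fun z => rfl,
      CQG.matrixMap_single u, hu.isQuantumSymmetryGroup⟩, fun Q _ _ c hc => ?_⟩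
  obtain ⟨u, hcu, hu⟩ := hc.exists_isFreeOrthogonal
  exact ⟨u, fun i => by rw [hcu, CQG.matrixMap_single], hu⟩
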